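/- Let $m\ge 1$ and let $\ell$ be an odd prime such that $3$ is a primitive root modulo $2\ell^m$. Let $q=3^{e}$ with $e=\varphi(2\ell^m)=(\ell-1)\ell^{m-1}$, let $\mathrm{Tr}$ be the trace from $\mathbb F_q$ to $\mathbb F_3$, and let $g$ be a primitive element of $\mathbb F_q$. For $\alpha\in\mathbb F_3$, $\beta\in\mathbb F_q$ put $$D=\{x\in\mathbb F_q^*:\ \mathrm{Tr}(x^{\frac{q-1}{2\ell^m}}+\beta x)=\alpha\},\qquad \mathcal C=\mathcal C_{\alpha,\beta}=\{(\mathrm{Tr}(dx))_{d\in D}:\ x\in\mathbb F_q\}.$$ For $\alpha\neq0$ write $\alpha=(-1)^{T_\alpha}$ with $T_\alpha\in\{0,1\}$. For $\beta\ne0$ let $\mathrm{Ind}(\beta)$ be the least $k\ge0$ with $\beta=g^k$ and let $j_\beta$ be the least nonnegative residue of $-\mathrm{Ind}(\beta)$ modulo $2\ell^m$. Put $J=\{0,\dots,2\ell^m-1\}$, $J_1=\{j:1\le j\le(\ell-1)\ell^{m-1}\}$, $J_2=\{j:(\ell-1)\ell^{m-1}<j\le\ell^m\}$, $J_4=\{j:2\ell^m-\ell^{m-1}<j\le2\ell^m-1\}$,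 and $J_1^{(1)}=\{j\in J_1:\ell^{m-1}\nmid j\}$, $J_1^{(2)}=\{j\in J_1:\ell^{m-1}\mid j,\ 2\nmid j\}$, $J_1^{(3)}=\{j\in J_1:2\ell^{m-1}\mid j\}$, $J_3^{(1)}=\{\ell^m+k\ell^{m-1}-u:1\le k\le\ell-1,\ 0<u\le\ell^{m-1}-1\}$, $J_3^{(2)}=\{\ell^m+k\ell^{m-1}:1\le k\le\ell-1,\ 2\mid k\}$, $J_3^{(3)}=\{\ell^m+k\ell^{m-1}:1\le k\le\ell-1,\ 2\nmid k\}$, $J'=\{0\}\cup J_1^{(1)}\cup J_2\cup J_3^{(1)}\cup J_4$, $J''=J_1^{(1)}\cup(J_2\setminus\{\ell^m\})\cup J_3^{(1)}\cup J_4$. An $[n,k]$ code with weights $w_1,\dots,w_N$ and frequencies $A_{w_1},\dots,A_{w_N}$ means: a ternary linear code of length $n$ and dimension $k$ whose nonzero codewords have exactly the pairwise distinct weights $w_1,\dots,w_N>0$, where the weight $w_i$ occurs for exactly $A_{w_i}>0$ codewords. Below, $k=(\ell-1)\ell^{m-1}$. Then: **(a)** Let $\beta=0$. If $\alpha=0$,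 $m=1$ and $\ell\equiv-1\pmod 3$, then $D$ is empty. Otherwise $\mathcal C$ is a two-weight code: (i) if $\alpha=0$, $\ell\equiv1\pmod3$: $n=\frac{(\ell^m-\ell+1)(q-1)}{\ell^m}$, $w_1=\frac{2(\ell^m-\ell+1)q}{3\ell^m}-\frac{2(\ell-1)\sqrt q}{3\ell^m}$, $w_2=\frac{2(\ell^m-\ell+1)q}{3\ell^m}+\frac{2(\ell^m-\ell+1)\sqrt q}{3\ell^m}$, $A_{w_1}=\frac{(\ell^m-\ell+1)(q-1)}{\ell^m}$, $A_{w_2}=\frac{(\ell-1)(q-1)}{\ell^m}$; (ii) if $\alpha\ne0$, $\ell\equiv1\pmod3$: $n=\frac{(\ell-1)(q-1)}{2\ell^m}$, $w_1=\frac{(\ell-1)q}{3\ell^m}+\frac{(\ell-1)\sqrt q}{3\ell^m}$, $w_2=\frac{(\ell-1)q}{3\ell^m}-\frac{(2\ell^m-\ell+1)\sqrt q}{3\ell^m}$, $A_{w_1}=\frac{(2\ell^m-\ell+1)(q-1)}{2\ell^m}$, $A_{w_2}=\frac{(\ell-1)(q-1)}{2\ell^m}$; (iii) if $\alpha=0$,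 $\ell\equiv-1\pmod3$, $m\ge2$: $n=\frac{(\ell^{m-1}-1)(q-1)}{\ell^{m-1}}$, $w_1=\frac{2(\ell^{m-1}-1)q}{3\ell^{m-1}}+\frac{2(\ell^{m-1}-1)\sqrt q}{3\ell^{m-1}}$, $w_2=\frac{2(\ell^{m-1}-1)q}{3\ell^{m-1}}-\frac{2\sqrt q}{3\ell^{m-1}}$, $A_{w_1}=\frac{q-1}{\ell^{m-1}}$, $A_{w_2}=\frac{(\ell^{m-1}-1)(q-1)}{\ell^{m-1}}$; (iv) if $\alpha\ne0$, $\ell\equiv-1\pmod3$: $n=\frac{q-1}{2\ell^{m-1}}$, $w_1=\frac{q}{3\ell^{m-1}}+\frac{\sqrt q}{3\ell^{m-1}}$, $w_2=\frac{q}{3\ell^{m-1}}-\frac{(2\ell^{m-1}-1)\sqrt q}{3\ell^{m-1}}$, $A_{w_1}=\frac{(2\ell^{m-1}-1)(q-1)}{2\ell^{m-1}}$, $A_{w_2}=\frac{q-1}{2\ell^{m-1}}$. **(b)** Let $\beta\ne0$, $\alpha=0$. If $m=1$ and $\ell\equiv-1\pmod3$, then $n=\frac q3$ and $\mathcal C$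 has two weights $w_1=\frac q3$, $w_2=\frac{2q}9$ with $A_{w_1}=2$, $A_{w_2}=q-3$. Otherwise $\mathcal C$ is a four-weight code with $w_2=\frac{2q}{9}$, $A_{w_1}=2$ and: (i) if $\ell\equiv1\pmod3$, $j_\beta\in J'$: $n=\frac q3+\frac{(\ell-1)\sqrt q}{\ell^m}+\frac{-\ell^m+\ell-1}{\ell^m}$, $w_1=\frac{(\ell-1)(q+\sqrt q)}{3\ell^m}$, $w_3=\frac{2q}9+\frac{\sqrt q}3$, $w_4=\frac{2q}9+\frac{2\sqrt q}3$, $A_{w_2}=\frac{(\ell^m-\ell+1)^2q}{\ell^{2m}}-\frac{(\ell-1)(\ell^m-2\ell+2)\sqrt q}{\ell^{2m}}+\frac{(\ell-1)(\ell^m+\ell-1)}{\ell^{2m}}-3$, $A_{w_3}=\frac{2(\ell-1)(\ell^m-\ell+1)q}{\ell^{2m}}+\frac{2(\ell-1)(\ell^m-2\ell+2)\sqrt q}{\ell^{2m}}-\frac{2(\ell-1)^2}{\ell^{2m}}$, $A_{w_4}=\frac{(\ell-1)^2q}{\ell^{2m}}+\frac{(\ell-1)(-\ell^m+2\ell-2)\sqrt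 q}{\ell^{2m}}+\frac{(\ell-1)(-\ell^m+\ell-1)}{\ell^{2m}}$; (ii) if $\ell\equiv1\pmod3$, $j_\beta\in J\setminus J'$: $n=\frac q3+\frac{(-\ell^m+\ell-1)(\sqrt q+1)}{\ell^m}$, $w_1=\frac{(\ell-1)(q+\sqrt q)}{3\ell^m}-\frac{\sqrt q}3$, $w_3=\frac{2q}9-\frac{\sqrt q}3$, $w_4=\frac{2q}9-\frac{2\sqrt q}3$, $A_{w_2}=\frac{(\ell-1)^2q}{\ell^{2m}}+\frac{(\ell-1)(-3\ell^m+2\ell-2)\sqrt q}{\ell^{2m}}+\sqrt q+\frac{(\ell-1)(-3\ell^m+\ell-1)}{\ell^{2m}}-1$, $A_{w_3}=\frac{2(\ell-1)(\ell^m-\ell+1)q}{\ell^{2m}}+\frac{2(\ell-1)(3\ell^m-2\ell+2)\sqrt q}{\ell^{2m}}-2\sqrt q+\frac{2(\ell-1)(2\ell^m-\ell+1)}{\ell^{2m}}-2$, $A_{w_4}=\frac{(\ell-1)(-2\ell^m+\ell-1)q}{\ell^{2m}}+q+\frac{(\ell-1)(-3\ell^m+2\ell-2)\sqrt q}{\ell^{2m}}+\sqrt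 q+\frac{(\ell-1)(-\ell^m+\ell-1)}{\ell^{2m}}$; (iii) if $m\ge2$, $\ell\equiv-1\pmod3$, $j_\beta\in J''$: $n=\frac q3+\frac{\sqrt q}{\ell^{m-1}}+\frac{1-\ell^{m-1}}{\ell^{m-1}}$, $w_1=\frac{q+\sqrt q}{3\ell^{m-1}}$, $w_3=\frac{2q}9+\frac{\sqrt q}3$, $w_4=\frac{2q}9+\frac{2\sqrt q}3$, $A_{w_2}=\frac{(\ell^{m-1}-1)^2q}{\ell^{2m-2}}+\frac{(2-\ell^{m-1})\sqrt q}{\ell^{2m-2}}+\frac{\ell^{m-1}+1}{\ell^{2m-2}}-3$, $A_{w_3}=\frac{2(\ell^{m-1}-1)q}{\ell^{2m-2}}+\frac{2(\ell^{m-1}-2)\sqrt q}{\ell^{2m-2}}-\frac2{\ell^{2m-2}}$, $A_{w_4}=\frac q{\ell^{2m-2}}+\frac{(2-\ell^{m-1})\sqrt q}{\ell^{2m-2}}+\frac{1-\ell^{m-1}}{\ell^{2m-2}}$; (iv) if $m\ge2$, $\ell\equiv-1\pmod3$, $j_\beta\in J\setminus J''$: $n=\frac q3+\frac{(1-\ell^{m-1})(\sqrt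 q+1)}{\ell^{m-1}}$, $w_1=\frac q{3\ell^{m-1}}+\frac{(1-\ell^{m-1})\sqrt q}{3\ell^{m-1}}$, $w_3=\frac{2q}9-\frac{\sqrt q}3$, $w_4=\frac{2q}9-\frac{2\sqrt q}3$, $A_{w_2}=\frac q{\ell^{2m-2}}+\frac{(2-3\ell^{m-1})\sqrt q}{\ell^{2m-2}}+\sqrt q+\frac{1-3\ell^{m-1}}{\ell^{2m-2}}-1$, $A_{w_3}=\frac{2(\ell^{m-1}-1)q}{\ell^{2m-2}}+\frac{2(3\ell^{m-1}-2)\sqrt q}{\ell^{2m-2}}-2\sqrt q+\frac{2(2\ell^{m-1}-1)}{\ell^{2m-2}}-2$, $A_{w_4}=\frac{(1-2\ell^{m-1})q}{\ell^{2m-2}}+q+\frac{(2-3\ell^{m-1})\sqrt q}{\ell^{2m-2}}+\sqrt q+\frac{1-\ell^{m-1}}{\ell^{2m-2}}$. **(c)** Let $\beta\ne0$, $\alpha\ne0$. If $m=1$, $\ell=5$ and either $T_\alpha=0$, $j_\beta\in\{0\}\cup J_1^{(2)}\cup J_3^{(2)}$, or $T_\alpha=1$, $j_\beta\in\{5\}\cup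 J_1^{(3)}\cup J_3^{(3)}$, then $\mathcal C$ is a $[22,4]$ code with three weights $w_1=12$, $w_2=18$, $w_3=15$ and $A_{w_1}=22$, $A_{w_2}=18$, $A_{w_3}=40$. Otherwise $\mathcal C$ is a four-weight code with $w_2=\frac{2q}9$, $A_{w_1}=2$ and: (i) if $\ell\equiv1\pmod3$ and $(T_\alpha,j_\beta)$ lies in $\{0,1\}\times J'$, $\{0\}\times(J_1^{(3)}\cup J_3^{(3)})$ or $\{1\}\times(J_1^{(2)}\cup J_3^{(2)})$: $n=\frac q3+\frac{(1-\ell)(\sqrt q+1)}{2\ell^m}$, $w_1=\frac{(2\ell^m-\ell+1)q}{6\ell^m}+\frac{(1-\ell)\sqrt q}{6\ell^m}$, $w_3=\frac{2q}9-\frac{\sqrt q}3$, $w_4=\frac{2q}9-\frac{2\sqrt q}3$, $A_{w_2}=\frac{(\ell-1)(-4\ell^m+\ell-1)q}{4\ell^{2m}}+q+\frac{(\ell-1)(-\ell^m+\ell-1)\sqrt q}{2\ell^{2m}}+\frac{(\ell-1)(2\ell^m+\ell-1)}{4\ell^{2m}}-3$, $A_{w_3}=\frac{(\ell-1)(2\ell^m-\ell+1)q}{2\ell^{2m}}+\frac{(\ell-1)(\ell^m-\ell+1)\sqrt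 q}{\ell^{2m}}-\frac{(\ell-1)^2}{2\ell^{2m}}$, $A_{w_4}=\frac{(\ell-1)^2q}{4\ell^{2m}}+\frac{(\ell-1)(-\ell^m+\ell-1)\sqrt q}{2\ell^{2m}}+\frac{(\ell-1)(-2\ell^m+\ell-1)}{4\ell^{2m}}$; (ii) if $\ell\equiv1\pmod3$ and $(T_\alpha,j_\beta)$ lies in $\{1\}\times(J_1^{(3)}\cup J_3^{(3)})$ or $\{0\}\times(J_1^{(2)}\cup J_3^{(2)})$: $n=\frac{q+3\sqrt q}3+\frac{(1-\ell)(\sqrt q+1)}{2\ell^m}$, $w_1=\frac{(2\ell^m-\ell+1)(q+\sqrt q)}{6\ell^m}$, $w_3=\frac{2q}9+\frac{\sqrt q}3$, $w_4=\frac{2q}9+\frac{2\sqrt q}3$, $A_{w_2}=\frac{(\ell-1)^2q}{4\ell^{2m}}+\frac{(\ell-1)(-3\ell^m+\ell-1)\sqrt q}{2\ell^{2m}}+\sqrt q+\frac{(\ell-1)(-6\ell^m+\ell-1)}{4\ell^{2m}}-1$, $A_{w_3}=\frac{(\ell-1)(2\ell^m-\ell+1)q}{2\ell^{2m}}+\frac{(\ell-1)(3\ell^m-\ell+1)\sqrt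 q}{\ell^{2m}}-2\sqrt q+\frac{(\ell-1)(4\ell^m-\ell+1)}{2\ell^{2m}}-2$, $A_{w_4}=\frac{(\ell-1)(\ell-1-4\ell^m)q}{4\ell^{2m}}+q+\frac{(\ell-1)(-3\ell^m+\ell-1)\sqrt q}{2\ell^{2m}}+\sqrt q+\frac{(\ell-1)(\ell-1-2\ell^m)}{4\ell^{2m}}$; (iii) if $\ell\equiv-1\pmod3$, $\ell^m\ne5$ and $(m+T_\alpha,j_\beta)$ lies in $\mathbb Z\times J''$, $(2\mathbb Z)\times(\{\ell^m\}\cup J_1^{(3)}\cup J_3^{(3)})$ or $(2\mathbb Z+1)\times(\{0\}\cup J_1^{(2)}\cup J_3^{(2)})$: $n=\frac q3-\frac{\sqrt q+1}{2\ell^{m-1}}$, $w_1=\frac{(2\ell^{m-1}-1)q-\sqrt q}{6\ell^{m-1}}$, $w_3=\frac{2q}9-\frac{\sqrt q}3$, $w_4=\frac{2q}9-\frac{2\sqrt q}3$, $A_{w_2}=\frac{(-4\ell^{m-1}+1)q}{4\ell^{2m-2}}+q+\frac{(1-\ell^{m-1})\sqrt q}{2\ell^{2m-2}}+\frac{2\ell^{m-1}+1}{4\ell^{2m-2}}-3$,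 $A_{w_3}=\frac{(2\ell^{m-1}-1)q}{2\ell^{2m-2}}+\frac{(\ell^{m-1}-1)\sqrt q}{\ell^{2m-2}}-\frac1{2\ell^{2m-2}}$, $A_{w_4}=\frac q{4\ell^{2m-2}}+\frac{(1-\ell^{m-1})\sqrt q}{2\ell^{2m-2}}+\frac{1-2\ell^{m-1}}{4\ell^{2m-2}}$; (iv) if $\ell\equiv-1\pmod3$ and $(m+T_\alpha,j_\beta)$ lies in $(2\mathbb Z)\times(\{0\}\cup J_1^{(2)}\cup J_3^{(2)})$ or $(2\mathbb Z+1)\times(\{\ell^m\}\cup J_1^{(3)}\cup J_3^{(3)})$: $n=\frac{q+3\sqrt q}3-\frac{\sqrt q+1}{2\ell^{m-1}}$, $w_1=\frac{(2\ell^{m-1}-1)(q+\sqrt q)}{6\ell^{m-1}}$, $w_3=\frac{2q}9+\frac{\sqrt q}3$, $w_4=\frac{2q}9+\frac{2\sqrt q}3$, $A_{w_2}=\frac q{4\ell^{2m-2}}+\frac{(1-3\ell^{m-1})\sqrt q}{2\ell^{2m-2}}+\sqrt q+\frac{1-6\ell^{m-1}}{4\ell^{2m-2}}-1$, $A_{w_3}=\frac{(2\ell^{m-1}-1)q}{2\ell^{2m-2}}+\frac{(3\ell^{m-1}-1)\sqrt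 q}{\ell^{2m-2}}-2\sqrt q+\frac{4\ell^{m-1}-1}{2\ell^{2m-2}}-2$, $A_{w_4}=\frac{(1-4\ell^{m-1})q}{4\ell^{2m-2}}+q+\frac{(1-3\ell^{m-1})\sqrt q}{2\ell^{2m-2}}+\sqrt q+\frac{1-2\ell^{m-1}}{4\ell^{2m-2}}$. -/

import Mathlib

namespace TernaryCode

section Codes

variable {F : Type*} [Field F] [Fintype F] [Algebra (ZMod 3) F]

/-- The defining set `{x ≠ 0 : Tr (x ^ ((q - 1) / N) + β x) = α}`, where `q` is the size of `F`
and `Tr` is the absolute trace to the field with three elements. -/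
noncomputable def definingSet (N : ℕ) (α : ZMod 3) (β : F) : Finset F :=
  open Classical in
  Finset.univ.filter fun x : F =>
    x ≠ 0 ∧ Algebra.trace (ZMod 3) F (x ^ ((Fintype.card F - 1) / N) + β * x) = α

/-- The ternary code `{(Tr (d x))_{d ∈ D} : x ∈ F}` with defining set `D`. Its coordinates are
indexed by the elements of `D`. -/
noncomputable def traceCode (D : Finset F) : Submodule (ZMod 3) (D → ZMod 3) :=
  LinearMap.range
    (LinearMap.pi fun d : D =>
      (Algebra.trace (ZMod 3) F) ∘ₗ (LinearMap.mulLeft (ZMod 3) (d : F)))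

theorem mem_traceCode (D : Finset F) (v : D → ZMod 3) :
    v ∈ traceCode D ↔ ∃ x : F, v = fun d : D => Algebra.trace (ZMod 3) F ((d : F) * x) := by
  constructor
  · rintro ⟨x, rfl⟩
    exact ⟨x, rfl⟩
  · rintro ⟨x, rfl⟩
    exact ⟨x, rfl⟩

/-- The code `C_{α,β}` with defining set `{x ≠ 0 : Tr (x ^ ((q - 1) / (2 ℓ ^ m)) + β x) = α}`. -/
noncomputable abbrev code (ℓ m : ℕ) (α : ZMod 3) (β : F) :
    Submodule (ZMod 3) (definingSet (2 * ℓ ^ m) α β → ZMod 3) :=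
  traceCode (definingSet (2 * ℓ ^ m) α β)

/-- The index of `β ≠ 0` with respect to the primitive element `g`: the least `k ≥ 0` with
`β = g ^ k`. -/
noncomputable def ind (g : Fˣ) (β : F) : ℕ := sInf {k : ℕ | (g : F) ^ k = β}

/-- `j_β`: the least nonnegative residue of `- Ind β` modulo `2 ℓ ^ m`. -/
noncomputable def jRes (ℓ m : ℕ) (g : Fˣ) (β : F) : ℕ :=
  ((-(ind g β : ℤ)) % ((2 * ℓ ^ m : ℕ) : ℤ)).toNat

end Codes

/-- `T_α ∈ {0, 1}` with `α = (-1) ^ T_α`, for `α ≠ 0`. -/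
def signExp (α : ZMod 3) : ℕ := if α = 1 then 0 else 1

theorem signExp_spec (α : ZMod 3) (hα : α ≠ 0) : α = (-1) ^ signExp α := by
  revert α
  decide

/-- `C` is an `[n, k]` ternary code, and its nonzero weights together with their frequencies are
exactly the pairs `(w, A)` of the list `W`: the weights `w` in `W` are positive and pairwise
distinct, each `w` is the weight of exactly `A > 0` codewords, and there are no other nonzero
weights. In particular `C` is an `N`-weight code, where `N` is the length of `W`. -/
structure HasWeightDistribution {ι : Type*} [Fintype ι] (C : Submodule (ZMod 3) (ι → ZMod 3))
    (n : ℝ) (k : ℕ) (W : List (ℝ × ℝ)) : Prop where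
  length_eq : (Fintype.card ι : ℝ) = n
  dim_eq : Module.finrank (ZMod 3) C = k
  weights_distinct : (W.map Prod.fst).Nodup
  weights_pos : ∀ p ∈ W, 0 < p.1
  freq_pos : ∀ p ∈ W, 0 < p.2
  freq_eq : ∀ p ∈ W, (Set.ncard {c : ι → ZMod 3 | c ∈ C ∧ (hammingNorm c : ℝ) = p.1} : ℝ) = p.2
  weights_complete : ∀ c ∈ C, c ≠ 0 → (hammingNorm c : ℝ) ∈ W.map Prod.fst

section Residues

variable (ℓ m : ℕ)

/-- `J = {0, …, 2 ℓ ^ m - 1}`. -/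
def setJ : Set ℕ := {j | j < 2 * ℓ ^ m}

def setJ1 : Set ℕ := {j | 1 ≤ j ∧ j ≤ (ℓ - 1) * ℓ ^ (m - 1)}

def setJ2 : Set ℕ := {j | (ℓ - 1) * ℓ ^ (m - 1) < j ∧ j ≤ ℓ ^ m}

def setJ4 : Set ℕ := {j | 2 * ℓ ^ m - ℓ ^ (m - 1) < j ∧ j ≤ 2 * ℓ ^ m - 1}

/-- `J₁⁽¹⁾`. -/
def setJ11 : Set ℕ := {j | j ∈ setJ1 ℓ m ∧ ¬ ℓ ^ (m - 1) ∣ j}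

/-- `J₁⁽²⁾`. -/
def setJ12 : Set ℕ := {j | j ∈ setJ1 ℓ m ∧ ℓ ^ (m - 1) ∣ j ∧ ¬ 2 ∣ j}

/-- `J₁⁽³⁾`. -/
def setJ13 : Set ℕ := {j | j ∈ setJ1 ℓ m ∧ 2 * ℓ ^ (m - 1) ∣ j}

/-- `J₃⁽¹⁾`. -/
def setJ31 : Set ℕ :=
  {j | ∃ k u : ℕ, 1 ≤ k ∧ k ≤ ℓ - 1 ∧ 0 < u ∧ u ≤ ℓ ^ (m - 1) - 1 ∧
    j = ℓ ^ m + k * ℓ ^ (m - 1) - u}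

/-- `J₃⁽²⁾`. -/
def setJ32 : Set ℕ :=
  {j | ∃ k : ℕ, 1 ≤ k ∧ k ≤ ℓ - 1 ∧ 2 ∣ k ∧ j = ℓ ^ m + k * ℓ ^ (m - 1)}

/-- `J₃⁽³⁾`. -/
def setJ33 : Set ℕ :=
  {j | ∃ k : ℕ, 1 ≤ k ∧ k ≤ ℓ - 1 ∧ ¬ 2 ∣ k ∧ j = ℓ ^ m + k * ℓ ^ (m - 1)}

/-- The set `{0} ∪ J₁⁽¹⁾ ∪ J₂ ∪ J₃⁽¹⁾ ∪ J₄`. -/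
def setJp : Set ℕ := {0} ∪ setJ11 ℓ m ∪ setJ2 ℓ m ∪ setJ31 ℓ m ∪ setJ4 ℓ m

/-- The set `J₁⁽¹⁾ ∪ (J₂ \ {ℓ ^ m}) ∪ J₃⁽¹⁾ ∪ J₄`. -/
def setJpp : Set ℕ := setJ11 ℓ m ∪ (setJ2 ℓ m \ {ℓ ^ m}) ∪ setJ31 ℓ m ∪ setJ4 ℓ m

end Residues

end TernaryCode

open TernaryCode

/-! Write s = √q = 3^f with f = φ(2ℓ^m)/2. Because 3 is a primitive root, s ≡ -1 modulo 2ℓ^m, so s +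
1 = 2ℓ^m·M and the exponent (q-1)/(2ℓ^m) equals (s-1)M. It kills the nonzero elements of the
subfield F_s. Hence the phase a(x) = Tr(x^((q-1)/(2ℓ^m))) - α is constant on the s + 1 punctured
lines of the plane F_q over F_s, and vanishes on some number κ of them.

Averaging the sum of the characters of a(x) + Tr(cx) over the scalars in F_s leaves only the line
where cx has relative trace zero, namely the line through θ/c with θ^s = -θ. So the sum takes just
two values, according to whether a vanishes at θ/c (`phaseSum_of_ne_zero`). Let χ(c) be the
indicator of this event; its support is again a union of κ punctured lines. By orthogonality, the
length of the code depends on κ and χ(β), and the weight of the word of b on κ, χ(β), χ(β+b) and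
χ(β-b). For β = 0 this gives two weights. For β ≠ 0 the words of ±β have one weight, and the others
have a weight depending on χ(β+b) + χ(β-b), which is 0, 1 or 2.

The frequencies are an incidence count in the plane: two distinct lines that both miss a vector γ ≠
0 represent γ exactly once as a sum (`sum_mul_sub`).

The number theory enters through κ and χ(β). The trace of a 2ℓ^m-th root of unity is a Ramanujan sum
(`algebraMap_trace_eq`), which has few values modulo 3; this yields κ. The value χ(β) is read off
from j_β up to the sign (-1)^M, and quadratic reciprocity determines the parity of M
(`even_quotient_iff`). Finally the weight of ±β must differ from the other weights, which fails only
for ℓ^m = 5, α ≠ 0 and χ(β) = 0. -/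

set_option linter.unusedSectionVars false

namespace TernaryCode

open Finset

/-! ### Roots of unity, the subfield of index two and the trace -/

section FieldFacts

theorem charP_three (F : Type*) [Field F] [Algebra (ZMod 3) F] : CharP F 3 :=
  charP_of_injective_algebraMap (algebraMap (ZMod 3) F).injective 3

variable {F : Type*} [Field F] [Fintype F]

theorem sum_mul_left_eq {M : Type*} [AddCommMonoid M] {k : F} (hk : k ≠ 0) (h : F → M) :
    ∑ x, h (k * x) = ∑ x, h x :=
  Equiv.sum_comp (Equiv.mulLeft₀ k hk) h

theorem exists_isPrimitiveRoot_of_dvd {d : ℕ} (hd : d ∣ Fintype.card F - 1) :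
    ∃ ζ : F, IsPrimitiveRoot ζ d := by
  obtain ⟨g, hg⟩ := IsCyclic.exists_generator (α := Fˣ)
  have hpos : 0 < Fintype.card F - 1 := Nat.sub_pos_of_lt Fintype.one_lt_card
  have h1 : IsPrimitiveRoot (g : F) (Fintype.card F - 1) := by
    rw [IsPrimitiveRoot.coe_units_iff, IsPrimitiveRoot.iff_orderOf,
      orderOf_eq_card_of_forall_mem_zpowers hg, Nat.card_units, Nat.card_eq_fintype_card]
  obtain ⟨c, hc⟩ := hd
  exact ⟨_, h1.pow hpos (by rw [hc, mul_comm])⟩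

open scoped Classical in
theorem card_filter_pow_eq_one {d : ℕ} (hd : d ∣ Fintype.card F - 1) :
    #{x : F | x ^ d = 1} = d := by
  have hpos : 0 < Fintype.card F - 1 := Nat.sub_pos_of_lt Fintype.one_lt_card
  have hd0 : 0 < d := Nat.pos_of_dvd_of_pos hd hpos
  obtain ⟨ζ, hζ⟩ := exists_isPrimitiveRoot_of_dvd hd
  refine Eq.trans ?_ hζ.card_nthRootsFinset
  congr 1
  ext x
  simp [Polynomial.mem_nthRootsFinset hd0]

open scoped Classical in
theorem card_filter_pow_eq_neg_one [CharP F 3] {d : ℕ} (hd : 2 * d ∣ Fintype.card F - 1) :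
    #{x : F | x ^ d = -1} = d := by
  have h2 := card_filter_pow_eq_one hd
  have h1 := card_filter_pow_eq_one (F := F) (d := d) (dvd_trans (dvd_mul_left d 2) hd)
  have hne : (-1 : F) ≠ 1 := by
    have := Ring.neg_one_ne_one_of_char_ne_two (R := F) (by rw [ringChar.eq F 3]; decide)
    exact this
  have hu : ({x : F | x ^ (2 * d) = 1} : Finset F)
      = ({x : F | x ^ d = 1} : Finset F) ∪ ({x : F | x ^ d = -1} : Finset F) := by
    ext x
    simp only [mem_filter, mem_univ, true_and, mem_union]
    rw [mul_comm, pow_mul, sq_eq_one_iff]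
  have hdisj : Disjoint ({x : F | x ^ d = 1} : Finset F) ({x : F | x ^ d = -1} : Finset F) := by
    rw [Finset.disjoint_filter]
    intro x _ h h'
    exact hne (h'.symm.trans h)
  rw [hu, card_union_of_disjoint hdisj, h1] at h2
  lia

/-- The subfield of the solutions of `x ^ 3 ^ f = x`. -/
def frobFixed [CharP F 3] (f : ℕ) : Subfield F where
  carrier := {x | x ^ 3 ^ f = x}
  mul_mem' {a b} ha hb := by
    simp only [Set.mem_ofPred_eq] at *
    rw [mul_pow, ha, hb]
  one_mem' := one_pow _
  add_mem' {a b} ha hb := by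
    simp only [Set.mem_ofPred_eq] at *
    rw [add_pow_char_pow, ha, hb]
  zero_mem' := zero_pow (by positivity)
  neg_mem' {a} ha := by
    simp only [Set.mem_ofPred_eq] at *
    rw [Odd.neg_pow (Odd.pow (by decide)), ha]
  inv_mem' a ha := by
    simp only [Set.mem_ofPred_eq] at *
    rw [inv_pow, ha]

theorem mem_frobFixed [CharP F 3] {f : ℕ} {x : F} : x ∈ frobFixed f ↔ x ^ 3 ^ f = x := Iff.rfl

open scoped Classical in
theorem card_frobFixed [CharP F 3] {f : ℕ} (hq : Fintype.card F = (3 ^ f) ^ 2) :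
    Nat.card (frobFixed (F := F) f) = 3 ^ f := by
  have hs : 1 ≤ 3 ^ f := Nat.one_le_pow _ _ (by norm_num)
  have hd : 3 ^ f - 1 ∣ Fintype.card F - 1 := by
    rw [hq]
    simpa using Nat.sub_dvd_pow_sub_pow (3 ^ f) 1 2
  have h1 := card_filter_pow_eq_one hd
  have h2 : ({x : F | x ^ 3 ^ f = x} : Finset F)
      = insert 0 ({x : F | x ^ (3 ^ f - 1) = 1} : Finset F) := by
    ext x
    simp only [mem_filter, mem_univ, true_and, mem_insert]
    have hx : x ^ 3 ^ f = x * x ^ (3 ^ f - 1) := by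
      rw [← pow_succ', Nat.sub_add_cancel hs]
    rw [hx]
    by_cases h0 : x = 0
    · simp [h0]
    · simp [h0]
  have hpos : 3 ^ f - 1 ≠ 0 := by
    intro h
    rw [h] at hd
    have : 0 < Fintype.card F - 1 := Nat.sub_pos_of_lt Fintype.one_lt_card
    have := Nat.eq_zero_of_zero_dvd hd
    lia
  have h3 : (0 : F) ∉ ({x : F | x ^ (3 ^ f - 1) = 1} : Finset F) := by
    simp [zero_pow hpos]
  have h4 : Nat.card (frobFixed (F := F) f) = #{x : F | x ^ 3 ^ f = x} := by
    rw [Nat.card_eq_fintype_card]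
    exact Fintype.card_subtype _
  rw [h4, h2, card_insert_of_notMem h3, h1]
  lia

theorem trace_pow_three_pow [Algebra (ZMod 3) F] (f : ℕ) (x : F) :
    Algebra.trace (ZMod 3) F (x ^ 3 ^ f) = Algebra.trace (ZMod 3) F x := by
  induction f with
  | zero => simp
  | succ f ih =>
    rw [pow_succ, pow_mul, ← ih]
    have h := Algebra.trace_eq_of_algEquiv
      (FiniteField.frobeniusAlgEquivOfAlgebraic (ZMod 3) F) (x ^ 3 ^ f)
    rw [FiniteField.coe_frobeniusAlgEquivOfAlgebraic, ZMod.card] at h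
    exact h

/-- The scalars tested are relative traces k = y + y^s. Invariance of the trace under Frobenius
turns Tr(kz) into Tr(y(z + z^s)), and the trace form is nondegenerate. -/
theorem exists_trace_mul_ne_zero [CharP F 3] [Algebra (ZMod 3) F] {f : ℕ}
    (hq : Fintype.card F = (3 ^ f) ^ 2) {z : F} (hz : z ^ 3 ^ f ≠ -z) :
    ∃ k ∈ frobFixed f, Algebra.trace (ZMod 3) F (k * z) ≠ 0 := by
  have hq2 : ∀ y : F, (y ^ 3 ^ f) ^ 3 ^ f = y := by
    intro y
    rw [← pow_mul, ← sq, ← hq, FiniteField.pow_card]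
  have hne : z + z ^ 3 ^ f ≠ 0 := fun h => hz (eq_neg_of_add_eq_zero_right h)
  have htr := (traceForm_nondegenerate (ZMod 3) F).1 (z + z ^ 3 ^ f)
  simp_rw [Algebra.traceForm_apply] at htr
  by_contra! hf
  refine hne (htr fun y => ?_)
  have hk : y + y ^ 3 ^ f ∈ frobFixed (F := F) f := by
    rw [mem_frobFixed, add_pow_char_pow, hq2, add_comm]
  have h := hf _ hk
  rw [add_mul, map_add, ← trace_pow_three_pow f (y ^ 3 ^ f * z), mul_pow, hq2, ← map_add] at h
  rw [← h]
  congr 1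
  ring

/-- The s-power map negates kz and preserves its trace t, so t = -t in `ZMod 3`. -/
theorem trace_mul_eq_zero [CharP F 3] [Algebra (ZMod 3) F] {f : ℕ} {z k : F}
    (hz : z ^ 3 ^ f = -z) (hk : k ∈ frobFixed f) :
    Algebra.trace (ZMod 3) F (k * z) = 0 := by
  have h := trace_pow_three_pow f (k * z)
  rw [mul_pow, mem_frobFixed.1 hk, hz, mul_neg, map_neg] at h
  generalize Algebra.trace (ZMod 3) F (k * z) = t at h
  revert t
  decide

end FieldFacts

/-! ### Character sums of phases constant on lines -/

section CharacterSums

/-- The sum of the two nontrivial characters of `ZMod 3`. -/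
def charSum (a : ZMod 3) : ℤ := if a = 0 then 2 else -1

theorem charSum_eq (a : ZMod 3) : charSum a = 3 * (if a = 0 then 1 else 0) - 1 := by
  revert a; decide

/-- Orthogonality on (Z/3)²: the nine characters are the trivial one and four conjugate pairs, and
each pair contributes one `charSum`. -/
theorem nine_mul_indicator (a b : ZMod 3) :
    (9 : ℤ) * (if a = 0 ∧ b = 0 then 1 else 0)
      = 1 + charSum b + charSum a + charSum (a + b) + charSum (a - b) := by
  revert a b; decide

variable {F : Type*} [Field F] [Fintype F] [CharP F 3] [Algebra (ZMod 3) F]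

/-- Translating the variable does not change the sum, while the three translates by 0, k₀ and 2k₀
run termwise through all of `ZMod 3`, on which `charSum` adds up to 2 - 1 - 1 = 0. -/
theorem sum_charSum_eq_zero {A : Type*} [Fintype A] [AddCommGroup A] (φ : A →+ ZMod 3)
    (hφ : ∃ k, φ k ≠ 0) (a : ZMod 3) : ∑ k, charSum (a + φ k) = 0 := by
  obtain ⟨k₀, hk₀⟩ := hφ
  have h (r : A) : ∑ k, charSum (a + φ k) = ∑ k, charSum (a + φ k + φ r) := by
    rw [← Equiv.sum_comp (Equiv.addRight r)]
    simp [add_assoc]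
  have h3 : ∑ k, (charSum (a + φ k) + charSum (a + φ k + φ k₀)
      + charSum (a + φ k + φ (k₀ + k₀))) = 0 := by
    refine Finset.sum_eq_zero fun k _ => ?_
    rw [map_add]
    generalize a + φ k = u
    generalize φ k₀ = v at hk₀
    revert u v
    decide
  rw [sum_add_distrib, sum_add_distrib, ← h, ← h] at h3
  lia

open scoped Classical in
theorem sum_frobFixed_charSum {f : ℕ} (hq : Fintype.card F = (3 ^ f) ^ 2) (a : ZMod 3) (z : F) :
    ∑ k : frobFixed (F := F) f, charSum (a + Algebra.trace (ZMod 3) F (k * z))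
      = if z ^ 3 ^ f = -z then 3 ^ f * charSum a else 0 := by
  split_ifs with hz
  · rw [Finset.sum_congr rfl fun k _ => by rw [trace_mul_eq_zero hz k.2, add_zero]]
    rw [sum_const, card_univ, ← Nat.card_eq_fintype_card, card_frobFixed hq]
    simp
  · obtain ⟨k, hk, hne⟩ := exists_trace_mul_ne_zero hq hz
    exact sum_charSum_eq_zero (A := frobFixed (F := F) f)
      { toFun := fun k => Algebra.trace (ZMod 3) F (k * z)
        map_zero' := by simp
        map_add' := fun x y => by simp [add_mul] } ⟨⟨k, hk⟩, hne⟩ a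

/-- A function on `F` is constant on the punctured lines over the subfield. -/
def LineInvariant {X : Type*} (f : ℕ) (a : F → X) : Prop :=
  ∀ k ∈ frobFixed (F := F) f, k ≠ 0 → ∀ x, a (k * x) = a x

open scoped Classical in
/-- The character sum over the nonzero elements attached to the phase `a (x) + Tr (c x)`. -/
noncomputable def phaseSum (a : F → ZMod 3) (c : F) : ℤ :=
  ∑ x : F, if x ≠ 0 then charSum (a x + Algebra.trace (ZMod 3) F (c * x)) else 0

open scoped Classical in
-- The elements counted form one punctured line over the subfield, the line through θ/c.
theorem card_filter_mul_pow {f : ℕ} (hq : Fintype.card F = (3 ^ f) ^ 2)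
    {θ : F} (hθ0 : θ ≠ 0) (hθ : θ ^ 3 ^ f = -θ) {c : F} (hc : c ≠ 0) :
    ∑ x : F, (if x ≠ 0 then (if (c * x) ^ 3 ^ f = -(c * x) then 1 else 0) else 0 : ℤ)
      = 3 ^ f - 1 := by
  have hne : θ / c ≠ 0 := div_ne_zero hθ0 hc
  rw [← sum_mul_left_eq hne]
  have h1 (y : F) : (if θ / c * y ≠ 0 then
      (if (c * (θ / c * y)) ^ 3 ^ f = -(c * (θ / c * y)) then 1 else 0) else 0 : ℤ)
      = (if y ^ 3 ^ f = y then 1 else 0) - (if y = 0 then 1 else 0) := by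
    have h2 : c * (θ / c * y) = y * θ := by field_simp
    rw [h2, mul_pow, hθ]
    have h3 : y ^ 3 ^ f * -θ = -(y * θ) ↔ y ^ 3 ^ f = y := by
      rw [mul_neg, neg_inj, mul_left_inj' hθ0]
    rw [if_congr h3 rfl rfl]
    by_cases hy : y = 0
    · simp [hy]
    · rw [if_pos (mul_ne_zero hne hy), if_neg hy, sub_zero]
  rw [Finset.sum_congr rfl fun y _ => h1 y, sum_sub_distrib]
  have h4 : (#{x : F | x ^ 3 ^ f = x} : ℤ) = 3 ^ f := by
    have : Nat.card (frobFixed (F := F) f) = #{x : F | x ^ 3 ^ f = x} := by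
      rw [Nat.card_eq_fintype_card]
      exact Fintype.card_subtype _
    rw [← this, card_frobFixed hq]
    push_cast
    rfl
  rw [sum_boole, h4]
  simp

open scoped Classical in
-- Replacing x by kx shows that c may be scaled by any nonzero k of the subfield. Adding all these
-- sums together with the one for k = 0 makes the inner sum over k vanish, except on the line
-- through θ/c, where the phase is constant.
theorem phaseSum_of_ne_zero {f : ℕ} (hf : 1 ≤ f) (hq : Fintype.card F = (3 ^ f) ^ 2)
    {a : F → ZMod 3}
    (ha : LineInvariant f a) {θ : F} (hθ0 : θ ≠ 0) (hθ : θ ^ 3 ^ f = -θ) {K : ℤ}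
    (hK : phaseSum a 0 = (3 ^ f - 1) * K) {c : F} (hc : c ≠ 0) :
    phaseSum a c = 3 ^ f * charSum (a (θ / c)) - K := by
  set T := Algebra.trace (ZMod 3) F
  have hs : (3 : ℤ) ≤ 3 ^ f := by
    calc (3 : ℤ) = 3 ^ 1 := by norm_num
      _ ≤ 3 ^ f := pow_le_pow_right₀ (by norm_num) hf
  -- averaging over the scalars
  have h1 (k : F) (hk : k ∈ frobFixed (F := F) f) (hk0 : k ≠ 0) :
      phaseSum a c = ∑ x : F, if x ≠ 0 then charSum (a x + T (k * (c * x))) else 0 := by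
    rw [phaseSum, ← sum_mul_left_eq hk0]
    refine Finset.sum_congr rfl fun x _ => ?_
    simp only [ha k hk hk0, ne_eq, mul_eq_zero, hk0, false_or]
    rw [mul_left_comm]
  -- The s - 1 nonzero scalars give equal sums, and the scalar 0 gives `phaseSum a 0`.
  have h2 : ∑ k : frobFixed (F := F) f, (∑ x : F, if x ≠ 0 then
      charSum (a x + T (k * (c * x))) else 0) = (3 ^ f - 1) * phaseSum a c + phaseSum a 0 := by
    rw [← Finset.add_sum_erase univ _ (mem_univ (0 : frobFixed (F := F) f)), add_comm]
    congr 1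
    · rw [Finset.sum_congr rfl fun (k : frobFixed (F := F) f) hk =>
        (h1 k k.2 (by simpa using (mem_erase.1 hk).1)).symm]
      rw [sum_const, card_erase_of_mem (mem_univ _), card_univ, ← Nat.card_eq_fintype_card,
        card_frobFixed hq, nsmul_eq_mul, Nat.cast_sub (Nat.one_le_pow _ _ (by norm_num))]
      push_cast
      rfl
    · simp [phaseSum, T]
  have h3 : ∑ k : frobFixed (F := F) f, (∑ x : F, if x ≠ 0 then
      charSum (a x + T (k * (c * x))) else 0)
      = ∑ x : F, if x ≠ 0 then
        (if (c * x) ^ 3 ^ f = -(c * x) then 3 ^ f * charSum (a x) else 0) else 0 := by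
    rw [sum_comm]
    refine Finset.sum_congr rfl fun x _ => ?_
    by_cases hx : x = 0
    · simp [hx]
    · simp only [ne_eq, hx, not_false_eq_true, if_true]
      exact sum_frobFixed_charSum hq _ _
  have h4 : ∑ x : F, (if x ≠ 0 then
        (if (c * x) ^ 3 ^ f = -(c * x) then 3 ^ f * charSum (a x) else 0) else 0 : ℤ)
      = 3 ^ f * charSum (a (θ / c)) * (3 ^ f - 1) := by
    rw [← card_filter_mul_pow hq hθ0 hθ hc, mul_sum]
    refine Finset.sum_congr rfl fun x _ => ?_
    by_cases hx : x = 0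
    · simp [hx]
    by_cases hcx : (c * x) ^ 3 ^ f = -(c * x)
    · have hk : c * x / θ ∈ frobFixed (F := F) f := by
        rw [mem_frobFixed, div_pow, hcx, hθ, neg_div_neg_eq]
      have := ha _ hk (div_ne_zero (mul_ne_zero hc hx) hθ0) (θ / c)
      have h5 : c * x / θ * (θ / c) = x := by field_simp
      rw [h5] at this
      simp [hx, hcx, this]
    · simp [hx, hcx]
  rw [h4, h2, hK] at h3
  have h6 : ((3 : ℤ) ^ f - 1) ≠ 0 := by linarith
  apply mul_left_cancel₀ h6
  linarith

end CharacterSums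

/-! ### Counting representations by a union of lines -/

section PairCount

variable {F : Type*} [Field F] [Fintype F] [CharP F 3]

theorem sum_sub_left_eq {A M : Type*} [Fintype A] [AddCommGroup A] [AddCommMonoid M] (c : A)
    (h : A → M) : ∑ x, h (c - x) = ∑ x, h x :=
  Equiv.sum_comp (Equiv.subLeft c) h

open scoped Classical in
-- Two vectors on different lines are independent over the subfield, and since q = s² they form a
-- basis.
theorem exists_eq_add_mul {f : ℕ} (hq : Fintype.card F = (3 ^ f) ^ 2) {γ x : F} (hγ : γ ≠ 0)
    (hx : x / γ ∉ frobFixed (F := F) f) (y : F) :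
    ∃ k ∈ frobFixed (F := F) f, ∃ l ∈ frobFixed (F := F) f, y = k * x + l * γ := by
  let φ : frobFixed (F := F) f × frobFixed (F := F) f → F := fun p => p.1 * x + p.2 * γ
  have hinj : Function.Injective φ := by
    rintro ⟨k, l⟩ ⟨k', l'⟩ h
    simp only [φ] at h
    have h1 : ((k : F) - k') * (x / γ) = l' - l := by
      field_simp
      linear_combination h
    have hk : (k : F) - k' = 0 := by
      by_contra hne
      apply hx
      have : x / γ = ((l' : F) - l) / (k - k') := by
        rw [← h1]
        field_simp
      rw [this]
      exact div_mem (sub_mem l'.2 l.2) (sub_mem k.2 k'.2)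
    rw [hk, zero_mul] at h1
    ext
    · exact sub_eq_zero.1 hk
    · exact (sub_eq_zero.1 h1.symm).symm
  have hbij : Function.Bijective φ := by
    rw [Fintype.bijective_iff_injective_and_card]
    refine ⟨hinj, ?_⟩
    rw [Fintype.card_prod, ← Nat.card_eq_fintype_card, card_frobFixed hq, hq, sq]
  obtain ⟨⟨k, l⟩, h⟩ := hbij.2 y
  exact ⟨k, k.2, l, l.2, h.symm⟩

open scoped Classical in
theorem card_frobFixed_int {f : ℕ} (hq : Fintype.card F = (3 ^ f) ^ 2) :
    (Fintype.card (frobFixed (F := F) f) : ℤ) = 3 ^ f := by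
  rw [← Nat.card_eq_fintype_card, card_frobFixed hq]
  push_cast
  rfl

open scoped Classical in
/-- Splitting a sum into the line through `γ` and its complement. -/
theorem sum_eq_sum_line_add {f : ℕ} {γ : F} (hγ : γ ≠ 0) (h : F → ℤ) :
    ∑ x, h x = ∑ k : frobFixed (F := F) f, h (k * γ)
      + ∑ x, if x / γ ∉ frobFixed (F := F) f then h x else 0 := by
  have h1 : ∑ x, h x = ∑ x, (if x / γ ∈ frobFixed (F := F) f then h x else 0)
      + ∑ x, if x / γ ∉ frobFixed (F := F) f then h x else 0 := by
    rw [← sum_add_distrib]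
    refine sum_congr rfl fun x _ => ?_
    split_ifs <;> simp_all
  rw [h1]
  congr 1
  rw [← sum_mul_left_eq hγ]
  have h2 (x : F) : (if γ * x / γ ∈ frobFixed (F := F) f then h (γ * x) else 0)
      = if x ∈ frobFixed (F := F) f then h (x * γ) else 0 := by
    rw [mul_div_cancel_left₀ _ hγ, mul_comm]
  rw [sum_congr rfl fun x _ => h2 x, ← sum_filter]
  exact (Finset.sum_subtype _ (fun x => by simp) fun x => h (x * γ))

open scoped Classical in
theorem sum_line_const {f : ℕ} (hq : Fintype.card F = (3 ^ f) ^ 2) {g : F → ℤ}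
    (hg : LineInvariant f g) (hg0 : g 0 = 0) (γ : F) :
    ∑ k : frobFixed (F := F) f, g (k * γ) = (3 ^ f - 1) * g γ := by
  have h1 (k : frobFixed (F := F) f) : g (k * γ) = g γ - if k = 0 then g γ else 0 := by
    split_ifs with h
    · simp [h, hg0]
    · rw [hg k k.2 (by simpa using h), sub_zero]
  rw [sum_congr rfl fun k _ => h1 k, sum_sub_distrib, sum_const, card_univ, nsmul_eq_mul,
    card_frobFixed_int hq, sum_ite_eq' univ (0 : frobFixed (F := F) f)]
  simp
  ring

open scoped Classical in
/-- The autocorrelation of the indicator function of a union of punctured lines in a plane. -/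
theorem sum_mul_sub {f : ℕ} (hf : 1 ≤ f) (hq : Fintype.card F = (3 ^ f) ^ 2) {g : F → ℤ}
    (hg : LineInvariant f g) (hg0 : g 0 = 0) (hidem : ∀ x, g x * g x = g x) {γ : F}
    (hγ : γ ≠ 0) {K : ℤ} (hK : ∑ x, g x = (3 ^ f - 1) * K) :
    ∑ x, g x * g (γ - x) = (K - g γ) ^ 2 - (K - g γ) + g γ * (3 ^ f - 2) := by
  have hs : (3 : ℤ) ≤ 3 ^ f := by
    calc (3 : ℤ) = 3 ^ 1 := by norm_num
      _ ≤ 3 ^ f := pow_le_pow_right₀ (by norm_num) hf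
  have hs1 : ((3 : ℤ) ^ f - 1) ≠ 0 := by linarith
  have hneg (x : F) : g (-x) = g x := by
    have := hg (-1) (neg_mem (one_mem _)) (neg_ne_zero.2 one_ne_zero) x
    rwa [neg_one_mul] at this
  set R := frobFixed (F := F) f with hR
  -- W counts the support of g off the line through γ: K - g γ lines with s - 1 points each.
  set W := ∑ x, if x / γ ∉ R then g x else 0 with hWdef
  have hW : W = (3 ^ f - 1) * (K - g γ) := by
    have := sum_eq_sum_line_add (f := f) hγ g
    rw [hK, sum_line_const hq hg hg0] at this
    linear_combination -this
  set P := ∑ x, if x / γ ∉ R then g x * g (γ - x) else 0 with hPdef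
  -- the part on the line
  have hline : ∑ k : R, g (k * γ) * g (γ - k * γ) = g γ * (3 ^ f - 2) := by
    have h1 (k : R) : g (k * γ) * g (γ - k * γ)
        = g γ - (if k = 0 then g γ else 0) - (if k = 1 then g γ else 0) := by
      by_cases h0 : k = 0
      · simp [h0, hg0]
      by_cases h1 : k = 1
      · simp [h1, hg0]
      have h2 : γ - k * γ = (1 - k : F) * γ := by ring
      have h3 : (1 - k : F) ≠ 0 := by
        rw [sub_ne_zero]
        intro h
        exact h1 (Subtype.ext h.symm)
      rw [h2, hg k k.2 (by simpa using h0), hg _ (sub_mem (one_mem _) k.2) h3, hidem]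
      simp [h0, h1]
    rw [sum_congr rfl fun k _ => h1 k, sum_sub_distrib, sum_sub_distrib, sum_const, card_univ,
      nsmul_eq_mul, card_frobFixed_int hq, sum_ite_eq' univ (0 : R), sum_ite_eq' univ (1 : R)]
    simp
    ring
  -- H x counts the support of g on the affine line through -x in direction γ. Off the line of γ it
  -- should equal K - g γ, since such an affine line meets every other line through 0 exactly once.
  set H : F → ℤ := fun x => ∑ k : R, g (k * γ - x) with hH
  have hPk (k : F) (hk : k ∈ R) (hk0 : k ≠ 0) :
      P = ∑ x, if x / γ ∉ R then g x * g (k * γ - x) else 0 := by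
    rw [← sum_mul_left_eq hk0]
    refine sum_congr rfl fun x _ => ?_
    have h1 : k * x / γ ∈ R ↔ x / γ ∈ R := by
      rw [mul_div_assoc]
      constructor
      · intro h
        have := mul_mem (inv_mem hk) h
        rwa [inv_mul_cancel_left₀ hk0] at this
      · exact mul_mem hk
    rw [h1, hg k hk hk0, ← mul_sub, hg k hk hk0]
  -- Each k ≠ 0 contributes P by homogeneity, and k = 0 contributes W because g is even and
  -- idempotent.
  have hdouble : (3 ^ f - 1) * P + W = ∑ x, if x / γ ∉ R then g x * H x else 0 := by
    have h1 : ∑ x, (if x / γ ∉ R then g x * H x else 0)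
        = ∑ k : R, ∑ x, if x / γ ∉ R then g x * g (k * γ - x) else 0 := by
      rw [sum_comm]
      refine sum_congr rfl fun x _ => ?_
      split_ifs
      · simp
      · rw [hH, mul_sum]
    rw [h1, ← Finset.add_sum_erase univ _ (mem_univ (0 : R)), add_comm]
    congr 1
    · refine sum_congr rfl fun x _ => ?_
      simp [hneg, hidem]
    · rw [sum_congr rfl fun (k : R) hk => (hPk k k.2 (by simpa using (mem_erase.1 hk).1)).symm]
      rw [sum_const, card_erase_of_mem (mem_univ _), card_univ, nsmul_eq_mul,
        Nat.cast_sub Fintype.card_pos, card_frobFixed_int hq]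
      simp
  have hcard : ∑ x : F, (if x / γ ∉ R then (1 : ℤ) else 0) = (3 ^ f) * (3 ^ f - 1) := by
    have := sum_eq_sum_line_add (f := f) hγ (fun _ => 1)
    rw [sum_const, card_univ, hq, sum_const, card_univ, nsmul_eq_mul, nsmul_eq_mul,
      card_frobFixed_int hq] at this
    push_cast at this
    linear_combination -this
  have hHsum : ∑ x, (if x / γ ∉ R then H x else 0) = 3 ^ f * W := by
    have h1 : ∑ x, (if x / γ ∉ R then H x else 0)
        = ∑ k : R, ∑ x, if x / γ ∉ R then g (k * γ - x) else 0 := by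
      rw [sum_comm]
      refine sum_congr rfl fun x _ => ?_
      split_ifs
      · simp
      · rfl
    have h2 (k : R) : ∑ x, (if x / γ ∉ R then g (k * γ - x) else 0) = W := by
      rw [← sum_sub_left_eq ((k : F) * γ)]
      refine sum_congr rfl fun x _ => ?_
      have h3 : (k * γ - x) / γ ∈ R ↔ x / γ ∈ R := by
        rw [sub_div, mul_div_cancel_right₀ _ hγ]
        constructor
        · intro h
          have := sub_mem k.2 h
          rwa [sub_sub_cancel] at this
        · exact sub_mem k.2
      rw [h3, sub_sub_cancel]
    rw [h1, sum_congr rfl fun k _ => h2 k, sum_const, card_univ, nsmul_eq_mul,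
      card_frobFixed_int hq]
  obtain ⟨x₀, hx₀⟩ : ∃ x₀ : F, x₀ / γ ∉ R := by
    by_contra! hall
    have : ∑ x : F, (if x / γ ∉ R then (1 : ℤ) else 0) = 0 :=
      sum_eq_zero fun x _ => by simp [hall x]
    rw [hcard] at this
    have : (0 : ℤ) < 3 ^ f * (3 ^ f - 1) := mul_pos (by linarith) (by linarith)
    linarith
  -- Affine lines parallel to γ and missing 0 are permuted transitively by scalars; j ↦ kj + l
  -- matches their points.
  have hHconst (x : F) (hx : x / γ ∉ R) : H x = H x₀ := by
    obtain ⟨k, hk, l, hl, rfl⟩ := exists_eq_add_mul hq hγ hx₀ x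
    have hk0 : k ≠ 0 := by
      rintro rfl
      apply hx
      rw [zero_mul, zero_add, mul_div_cancel_right₀ _ hγ]
      exact hl
    simp only [hH]
    let e : R ≃ R := (Equiv.mulLeft₀ (⟨k, hk⟩ : R)
      (by simpa [Subtype.ext_iff] using hk0)).trans (Equiv.addRight ⟨l, hl⟩)
    rw [← Equiv.sum_comp e]
    refine sum_congr rfl fun j _ => ?_
    have h1 : ((e j : R) : F) = k * j + l := rfl
    rw [h1, ← hg k hk hk0 (j * γ - x₀)]
    congr 1
    ring
  have hH0 : (3 ^ f - 1) * H x₀ = W := by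
    have h1 : ∑ x, (if x / γ ∉ R then H x else 0)
        = (∑ x : F, (if x / γ ∉ R then (1 : ℤ) else 0)) * H x₀ := by
      rw [sum_mul]
      refine sum_congr rfl fun x _ => ?_
      split_ifs with h
      · simp
      · rw [hHconst x h, one_mul]
    rw [hHsum, hcard, mul_assoc] at h1
    exact (mul_left_cancel₀ (by positivity) h1).symm
  have hH1 : H x₀ = K - g γ := mul_left_cancel₀ hs1 (hH0.trans hW)
  have hgH : ∑ x, (if x / γ ∉ R then g x * H x else 0) = W * (K - g γ) := by
    rw [hWdef, sum_mul]
    refine sum_congr rfl fun x _ => ?_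
    split_ifs with h
    · simp
    · rw [hHconst x h, hH1]
  have hP : P = (K - g γ) ^ 2 - (K - g γ) := by
    apply mul_left_cancel₀ hs1
    rw [hgH, hW] at hdouble
    linear_combination hdouble
  rw [sum_eq_sum_line_add (f := f) hγ, hline, ← hP]
  ring

end PairCount

/-! ### Lengths and weights in terms of phase sums -/

section Weights

variable {F : Type*} [Field F] [Fintype F] [CharP F 3] [Algebra (ZMod 3) F]

open scoped Classical in
theorem sum_charSum_trace_mul {b : F} (hb : b ≠ 0) :
    ∑ x : F, charSum (Algebra.trace (ZMod 3) F (b * x)) = 0 := by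
  have htr := (traceForm_nondegenerate (ZMod 3) F).1 b
  simp_rw [Algebra.traceForm_apply] at htr
  have h : ∃ k, Algebra.trace (ZMod 3) F (b * k) ≠ 0 := by
    by_contra! hf
    exact hb (htr hf)
  have := sum_charSum_eq_zero (A := F)
    { toFun := fun k => Algebra.trace (ZMod 3) F (b * k)
      map_zero' := by simp
      map_add' := fun x y => by simp [mul_add] } h 0
  simpa using this

open scoped Classical in
theorem three_mul_card_eq (a : F → ZMod 3) (β : F) :
    (3 : ℤ) * #{x : F | x ≠ 0 ∧ a x + Algebra.trace (ZMod 3) F (β * x) = 0}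
      = Fintype.card F - 1 + phaseSum a β := by
  have h (x : F) : (3 : ℤ) * (if x ≠ 0 ∧ a x + Algebra.trace (ZMod 3) F (β * x) = 0 then 1 else 0)
      = 1 - (if x = 0 then 1 else 0) +
        if x ≠ 0 then charSum (a x + Algebra.trace (ZMod 3) F (β * x)) else 0 := by
    rw [charSum_eq]
    by_cases hx : x = 0
    · simp [hx]
    · simp [hx]
  rw [← sum_boole, mul_sum, sum_congr rfl fun x _ => h x, sum_add_distrib, sum_sub_distrib]
  simp [phaseSum]

open scoped Classical in
theorem nine_mul_card_eq (a : F → ZMod 3) (β : F) {b : F} (hb : b ≠ 0) :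
    (9 : ℤ) * #{x : F | x ≠ 0 ∧ a x + Algebra.trace (ZMod 3) F (β * x) = 0
        ∧ Algebra.trace (ZMod 3) F (b * x) = 0}
      = Fintype.card F - 3 + phaseSum a β + phaseSum a (β + b) + phaseSum a (β - b) := by
  set T := Algebra.trace (ZMod 3) F
  have h (x : F) : (9 : ℤ) * (if x ≠ 0 ∧ a x + T (β * x) = 0 ∧ T (b * x) = 0 then 1 else 0)
      = 1 - (if x = 0 then 1 else 0) + (charSum (T (b * x)) - if x = 0 then 2 else 0)
        + (if x ≠ 0 then charSum (a x + T (β * x)) else 0)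
        + (if x ≠ 0 then charSum (a x + T ((β + b) * x)) else 0)
        + (if x ≠ 0 then charSum (a x + T ((β - b) * x)) else 0) := by
    by_cases hx : x = 0
    · simp [hx, charSum]
    · simp only [ne_eq, hx, not_false_eq_true, true_and, if_true, if_false, sub_zero]
      rw [nine_mul_indicator, add_mul, sub_mul, map_add, map_sub, add_assoc (a x), add_sub_assoc]
  rw [← sum_boole, mul_sum, sum_congr rfl fun x _ => h x, sum_add_distrib, sum_add_distrib,
    sum_add_distrib, sum_add_distrib, sum_sub_distrib, sum_sub_distrib, sum_charSum_trace_mul hb]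
  simp [phaseSum, T]
  ring

open scoped Classical in
/-- The weight of the codeword of `b` in terms of the phase sums. -/
theorem nine_mul_weight_eq (a : F → ZMod 3) (β : F) {b : F} (hb : b ≠ 0) :
    (9 : ℤ) * #{x : F | (x ≠ 0 ∧ a x + Algebra.trace (ZMod 3) F (β * x) = 0)
        ∧ Algebra.trace (ZMod 3) F (b * x) ≠ 0}
      = 2 * Fintype.card F + 2 * phaseSum a β - phaseSum a (β + b) - phaseSum a (β - b) := by
  have h := Finset.card_filter_add_card_filter_not
    (s := ({x : F | x ≠ 0 ∧ a x + Algebra.trace (ZMod 3) F (β * x) = 0} : Finset F))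
    (fun x => Algebra.trace (ZMod 3) F (b * x) = 0)
  rw [filter_filter, filter_filter] at h
  have h9 := nine_mul_card_eq a β hb
  have h3 := three_mul_card_eq a β
  rw [← h] at h3
  simp only [and_assoc] at *
  push_cast at h3
  linarith

/-- The data of a phase function that is constant on punctured lines over the subfield with
`3 ^ f` elements, where `θ` spans the kernel of the relative trace and the phase vanishes on
exactly `κ` lines. -/
structure PhaseData (f : ℕ) (a : F → ZMod 3) (θ : F) (κ : ℕ) : Prop where
  one_le : 1 ≤ f
  card_eq : Fintype.card F = (3 ^ f) ^ 2
  invariant : LineInvariant f a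
  ne_zero : θ ≠ 0
  pow_eq : θ ^ 3 ^ f = -θ
  phaseSum_zero : phaseSum a 0 = (3 ^ f - 1) * (3 * κ - (3 ^ f + 1))

open scoped Classical in
/-- The indicator function of the elements whose orthogonal line is a zero line of the phase. -/
noncomputable def zeroInd (a : F → ZMod 3) (θ c : F) : ℤ :=
  if c ≠ 0 ∧ a (θ / c) = 0 then 1 else 0

theorem zeroInd_zero (a : F → ZMod 3) (θ : F) : zeroInd a θ 0 = 0 := by simp [zeroInd]

theorem zeroInd_eq_zero_or_one (a : F → ZMod 3) (θ c : F) :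
    zeroInd a θ c = 0 ∨ zeroInd a θ c = 1 := by
  unfold zeroInd
  split_ifs <;> simp

variable {f κ : ℕ} {a : F → ZMod 3} {θ : F}

theorem PhaseData.phaseSum_eq (h : PhaseData f a θ κ) {c : F} (hc : c ≠ 0) :
    phaseSum a c = 3 ^ f * (3 * zeroInd a θ c - 1) - (3 * κ - (3 ^ f + 1)) := by
  rw [phaseSum_of_ne_zero h.one_le h.card_eq h.invariant h.ne_zero h.pow_eq h.phaseSum_zero hc,
    charSum_eq]
  simp [zeroInd, hc]

theorem PhaseData.zeroInd_invariant (h : PhaseData f a θ κ) : LineInvariant f (zeroInd a θ) := by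
  intro k hk hk0 x
  unfold zeroInd
  have h1 : a (θ / (k * x)) = a (θ / x) := by
    rw [← h.invariant k⁻¹ (inv_mem hk) (inv_ne_zero hk0) (θ / x)]
    congr 1
    by_cases hx : x = 0
    · simp [hx]
    · field_simp
  have h2 : (k * x ≠ 0 ∧ a (θ / (k * x)) = 0) ↔ (x ≠ 0 ∧ a (θ / x) = 0) := by
    rw [h1, mul_ne_zero_iff, and_iff_right hk0]
  split_ifs with h3 h4 h4
  · rfl
  · exact absurd (h2.1 h3) h4
  · exact absurd (h2.2 h4) h3
  · rfl

theorem PhaseData.zeroInd_neg (h : PhaseData f a θ κ) (x : F) :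
    zeroInd a θ (-x) = zeroInd a θ x := by
  have := h.zeroInd_invariant (-1) (neg_mem (one_mem _)) (neg_ne_zero.2 one_ne_zero) x
  rwa [neg_one_mul] at this

/-- The involution c ↦ θ/c carries the support of `zeroInd` to the nonzero zeros of the phase, which
the sum at c = 0 counts. -/
theorem PhaseData.sum_zeroInd (h : PhaseData f a θ κ) :
    ∑ x, zeroInd a θ x = (3 ^ f - 1) * κ := by
  classical
  have h1 : ∑ x, zeroInd a θ x = #{x : F | x ≠ 0 ∧ a x + Algebra.trace (ZMod 3) F (0 * x) = 0} := by
    unfold zeroInd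
    rw [sum_boole]
    congr 1
    refine Finset.card_nbij' (fun x => θ / x) (fun x => θ / x) ?_ ?_ ?_ ?_
    · intro x hx
      simp only [coe_filter, mem_univ, true_and, Set.mem_ofPred_eq] at *
      simpa [h.ne_zero] using hx
    · intro x hx
      simp only [coe_filter, mem_univ, true_and, Set.mem_ofPred_eq] at *
      have hx0 := hx.1
      have hθ := h.ne_zero
      simpa [h.ne_zero, div_div_cancel₀ h.ne_zero] using hx
    · intro x hx
      exact div_div_cancel₀ h.ne_zero
    · intro x hx
      exact div_div_cancel₀ h.ne_zero
  have h3 := three_mul_card_eq a 0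
  rw [← h1, h.phaseSum_zero, h.card_eq] at h3
  push_cast at h3
  linarith

end Weights

/-! ### From weights of field elements to weights of codewords -/

section TraceCode

variable {F : Type*} [Field F] [Fintype F] [Algebra (ZMod 3) F]

open scoped Classical in
/-- The weight of the codeword attached to `b` in the trace code with defining set `D`. -/
noncomputable def traceWeight (D : Finset F) (b : F) : ℕ :=
  #{x ∈ D | Algebra.trace (ZMod 3) F (b * x) ≠ 0}

theorem hammingNorm_eq_traceWeight (D : Finset F) (b : F) :
    hammingNorm (fun d : D => Algebra.trace (ZMod 3) F ((d : F) * b)) = traceWeight D b := by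
  classical
  unfold hammingNorm traceWeight
  refine Finset.card_bij (fun i _ => (i : F)) ?_ ?_ ?_
  · intro i hi
    simpa [mul_comm] using hi
  · intro i _ j _ hij
    exact Subtype.ext hij
  · intro x hx
    obtain ⟨hx1, hx2⟩ := mem_filter.1 hx
    exact ⟨⟨x, hx1⟩, by simpa [mul_comm] using hx2, rfl⟩

theorem traceWeight_zero (D : Finset F) : traceWeight D 0 = 0 := by
  simp [traceWeight]

/-- A weight distribution may be counted on the elements `b` parametrizing the codewords. -/
theorem hasWeightDistribution_traceCode {D : Finset F} {n : ℝ} {k : ℕ} {W : List (ℝ × ℝ)}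
    (hn : (#D : ℝ) = n) (hk : Module.finrank (ZMod 3) F = k)
    (hnodup : (W.map Prod.fst).Nodup) (hpos : ∀ p ∈ W, 0 < p.1) (hfpos : ∀ p ∈ W, 0 < p.2)
    (hfreq : ∀ p ∈ W, (Nat.card {b : F // (traceWeight D b : ℝ) = p.1} : ℝ) = p.2)
    (hcomplete : ∀ b : F, b ≠ 0 → (traceWeight D b : ℝ) ∈ W.map Prod.fst) :
    HasWeightDistribution (traceCode D) n k W := by
  set φ : F →ₗ[ZMod 3] (D → ZMod 3) := LinearMap.pi fun d : D =>
      (Algebra.trace (ZMod 3) F) ∘ₗ (LinearMap.mulLeft (ZMod 3) (d : F)) with hφ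
  have hφa (b : F) : φ b = fun d : D => Algebra.trace (ZMod 3) F ((d : F) * b) := rfl
  have hw (b : F) : hammingNorm (φ b) = traceWeight D b := hammingNorm_eq_traceWeight D b
  have hpos' (b : F) (hb : b ≠ 0) : traceWeight D b ≠ 0 := by
    intro h0
    obtain ⟨p, hp, hp1⟩ := List.mem_map.1 (hcomplete b hb)
    have := hpos p hp
    rw [hp1, h0] at this
    simp at this
  -- No nonzero b has weight 0, so codewords correspond bijectively to b; this gives both the
  -- dimension and the frequencies.
  have hinj : Function.Injective φ := by
    rw [← LinearMap.ker_eq_bot, LinearMap.ker_eq_bot']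
    intro b hb
    by_contra hne
    apply hpos' b hne
    rw [← hw, hb, hammingNorm_zero]
  refine ⟨by rw [Fintype.card_coe, hn], ?_, hnodup, hpos, hfpos, ?_, ?_⟩
  · rw [← hk]
    exact LinearMap.finrank_range_of_inj hinj
  · intro p hp
    rw [← hfreq p hp]
    congr 1
    have h1 : {c : D → ZMod 3 | c ∈ traceCode D ∧ (hammingNorm c : ℝ) = p.1}
        = φ '' {b : F | (traceWeight D b : ℝ) = p.1} := by
      ext c
      constructor
      · rintro ⟨⟨b, rfl⟩, hc⟩
        refine ⟨b, ?_, rfl⟩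
        change (traceWeight D b : ℝ) = p.1
        rw [← hw b]
        exact hc
      · rintro ⟨b, hb, rfl⟩
        refine ⟨⟨b, rfl⟩, ?_⟩
        rw [hw b]
        exact hb
    rw [h1, Set.ncard_image_of_injective _ hinj]
    rfl
  · rintro c ⟨b, rfl⟩ hc
    have hb : b ≠ 0 := by
      rintro rfl
      exact hc (map_zero φ)
    have := hcomplete b hb
    rw [← hw b] at this
    exact this

end TraceCode

/-! ### Classes of codewords and their sizes -/

section Classes

variable {F : Type*} [Field F] [Fintype F] [CharP F 3] [Algebra (ZMod 3) F]
variable {f κ : ℕ} {a : F → ZMod 3} {θ β : F}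

open scoped Classical in
/-- The defining set attached to the phase `a` and to `β`. -/
noncomputable def phaseSet (a : F → ZMod 3) (β : F) : Finset F :=
  {x : F | x ≠ 0 ∧ a x + Algebra.trace (ZMod 3) F (β * x) = 0}

theorem three_mul_card_phaseSet (a : F → ZMod 3) (β : F) :
    (3 : ℤ) * #(phaseSet a β) = Fintype.card F - 1 + phaseSum a β :=
  three_mul_card_eq a β

theorem nine_mul_traceWeight (a : F → ZMod 3) (β : F) {b : F} (hb : b ≠ 0) :
    (9 : ℤ) * traceWeight (phaseSet a β) b
      = 2 * Fintype.card F + 2 * phaseSum a β - phaseSum a (β + b) - phaseSum a (β - b) := by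
  classical
  rw [← nine_mul_weight_eq a β hb, traceWeight, phaseSet, filter_filter]

/-- The number of the two elements `β + b` and `β - b` that are orthogonal to a zero line. -/
noncomputable def pairSum (a : F → ZMod 3) (θ β b : F) : ℤ :=
  zeroInd a θ (β + b) + zeroInd a θ (β - b)

theorem PhaseData.two_lt (h : PhaseData f a θ κ) : (3 : ℤ) ≤ 3 ^ f := by
  calc (3 : ℤ) = 3 ^ 1 := by norm_num
    _ ≤ 3 ^ f := pow_le_pow_right₀ (by norm_num) h.one_le

theorem PhaseData.length_of_eq_zero (h : PhaseData f a θ κ) :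
    (#(phaseSet a (0 : F)) : ℤ) = (3 ^ f - 1) * κ := by
  have h1 := three_mul_card_phaseSet a 0
  rw [h.phaseSum_zero, h.card_eq] at h1
  push_cast at h1
  linarith

theorem PhaseData.weight_of_eq_zero (h : PhaseData f a θ κ) {b : F} (hb : b ≠ 0) :
    (3 : ℤ) * traceWeight (phaseSet a (0 : F)) b = 2 * 3 ^ f * (κ - zeroInd a θ b) := by
  have h1 := nine_mul_traceWeight a 0 hb
  rw [zero_add, zero_sub, h.phaseSum_eq hb, h.phaseSum_eq (neg_ne_zero.2 hb), h.zeroInd_neg,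
    h.phaseSum_zero, h.card_eq] at h1
  push_cast at h1
  linarith

theorem PhaseData.length_of_ne_zero (h : PhaseData f a θ κ) (hβ : β ≠ 0) :
    (3 : ℤ) * #(phaseSet a β) = (3 ^ f) ^ 2 + 3 * 3 ^ f * zeroInd a θ β - 3 * κ := by
  have h1 := three_mul_card_phaseSet a β
  rw [h.phaseSum_eq hβ, h.card_eq] at h1
  push_cast at h1
  linarith

theorem add_self_eq_neg (β : F) : β + β = -β := by
  have h3 : (3 : F) = 0 := by exact_mod_cast CharP.cast_eq_zero F 3
  linear_combination β * h3

theorem neg_ne_self {β : F} (hβ : β ≠ 0) : β ≠ -β := by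
  intro h
  rw [← add_self_eq_neg, left_eq_add] at h
  exact hβ h

/-- Here one of β ± b is 0 and the other is 2β = -β, so the exceptional value `phaseSum a 0` enters;
this is why ±β need a weight of their own. -/
theorem PhaseData.weight_of_eq (h : PhaseData f a θ κ) (hβ : β ≠ 0) {b : F}
    (hb : b = β ∨ b = -β) :
    (3 : ℤ) * traceWeight (phaseSet a β) b = 3 ^ f * (3 ^ f - κ + zeroInd a θ β) := by
  have hb0 : b ≠ 0 := by rcases hb with rfl | rfl <;> simpa using hβ
  have h1 := nine_mul_traceWeight a β hb0
  have h2 : phaseSum a (β + b) + phaseSum a (β - b) = phaseSum a (-β) + phaseSum a 0 := by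
    rcases hb with rfl | rfl
    · rw [add_self_eq_neg, sub_self]
    · rw [sub_neg_eq_add, add_self_eq_neg, add_neg_cancel, add_comm]
  rw [sub_sub, h2, h.phaseSum_zero, h.phaseSum_eq hβ, h.phaseSum_eq (neg_ne_zero.2 hβ),
    h.zeroInd_neg, h.card_eq] at h1
  push_cast at h1
  linarith

theorem PhaseData.weight_of_ne (h : PhaseData f a θ κ) (hβ : β ≠ 0) {b : F} (hb : b ≠ 0)
    (h1 : b ≠ β) (h2 : b ≠ -β) :
    (9 : ℤ) * traceWeight (phaseSet a β) b
      = 2 * (3 ^ f) ^ 2 + 3 * 3 ^ f * (2 * zeroInd a θ β - pairSum a θ β b) := by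
  have h3 := nine_mul_traceWeight a β hb
  have h4 : β + b ≠ 0 := fun h => h2 (eq_neg_of_add_eq_zero_right h)
  have h5 : β - b ≠ 0 := fun h => h1 (sub_eq_zero.1 h).symm
  rw [h.phaseSum_eq hβ, h.phaseSum_eq h4, h.phaseSum_eq h5, h.card_eq] at h3
  push_cast at h3
  rw [pairSum]
  linarith

open scoped Classical in
/-- The number of `b` outside the line `{0, β, -β}` with a given value of `pairSum`. -/
noncomputable def classCard (a : F → ZMod 3) (θ β : F) (j : ℤ) : ℕ :=
  #{b : F | (b ≠ 0 ∧ b ≠ β ∧ b ≠ -β) ∧ pairSum a θ β b = j}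

open scoped Classical in
theorem sum_off_line (hβ : β ≠ 0) (h : F → ℤ) :
    ∑ b, (if b ≠ 0 ∧ b ≠ β ∧ b ≠ -β then h b else 0) = ∑ b, h b - h 0 - h β - h (-β) := by
  have h1 (b : F) : (if b ≠ 0 ∧ b ≠ β ∧ b ≠ -β then h b else 0)
      = h b - (if b = 0 then h 0 else 0) - (if b = β then h β else 0)
        - (if b = -β then h (-β) else 0) := by
    by_cases h0 : b = 0
    · subst h0
      simp [hβ.symm, hβ]
    by_cases h2 : b = β
    · subst h2
      simp [hβ, neg_ne_self hβ]
    by_cases h3 : b = -β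
    · subst h3
      simp [hβ, (neg_ne_self hβ).symm]
    simp [h0, h2, h3]
  rw [sum_congr rfl fun b _ => h1 b]
  simp [sum_sub_distrib]

/-- With x = β + b one has β - b = -β - x, because 2β = -β. So this is the autocorrelation of χ at
-β; removing b = 0 costs χ(β), and b = ±β cost nothing since χ(0) = 0. -/
theorem PhaseData.classCard_two (h : PhaseData f a θ κ) (hβ : β ≠ 0) :
    (classCard a θ β 2 : ℤ) = (κ - zeroInd a θ β) ^ 2 - (κ - zeroInd a θ β)
      + zeroInd a θ β * (3 ^ f - 3) := by
  classical
  set χ := zeroInd a θ with hχ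
  have hidem (x : F) : χ x * χ x = χ x := by
    rcases zeroInd_eq_zero_or_one a θ x with h0 | h0 <;> rw [hχ, h0] <;> rfl
  have h1 := sum_mul_sub h.one_le h.card_eq h.zeroInd_invariant (zeroInd_zero a θ) hidem
    (neg_ne_zero.2 hβ) h.sum_zeroInd
  rw [← hχ, show χ (-β) = χ β from h.zeroInd_neg β] at h1
  have h2 : ∑ b, χ (β + b) * χ (β - b) = ∑ x, χ x * χ (-β - x) := by
    refine Eq.symm ?_
    rw [← Equiv.sum_comp (Equiv.addLeft β)]
    refine sum_congr rfl fun b _ => ?_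
    simp only [Equiv.coe_addLeft]
    rw [← add_self_eq_neg, add_sub_add_left_eq_sub]
  have h3 := sum_off_line hβ fun b => χ (β + b) * χ (β - b)
  rw [h2, h1] at h3
  have h4 : (classCard a θ β 2 : ℤ)
      = ∑ b, if b ≠ 0 ∧ b ≠ β ∧ b ≠ -β then χ (β + b) * χ (β - b) else 0 := by
    rw [classCard, ← sum_boole]
    refine sum_congr rfl fun b _ => ?_
    by_cases hb : b ≠ 0 ∧ b ≠ β ∧ b ≠ -β
    · rw [if_pos hb, pairSum]
      rcases zeroInd_eq_zero_or_one a θ (β + b) with h5 | h5 <;>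
      rcases zeroInd_eq_zero_or_one a θ (β - b) with h6 | h6 <;>
      simp [hb, hχ, h5, h6]
    · simp only [hb, false_and, if_false]
  rw [h4, h3]
  have h5 : χ 0 = 0 := zeroInd_zero a θ
  simp only [add_zero, sub_zero, sub_self, h5, mul_zero, hidem, add_neg_cancel, zero_mul]
  ring

/-- The sum of `pairSum` over all b is twice the support of χ. The excluded elements 0, β and -β
account for 2χ(β), χ(β) and χ(β). -/
theorem PhaseData.classCard_one (h : PhaseData f a θ κ) (hβ : β ≠ 0) :
    (classCard a θ β 1 : ℤ) = 2 * ((3 ^ f - 1) * κ - 2 * zeroInd a θ β)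
      - 2 * classCard a θ β 2 := by
  classical
  set χ := zeroInd a θ with hχ
  have h1 : ∑ b, χ (β + b) = (3 ^ f - 1) * κ := by
    rw [← h.sum_zeroInd]
    exact Equiv.sum_comp (Equiv.addLeft β) χ
  have h2 : ∑ b, χ (β - b) = (3 ^ f - 1) * κ := by
    rw [← h.sum_zeroInd]
    exact sum_sub_left_eq β χ
  have h3 := sum_off_line hβ fun b => pairSum a θ β b
  have h4 : ∑ b, pairSum a θ β b = 2 * ((3 ^ f - 1) * κ) := by
    simp only [pairSum, sum_add_distrib]
    rw [← hχ, h1, h2]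
    ring
  have h5 : (classCard a θ β 1 : ℤ) + 2 * classCard a θ β 2
      = ∑ b, if b ≠ 0 ∧ b ≠ β ∧ b ≠ -β then pairSum a θ β b else 0 := by
    rw [classCard, classCard, ← sum_boole, ← sum_boole, mul_sum, ← sum_add_distrib]
    refine sum_congr rfl fun b _ => ?_
    by_cases hb : b ≠ 0 ∧ b ≠ β ∧ b ≠ -β
    · rw [if_pos hb, pairSum]
      rcases zeroInd_eq_zero_or_one a θ (β + b) with h5 | h5 <;>
      rcases zeroInd_eq_zero_or_one a θ (β - b) with h6 | h6 <;>
      simp [hb, h5, h6]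
    · simp only [hb, false_and, if_false, mul_zero, add_zero]
  rw [h3, h4] at h5
  have h6 : χ 0 = 0 := zeroInd_zero a θ
  simp only [pairSum, add_self_eq_neg, sub_neg_eq_add, ← hχ, add_zero, sub_zero, sub_self, h6,
    add_neg_cancel, zero_add] at h5
  rw [show χ (-β) = χ β from h.zeroInd_neg β] at h5
  linarith

theorem PhaseData.classCard_zero (h : PhaseData f a θ κ) (hβ : β ≠ 0) :
    (classCard a θ β 0 : ℤ) = (3 ^ f) ^ 2 - 3 - classCard a θ β 1 - classCard a θ β 2 := by
  classical
  have h3 := sum_off_line hβ fun _ => 1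
  have h5 : (classCard a θ β 0 : ℤ) + classCard a θ β 1 + classCard a θ β 2
      = ∑ b, if b ≠ 0 ∧ b ≠ β ∧ b ≠ -β then 1 else 0 := by
    rw [classCard, classCard, classCard, ← sum_boole, ← sum_boole, ← sum_boole,
      ← sum_add_distrib, ← sum_add_distrib]
    refine sum_congr rfl fun b _ => ?_
    by_cases hb : b ≠ 0 ∧ b ≠ β ∧ b ≠ -β
    · rw [if_pos hb, pairSum]
      rcases zeroInd_eq_zero_or_one a θ (β + b) with h5 | h5 <;>
      rcases zeroInd_eq_zero_or_one a θ (β - b) with h6 | h6 <;>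
      simp [hb, h5, h6]
    · simp only [hb, false_and, if_false, add_zero]
  rw [h3, sum_const, card_univ, h.card_eq] at h5
  simp only [nsmul_eq_mul, mul_one] at h5
  push_cast at h5
  linarith

theorem pairSum_cases (a : F → ZMod 3) (θ β b : F) :
    pairSum a θ β b = 0 ∨ pairSum a θ β b = 1 ∨ pairSum a θ β b = 2 := by
  unfold pairSum
  rcases zeroInd_eq_zero_or_one a θ (β + b) with h5 | h5 <;>
  rcases zeroInd_eq_zero_or_one a θ (β - b) with h6 | h6 <;>
  simp [h5, h6]

/-- The weight of a codeword of `b` outside the line `{0, β, -β}` as a function of `pairSum`. -/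
noncomputable def classWeight (s χ j : ℝ) : ℝ := (2 * s ^ 2 + 3 * s * (2 * χ - j)) / 9

/-- The weight of the codewords of `β` and `-β`. -/
noncomputable def lineWeight (s χ κ : ℝ) : ℝ := s * (s - κ + χ) / 3

theorem PhaseData.weight_cases (h : PhaseData f a θ κ) (hβ : β ≠ 0) (b : F) :
    (b = 0 ∧ (traceWeight (phaseSet a β) b : ℝ) = 0) ∨
    ((b = β ∨ b = -β) ∧ (traceWeight (phaseSet a β) b : ℝ)
      = lineWeight (3 ^ f) (zeroInd a θ β) κ) ∨
    ((b ≠ 0 ∧ b ≠ β ∧ b ≠ -β) ∧ (traceWeight (phaseSet a β) b : ℝ)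
      = classWeight (3 ^ f) (zeroInd a θ β) (pairSum a θ β b)) := by
  by_cases h0 : b = 0
  · exact Or.inl ⟨h0, by rw [h0, traceWeight_zero, Nat.cast_zero]⟩
  by_cases h1 : b = β ∨ b = -β
  · refine Or.inr (Or.inl ⟨h1, ?_⟩)
    have h2 := h.weight_of_eq hβ h1
    have h3 : (3 : ℝ) * traceWeight (phaseSet a β) b = 3 ^ f * (3 ^ f - κ + zeroInd a θ β) := by
      exact_mod_cast h2
    rw [lineWeight]
    linarith
  · push Not at h1
    refine Or.inr (Or.inr ⟨⟨h0, h1⟩, ?_⟩)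
    have h2 := h.weight_of_ne hβ h0 h1.1 h1.2
    have h3 : (9 : ℝ) * traceWeight (phaseSet a β) b
      = 2 * (3 ^ f) ^ 2 + 3 * 3 ^ f * (2 * zeroInd a θ β - pairSum a θ β b) := by
      exact_mod_cast h2
    rw [classWeight]
    linarith

open scoped Classical in
theorem PhaseData.card_weight_eq (h : PhaseData f a θ κ) (hβ : β ≠ 0) (w : ℝ) :
    (Nat.card {b : F // (traceWeight (phaseSet a β) b : ℝ) = w} : ℝ)
      = (if 0 = w then 1 else 0) + (if lineWeight (3 ^ f) (zeroInd a θ β) κ = w then 2 else 0)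
        + (if classWeight (3 ^ f) (zeroInd a θ β) 0 = w then (classCard a θ β 0 : ℝ) else 0)
        + (if classWeight (3 ^ f) (zeroInd a θ β) 1 = w then (classCard a θ β 1 : ℝ) else 0)
        + (if classWeight (3 ^ f) (zeroInd a θ β) 2 = w then (classCard a θ β 2 : ℝ) else 0) := by
  set lw := lineWeight (3 ^ f) (zeroInd a θ β) κ
  set cw := classWeight (3 ^ f) (zeroInd a θ β)
  have hind (b : F) : (if (traceWeight (phaseSet a β) b : ℝ) = w then (1 : ℝ) else 0)
      = (if b = 0 then (if 0 = w then 1 else 0) else 0)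
        + (if b = β then (if lw = w then 1 else 0) else 0)
        + (if b = -β then (if lw = w then 1 else 0) else 0)
        + (if (b ≠ 0 ∧ b ≠ β ∧ b ≠ -β) ∧ pairSum a θ β b = 0 then 1 else 0)
          * (if cw 0 = w then 1 else 0)
        + (if (b ≠ 0 ∧ b ≠ β ∧ b ≠ -β) ∧ pairSum a θ β b = 1 then 1 else 0)
          * (if cw 1 = w then 1 else 0)
        + (if (b ≠ 0 ∧ b ≠ β ∧ b ≠ -β) ∧ pairSum a θ β b = 2 then 1 else 0)
          * (if cw 2 = w then 1 else 0) := by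
    rcases h.weight_cases hβ b with ⟨h0, h1⟩ | ⟨h0, h1⟩ | ⟨h0, h1⟩
    · rw [h1]
      subst h0
      simp [hβ, hβ.symm]
    · rw [h1]
      rcases h0 with h0 | h0
      · subst h0
        simp [hβ, neg_ne_self hβ, lw]
      · subst h0
        simp [hβ, (neg_ne_self hβ).symm, lw]
    · rw [h1]
      rcases pairSum_cases a θ β b with h2 | h2 | h2 <;> simp [h2, h0, cw]
  rw [Nat.card_eq_fintype_card, Fintype.card_subtype, ← sum_boole,
    sum_congr rfl fun b _ => hind b]
  simp only [sum_add_distrib, ← sum_mul, sum_boole, sum_ite_eq', mem_univ, if_true]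
  simp only [classCard, mul_ite, mul_one, mul_zero]
  split_ifs <;> ring

end Classes

/-! ### Weight distributions in terms of the number of zero lines -/

section Distributions

theorem HasWeightDistribution.perm {ι : Type*} [Fintype ι] {C : Submodule (ZMod 3) (ι → ZMod 3)}
    {n : ℝ} {k : ℕ} {W W' : List (ℝ × ℝ)} (h : HasWeightDistribution C n k W) (hW : W.Perm W') :
    HasWeightDistribution C n k W' where
  length_eq := h.length_eq
  dim_eq := h.dim_eq
  weights_distinct := (hW.map Prod.fst).nodup_iff.1 h.weights_distinct
  weights_pos p hp := h.weights_pos p (hW.mem_iff.2 hp)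
  freq_pos p hp := h.freq_pos p (hW.mem_iff.2 hp)
  freq_eq p hp := h.freq_eq p (hW.mem_iff.2 hp)
  weights_complete c hc h0 := (hW.map Prod.fst).mem_iff.1 (h.weights_complete c hc h0)

variable {F : Type*} [Field F] [Fintype F] [CharP F 3] [Algebra (ZMod 3) F]
variable {f κ k : ℕ} {a : F → ZMod 3} {θ β : F}

theorem PhaseData.two_lt_real (h : PhaseData f a θ κ) : (3 : ℝ) ≤ 3 ^ f := by
  exact_mod_cast h.two_lt

open scoped Classical in
theorem PhaseData.card_weight_eq_of_eq_zero (h : PhaseData f a θ κ) (w : ℝ) :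
    (Nat.card {b : F // (traceWeight (phaseSet a (0 : F)) b : ℝ) = w} : ℝ)
      = (if 0 = w then 1 else 0)
        + (if 2 * 3 ^ f * κ / 3 = w then ((3 : ℝ) ^ f) ^ 2 - 1 - (3 ^ f - 1) * κ else 0)
        + (if 2 * 3 ^ f * (κ - 1) / 3 = w then ((3 : ℝ) ^ f - 1) * κ else 0) := by
  have hind (b : F) : (if (traceWeight (phaseSet a (0 : F)) b : ℝ) = w then (1 : ℝ) else 0)
      = (if b = 0 then (if 0 = w then 1 else 0) else 0)
        + (1 - (if b = 0 then 1 else 0) - (zeroInd a θ b : ℝ))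
          * (if 2 * 3 ^ f * (κ : ℝ) / 3 = w then 1 else 0)
        + (zeroInd a θ b : ℝ) * (if 2 * 3 ^ f * ((κ : ℝ) - 1) / 3 = w then 1 else 0) := by
    by_cases h0 : b = 0
    · subst h0
      simp [zeroInd_zero, traceWeight_zero]
    · have h1 := h.weight_of_eq_zero h0
      have h2 : (3 : ℝ) * traceWeight (phaseSet a (0 : F)) b
          = 2 * 3 ^ f * (κ - zeroInd a θ b) := by
        exact_mod_cast h1
      have h3 : (traceWeight (phaseSet a (0 : F)) b : ℝ)
          = 2 * 3 ^ f * (κ - zeroInd a θ b) / 3 := by linarith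
      rw [h3]
      rcases zeroInd_eq_zero_or_one a θ b with h4 | h4 <;> simp [h4, h0]
  have hsum : ∑ b, (zeroInd a θ b : ℝ) = (3 ^ f - 1) * κ := by exact_mod_cast h.sum_zeroInd
  rw [Nat.card_eq_fintype_card, Fintype.card_subtype, ← sum_boole,
    sum_congr rfl fun b _ => hind b]
  simp only [sum_add_distrib, ← sum_mul, sum_sub_distrib, hsum, sum_ite_eq', mem_univ, if_true,
    sum_const, card_univ, h.card_eq, nsmul_eq_mul]
  push_cast
  split_ifs <;> ring

/-- For β = 0 the weight of b depends only on χ(b). The lower bound on κ makes the smaller weight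
positive; the upper bound leaves at least one line outside the support of χ. -/
theorem PhaseData.hasWeightDistribution_of_eq_zero (h : PhaseData f a θ κ)
    (hk : Module.finrank (ZMod 3) F = k) (hκ : 2 ≤ κ) (hκ' : κ ≤ 3 ^ f) :
    HasWeightDistribution (traceCode (phaseSet a (0 : F))) ((3 ^ f - 1) * κ) k
      [(2 * 3 ^ f * κ / 3, ((3 : ℝ) ^ f) ^ 2 - 1 - (3 ^ f - 1) * κ),
       (2 * 3 ^ f * (κ - 1) / 3, ((3 : ℝ) ^ f - 1) * κ)] := by
  have hs := h.two_lt_real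
  have hκr : (2 : ℝ) ≤ κ := by exact_mod_cast hκ
  have hκr' : (κ : ℝ) ≤ 3 ^ f := by exact_mod_cast hκ'
  have hw1 : (0 : ℝ) < 2 * 3 ^ f * κ / 3 := by positivity
  have hw2 : (0 : ℝ) < 2 * 3 ^ f * (κ - 1) / 3 := by
    have : (0 : ℝ) < κ - 1 := by linarith
    positivity
  have hne : (2 * 3 ^ f * κ / 3 : ℝ) ≠ 2 * 3 ^ f * (κ - 1) / 3 := by
    intro h
    have : (3 : ℝ) ^ f = 0 := by linarith
    linarith
  refine hasWeightDistribution_traceCode ?_ hk ?_ ?_ ?_ ?_ ?_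
  · exact_mod_cast h.length_of_eq_zero
  · simpa using hne
  · simp only [List.forall_mem_cons]
    exact ⟨hw1, hw2, by simp⟩
  · simp only [List.forall_mem_cons]
    refine ⟨?_, mul_pos (by linarith) (by linarith), by simp⟩
    have : (((3 : ℝ) ^ f) ^ 2 - 1 - (3 ^ f - 1) * κ) = (3 ^ f - 1) * (3 ^ f + 1 - κ) := by ring
    rw [this]
    exact mul_pos (by linarith) (by linarith)
  · simp only [List.forall_mem_cons]
    refine ⟨?_, ?_, by simp⟩
    · rw [h.card_weight_eq_of_eq_zero, if_neg hw1.ne, if_pos rfl, if_neg hne.symm]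
      ring
    · rw [h.card_weight_eq_of_eq_zero, if_neg hw2.ne, if_pos rfl, if_neg hne]
      ring
  · intro b hb
    have h2 : (3 : ℝ) * traceWeight (phaseSet a (0 : F)) b
        = 2 * 3 ^ f * (κ - zeroInd a θ b) := by
      exact_mod_cast h.weight_of_eq_zero hb
    simp only [List.map_cons, List.map_nil, List.mem_cons, List.not_mem_nil, or_false]
    rcases zeroInd_eq_zero_or_one a θ b with h4 | h4
    · left
      rw [h4] at h2
      push_cast at h2
      linarith
    · right
      rw [h4] at h2
      push_cast at h2
      linarith

theorem PhaseData.hasWeightDistribution_of_distinct (h : PhaseData f a θ κ) (hβ : β ≠ 0)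
    (hk : Module.finrank (ZMod 3) F = k) {n l c₀ c₁ c₂ n₀ n₁ n₂ : ℝ}
    (hn : (#(phaseSet a β) : ℝ) = n)
    (hl : lineWeight (3 ^ f) (zeroInd a θ β) κ = l)
    (hc₀ : classWeight (3 ^ f) (zeroInd a θ β) 0 = c₀)
    (hc₁ : classWeight (3 ^ f) (zeroInd a θ β) 1 = c₁)
    (hc₂ : classWeight (3 ^ f) (zeroInd a θ β) 2 = c₂)
    (hn₀ : (classCard a θ β 0 : ℝ) = n₀) (hn₁ : (classCard a θ β 1 : ℝ) = n₁)
    (hn₂ : (classCard a θ β 2 : ℝ) = n₂)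
    (hl' : 0 < l) (hc₀' : 0 < c₀) (hc₁' : 0 < c₁) (hc₂' : 0 < c₂)
    (hn₀' : 0 < n₀) (hn₁' : 0 < n₁) (hn₂' : 0 < n₂)
    (h0 : l ≠ c₀) (h1 : l ≠ c₁) (h2 : l ≠ c₂) (h01 : c₀ ≠ c₁) (h02 : c₀ ≠ c₂) (h12 : c₁ ≠ c₂) :
    HasWeightDistribution (traceCode (phaseSet a β)) n k
      [(l, 2), (c₀, n₀), (c₁, n₁), (c₂, n₂)] := by
  refine hasWeightDistribution_traceCode hn hk ?_ ?_ ?_ ?_ ?_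
  · simp [h0, h1, h2, h01, h02, h12]
  · simp only [List.forall_mem_cons]
    exact ⟨hl', hc₀', hc₁', hc₂', by simp⟩
  · simp only [List.forall_mem_cons]
    exact ⟨two_pos, hn₀', hn₁', hn₂', by simp⟩
  · simp only [List.forall_mem_cons, h.card_weight_eq hβ, hl, hc₀, hc₁, hc₂, hn₀, hn₁, hn₂]
    simp [h0, h1, h2, h01, h02, h12, h0.symm, h1.symm, h2.symm, h01.symm, h02.symm, h12.symm,
      hl'.ne, hc₀'.ne, hc₁'.ne, hc₂'.ne]
  · intro b hb
    simp only [List.map_cons, List.map_nil, List.mem_cons, List.not_mem_nil, or_false]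
    rcases h.weight_cases hβ b with ⟨h3, -⟩ | ⟨-, h3⟩ | ⟨-, h3⟩
    · exact absurd h3 hb
    · exact Or.inl (h3.trans hl)
    · rcases pairSum_cases a θ β b with h4 | h4 | h4 <;> rw [h4] at h3 <;> push_cast at h3
      · exact Or.inr (Or.inl (h3.trans hc₀))
      · exact Or.inr (Or.inr (Or.inl (h3.trans hc₁)))
      · exact Or.inr (Or.inr (Or.inr (h3.trans hc₂)))

theorem PhaseData.length_real (h : PhaseData f a θ κ) (hβ : β ≠ 0) :
    (3 : ℝ) * #(phaseSet a β) = (3 ^ f) ^ 2 + 3 * 3 ^ f * zeroInd a θ β - 3 * κ := by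
  exact_mod_cast h.length_of_ne_zero hβ

theorem PhaseData.classCard_two_real (h : PhaseData f a θ κ) (hβ : β ≠ 0) :
    (classCard a θ β 2 : ℝ) = (κ - zeroInd a θ β) ^ 2 - (κ - zeroInd a θ β)
      + zeroInd a θ β * (3 ^ f - 3) := by
  exact_mod_cast h.classCard_two hβ

theorem PhaseData.classCard_one_real (h : PhaseData f a θ κ) (hβ : β ≠ 0) :
    (classCard a θ β 1 : ℝ) = 2 * ((3 ^ f - 1) * κ - 2 * zeroInd a θ β)
      - 2 * classCard a θ β 2 := by
  exact_mod_cast h.classCard_one hβ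

theorem PhaseData.classCard_zero_real (h : PhaseData f a θ κ) (hβ : β ≠ 0) :
    (classCard a θ β 0 : ℝ) = (3 ^ f) ^ 2 - 3 - classCard a θ β 1 - classCard a θ β 2 := by
  exact_mod_cast h.classCard_zero hβ

/-- The weight of ±β equals the weight of class j exactly when s + 1 - 3κ = 1 + 3(χ(β) - j). For
χ(β) = 1 the values to exclude are therefore 4, 1 and -2, and for χ(β) = 0 they are 1, -2 and -5. -/
theorem PhaseData.hasWeightDistribution_of_mem (h : PhaseData f a θ κ) (hβ : β ≠ 0)
    (hk : Module.finrank (ZMod 3) F = k) (hχ : zeroInd a θ β = 1)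
    (hκ : 3 ≤ κ) (hκ' : κ + 1 ≤ 3 ^ f)
    (h1 : (3 : ℤ) ^ f + 1 - 3 * κ ≠ -2) (h2 : (3 : ℤ) ^ f + 1 - 3 * κ ≠ 1)
    (h3 : (3 : ℤ) ^ f + 1 - 3 * κ ≠ 4) :
    HasWeightDistribution (traceCode (phaseSet a β)) ((3 ^ f) ^ 2 / 3 + 3 ^ f - κ) k
      [(3 ^ f * (3 ^ f - κ + 1) / 3, 2),
       (2 * (3 ^ f) ^ 2 / 9, (κ - 1) * (κ - 2) + 3 ^ f - 3),
       (2 * (3 ^ f) ^ 2 / 9 + 3 ^ f / 3, 2 * (κ - 1) * (3 ^ f - κ + 1)),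
       (2 * (3 ^ f) ^ 2 / 9 + 2 * 3 ^ f / 3, (3 ^ f - κ) * (3 ^ f - κ + 1))] := by
  have hs := h.two_lt_real
  have hlen := h.length_real hβ
  have hA2 := h.classCard_two_real hβ
  have hA1 := h.classCard_one_real hβ
  have hA0 := h.classCard_zero_real hβ
  have hκr : (3 : ℝ) ≤ κ := by exact_mod_cast hκ
  have hκr' : (κ : ℝ) + 1 ≤ 3 ^ f := by exact_mod_cast hκ'
  have h1' : (3 : ℝ) ^ f + 1 - 3 * κ ≠ -2 := by exact_mod_cast h1
  have h2' : (3 : ℝ) ^ f + 1 - 3 * κ ≠ 1 := by exact_mod_cast h2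
  have h3' : (3 : ℝ) ^ f + 1 - 3 * κ ≠ 4 := by exact_mod_cast h3
  rw [hA1, hA2] at hA0
  rw [hA2] at hA1
  rw [hχ] at hlen hA0 hA1 hA2
  push_cast at hlen hA0 hA1 hA2
  -- For χ(β) = 1 the weight 2q/9 belongs to class 2, so the three classes appear in reverse order
  -- and are permuted at the end.
  refine (h.hasWeightDistribution_of_distinct hβ hk
    (l := 3 ^ f * (3 ^ f - κ + 1) / 3) (c₂ := 2 * (3 ^ f) ^ 2 / 9)
    (c₁ := 2 * (3 ^ f) ^ 2 / 9 + 3 ^ f / 3) (c₀ := 2 * (3 ^ f) ^ 2 / 9 + 2 * 3 ^ f / 3)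
    (n₂ := (κ - 1) * (κ - 2) + 3 ^ f - 3) (n₁ := 2 * (κ - 1) * (3 ^ f - κ + 1))
    (n₀ := (3 ^ f - κ) * (3 ^ f - κ + 1)) (by linarith) (by rw [lineWeight, hχ]; push_cast; ring)
    (by rw [classWeight, hχ]; push_cast; ring) (by rw [classWeight, hχ]; push_cast; ring)
    (by rw [classWeight, hχ]; push_cast; ring) (by rw [hA0]; ring) (by rw [hA1]; ring)
    (by rw [hA2]; ring)
    ?_ ?_ ?_ ?_ ?_ ?_ ?_ ?_ ?_ ?_ ?_ ?_ ?_).perm ?_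
  all_goals try clear hlen hA0 hA1 hA2
  all_goals try generalize (3 : ℝ) ^ f = s at *
  · have : 0 < s - κ + 1 := by linarith
    positivity
  · positivity
  · positivity
  · positivity
  · exact mul_pos (by linarith) (by linarith)
  · exact mul_pos (by linarith) (by linarith)
  · have : (0 : ℝ) < (κ - 1) * (κ - 2) := mul_pos (by linarith) (by linarith)
    linarith
  · intro he
    have : s * (s + 1 - 3 * κ) = s * (4 : ℝ) := by linarith
    exact h3' (mul_left_cancel₀ (by linarith) this)
  · intro he
    have : s * (s + 1 - 3 * κ) = s * (1 : ℝ) := by linarith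
    exact h2' (mul_left_cancel₀ (by linarith) this)
  · intro he
    have : s * (s + 1 - 3 * κ) = s * (-2 : ℝ) := by linarith
    exact h1' (mul_left_cancel₀ (by linarith) this)
  · intro he
    linarith
  · intro he
    linarith
  · intro he
    linarith
  · refine List.Perm.cons _ ?_
    exact List.reverse_perm [_, _, _] |>.symm

theorem PhaseData.hasWeightDistribution_of_not_mem (h : PhaseData f a θ κ) (hβ : β ≠ 0)
    (hk : Module.finrank (ZMod 3) F = k) (hχ : zeroInd a θ β = 0)
    (hκ : 3 ≤ κ) (hκ' : κ + 1 ≤ 3 ^ f)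
    (h1 : (3 : ℤ) ^ f + 1 - 3 * κ ≠ -2) (h2 : (3 : ℤ) ^ f + 1 - 3 * κ ≠ 1)
    (h3 : (3 : ℤ) ^ f + 1 - 3 * κ ≠ -5) :
    HasWeightDistribution (traceCode (phaseSet a β)) ((3 ^ f) ^ 2 / 3 - κ) k
      [(3 ^ f * (3 ^ f - κ) / 3, 2),
       (2 * (3 ^ f) ^ 2 / 9, (3 ^ f - κ) ^ 2 + κ - 3),
       (2 * (3 ^ f) ^ 2 / 9 - 3 ^ f / 3, 2 * κ * (3 ^ f - κ)),
       (2 * (3 ^ f) ^ 2 / 9 - 2 * 3 ^ f / 3, κ * (κ - 1))] := by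
  have hs := h.two_lt_real
  have hlen := h.length_real hβ
  have hA2 := h.classCard_two_real hβ
  have hA1 := h.classCard_one_real hβ
  have hA0 := h.classCard_zero_real hβ
  have hκr : (3 : ℝ) ≤ κ := by exact_mod_cast hκ
  have hκr' : (κ : ℝ) + 1 ≤ 3 ^ f := by exact_mod_cast hκ'
  have h1' : (3 : ℝ) ^ f + 1 - 3 * κ ≠ -2 := by exact_mod_cast h1
  have h2' : (3 : ℝ) ^ f + 1 - 3 * κ ≠ 1 := by exact_mod_cast h2
  have h3' : (3 : ℝ) ^ f + 1 - 3 * κ ≠ -5 := by exact_mod_cast h3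
  rw [hA1, hA2] at hA0
  rw [hA2] at hA1
  rw [hχ] at hlen hA0 hA1 hA2
  push_cast at hlen hA0 hA1 hA2
  refine h.hasWeightDistribution_of_distinct hβ hk
    (by linarith) (by rw [lineWeight, hχ]; push_cast; ring)
    (by rw [classWeight, hχ]; push_cast; ring) (by rw [classWeight, hχ]; push_cast; ring)
    (by rw [classWeight, hχ]; push_cast; ring) (by rw [hA0]; ring) (by rw [hA1]; ring)
    (by rw [hA2]; ring)
    ?_ ?_ ?_ ?_ ?_ ?_ ?_ ?_ ?_ ?_ ?_ ?_ ?_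
  all_goals clear hlen hA0 hA1 hA2
  all_goals generalize (3 : ℝ) ^ f = s at *
  · have : 0 < s - κ := by linarith
    positivity
  · positivity
  · have : 0 < s * (2 * s - 3) / 9 := by
      have : 0 < 2 * s - 3 := by linarith
      positivity
    linarith
  · have : 0 < s * (2 * (s - 3)) / 9 := by
      have : 0 < s - 3 := by linarith
      positivity
    linarith
  · have : (0 : ℝ) < (s - κ) ^ 2 := pow_pos (by linarith) 2
    linarith
  · exact mul_pos (by linarith) (by linarith)
  · exact mul_pos (by linarith) (by linarith)
  · intro he
    have : s * (s + 1 - 3 * κ) = s * (1 : ℝ) := by linarith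
    exact h2' (mul_left_cancel₀ (by linarith) this)
  · intro he
    have : s * (s + 1 - 3 * κ) = s * (-2 : ℝ) := by linarith
    exact h1' (mul_left_cancel₀ (by linarith) this)
  · intro he
    have : s * (s + 1 - 3 * κ) = s * (-5 : ℝ) := by linarith
    exact h3' (mul_left_cancel₀ (by linarith) this)
  · intro he
    linarith
  · intro he
    linarith
  · intro he
    linarith

/-- If the phase has no zero lines, the code has only two weights. -/
theorem PhaseData.hasWeightDistribution_of_no_line (h : PhaseData f a θ 0) (hβ : β ≠ 0)
    (hk : Module.finrank (ZMod 3) F = k) :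
    HasWeightDistribution (traceCode (phaseSet a β)) ((3 ^ f) ^ 2 / 3) k
      [((3 ^ f) ^ 2 / 3, 2), (2 * (3 ^ f) ^ 2 / 9, (3 ^ f) ^ 2 - 3)] := by
  classical
  have hs := h.two_lt_real
  have hχ : zeroInd a θ β = 0 := by
    have h1 := h.sum_zeroInd
    rw [Nat.cast_zero, mul_zero, sum_eq_zero_iff_of_nonneg] at h1
    · exact h1 β (mem_univ _)
    · intro b _
      rcases zeroInd_eq_zero_or_one a θ b with h0 | h0 <;> simp [h0]
  have hlen := h.length_real hβ
  have hA2 := h.classCard_two_real hβ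
  have hA1 := h.classCard_one_real hβ
  have hA0 := h.classCard_zero_real hβ
  rw [hχ] at hA2
  norm_num at hA2
  rw [hA2, hχ] at hA1
  norm_num at hA1
  rw [hA2, hA1] at hA0
  rw [hχ] at hlen
  norm_num at hlen
  have hw1 : (0 : ℝ) < (3 ^ f) ^ 2 / 3 := by positivity
  have hw2 : (0 : ℝ) < 2 * (3 ^ f) ^ 2 / 9 := by positivity
  have hne : ((3 ^ f) ^ 2 / 3 : ℝ) ≠ 2 * (3 ^ f) ^ 2 / 9 := by
    intro he
    linarith
  have hl : lineWeight (3 ^ f) (zeroInd a θ β) (0 : ℕ) = (3 ^ f) ^ 2 / 3 := by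
    rw [lineWeight, hχ]; push_cast; ring
  have hc : classWeight (3 ^ f) (zeroInd a θ β) 0 = 2 * (3 ^ f) ^ 2 / 9 := by
    rw [classWeight, hχ]; push_cast; ring
  refine hasWeightDistribution_traceCode (by linarith) hk ?_ ?_ ?_ ?_ ?_
  · simpa using hne
  · simp only [List.forall_mem_cons]
    exact ⟨hw1, hw2, by simp⟩
  · simp only [List.forall_mem_cons]
    refine ⟨two_pos, ?_, by simp⟩
    have : (3 : ℝ) * 3 ≤ 3 ^ f * 3 ^ f := mul_le_mul hs hs (by norm_num) (by positivity)
    linarith [sq ((3 : ℝ) ^ f)]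
  · simp only [List.forall_mem_cons, h.card_weight_eq hβ, hl, hc, hA0, hA1, hA2]
    simp [hne, hne.symm, hw2.ne, hw1.ne]
  · intro b hb
    simp only [List.map_cons, List.map_nil, List.mem_cons, List.not_mem_nil, or_false]
    rcases h.weight_cases hβ b with ⟨h3, -⟩ | ⟨-, h3⟩ | ⟨h5, h3⟩
    · exact absurd h3 hb
    · exact Or.inl (h3.trans hl)
    · have hempty (j : ℤ) (hj : classCard a θ β j = 0) : pairSum a θ β b ≠ j := by
        intro h6
        rw [classCard, card_eq_zero, filter_eq_empty_iff] at hj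
        exact hj (mem_univ b) ⟨h5, h6⟩
      rcases pairSum_cases a θ β b with h4 | h4 | h4
      · rw [h4] at h3
        push_cast at h3
        exact Or.inr (h3.trans hc)
      · exact absurd h4 (hempty 1 hA1)
      · exact absurd h4 (hempty 2 hA2)

/-- The exceptional parameters for which two of the four weights coincide. -/
theorem PhaseData.hasWeightDistribution_exceptional (h : PhaseData 2 a θ 5) (hβ : β ≠ 0)
    (hk : Module.finrank (ZMod 3) F = k) (hχ : zeroInd a θ β = 0) :
    HasWeightDistribution (traceCode (phaseSet a β)) 22 k [(12, 22), (18, 18), (15, 40)] := by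
  have hlen := h.length_real hβ
  have hA2 := h.classCard_two_real hβ
  have hA1 := h.classCard_one_real hβ
  have hA0 := h.classCard_zero_real hβ
  rw [hχ] at hA2
  norm_num at hA2
  rw [hA2, hχ] at hA1
  norm_num at hA1
  rw [hA2, hA1] at hA0
  norm_num at hA0
  rw [hχ] at hlen
  norm_num at hlen
  have hl : lineWeight (3 ^ 2) (zeroInd a θ β) (5 : ℕ) = 12 := by
    rw [lineWeight, hχ]; norm_num
  have hc0 : classWeight (3 ^ 2) (zeroInd a θ β) 0 = 18 := by
    rw [classWeight, hχ]; norm_num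
  have hc1 : classWeight (3 ^ 2) (zeroInd a θ β) 1 = 15 := by
    rw [classWeight, hχ]; norm_num
  have hc2 : classWeight (3 ^ 2) (zeroInd a θ β) 2 = 12 := by
    rw [classWeight, hχ]; norm_num
  refine hasWeightDistribution_traceCode (by linarith) hk ?_ ?_ ?_ ?_ ?_
  · norm_num
  · simp
  · simp
  -- The weight of ±β coincides with that of class 2, so the weight 12 occurs 2 + 20 times.
  · simp only [List.forall_mem_cons, h.card_weight_eq hβ, hl, hc0, hc1, hc2, hA0, hA1, hA2]
    norm_num
  · intro b hb
    simp only [List.map_cons, List.map_nil, List.mem_cons, List.not_mem_nil, or_false]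
    rcases h.weight_cases hβ b with ⟨h3, -⟩ | ⟨-, h3⟩ | ⟨-, h3⟩
    · exact absurd h3 hb
    · exact Or.inl (h3.trans hl)
    · rcases pairSum_cases a θ β b with h4 | h4 | h4 <;> rw [h4] at h3 <;> push_cast at h3
      · exact Or.inr (Or.inl (h3.trans hc0))
      · exact Or.inr (Or.inr (h3.trans hc1))
      · exact Or.inl (h3.trans hc2)

end Distributions

/-! ### Consequences of 3 being a primitive root modulo 2ℓ^m -/

section Arithmetic

variable {ℓ m : ℕ}

theorem totient_two_mul_prime_pow (hℓ : ℓ.Prime) (hodd : Odd ℓ) (hm : 1 ≤ m) :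
    Nat.totient (2 * ℓ ^ m) = (ℓ - 1) * ℓ ^ (m - 1) := by
  rw [Nat.totient_mul (Nat.coprime_two_left.2 hodd.pow), Nat.totient_two, one_mul,
    Nat.totient_prime_pow hℓ hm, mul_comm]

theorem totient_eq_two_mul (hℓ : ℓ.Prime) (hodd : Odd ℓ) (hm : 1 ≤ m) :
    Nat.totient (2 * ℓ ^ m) = 2 * ((ℓ / 2) * ℓ ^ (m - 1)) := by
  rw [totient_two_mul_prime_pow hℓ hodd hm, ← mul_assoc]
  congr 1
  obtain ⟨t, rfl⟩ := hodd
  lia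

/-- The exponent `φ (2 ℓ ^ m) / 2`. -/
def halfTotient (ℓ m : ℕ) : ℕ := (ℓ / 2) * ℓ ^ (m - 1)

theorem one_le_halfTotient (hℓ : ℓ.Prime) : 1 ≤ halfTotient ℓ m := by
  have := hℓ.two_le
  exact Nat.mul_pos (by lia) (pow_pos hℓ.pos _)

/-- The odd prime ℓ cannot divide both s - 1 and s + 1, so ℓ^m divides one of them. It is not s - 1,
since the order of 3 is 2f rather than a divisor of f. -/
theorem dvd_three_pow_add_one (hℓ : ℓ.Prime) (hodd : Odd ℓ) (hm : 1 ≤ m)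
    (hprim : orderOf (3 : ZMod (2 * ℓ ^ m)) = Nat.totient (2 * ℓ ^ m)) :
    2 * ℓ ^ m ∣ 3 ^ halfTotient ℓ m + 1 := by
  set f := halfTotient ℓ m with hf
  have hφ : Nat.totient (2 * ℓ ^ m) = 2 * f := totient_eq_two_mul hℓ hodd hm
  have hf1 : 1 ≤ f := one_le_halfTotient hℓ
  have hodd3 : Odd (3 ^ f) := Odd.pow (by decide)
  have h3 : 1 ≤ 3 ^ f := Nat.one_le_pow _ _ (by norm_num)
  have hcop : Nat.Coprime 2 (ℓ ^ m) := Nat.coprime_two_left.2 hodd.pow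
  have hnot : ¬ 2 * ℓ ^ m ∣ 3 ^ f - 1 := by
    intro h
    have h1 : ((3 : ZMod (2 * ℓ ^ m)) ^ f) = 1 := by
      have := (ZMod.natCast_eq_zero_iff _ _).2 h
      rw [Nat.cast_sub h3] at this
      push_cast at this
      exact sub_eq_zero.1 this
    have := orderOf_dvd_of_pow_eq_one h1
    rw [hprim, hφ] at this
    have := Nat.le_of_dvd hf1 this
    lia
  have hmul : ℓ ^ m ∣ (3 ^ f - 1) * (3 ^ f + 1) := by
    have h1 : ((3 : ZMod (2 * ℓ ^ m)) ^ (2 * f)) = 1 := by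
      rw [← hφ, ← hprim, pow_orderOf_eq_one]
    have h2 : 2 * ℓ ^ m ∣ 3 ^ (2 * f) - 1 := by
      rw [← ZMod.natCast_eq_zero_iff, Nat.cast_sub (Nat.one_le_pow _ _ (by norm_num))]
      push_cast
      rw [h1, sub_self]
    have h4 : (3 ^ f - 1) * (3 ^ f + 1) = 3 ^ (2 * f) - 1 := by
      rw [mul_comm, ← Nat.sq_sub_sq, one_pow, ← pow_mul, mul_comm]
    rw [h4]
    exact dvd_trans (dvd_mul_left _ _) h2
  by_cases hd : ℓ ∣ 3 ^ f - 1
  · exfalso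
    apply hnot
    have hc : Nat.Coprime (ℓ ^ m) (3 ^ f + 1) := by
      refine Nat.Coprime.pow_left _ ((Nat.Prime.coprime_iff_not_dvd hℓ).2 fun h => ?_)
      have h2 : ℓ ∣ 2 := by
        have := Nat.dvd_sub h hd
        have h5 : 3 ^ f + 1 - (3 ^ f - 1) = 2 := by lia
        rwa [h5] at this
      have := Nat.le_of_dvd (by norm_num) h2
      have := hℓ.two_le
      obtain ⟨t, ht⟩ := hodd
      lia
    refine Nat.Coprime.mul_dvd_of_dvd_of_dvd hcop ?_ (hc.dvd_of_dvd_mul_right hmul)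
    exact (Nat.Odd.sub_odd hodd3 odd_one).two_dvd
  · have hc : Nat.Coprime (ℓ ^ m) (3 ^ f - 1) :=
      Nat.Coprime.pow_left _ ((Nat.Prime.coprime_iff_not_dvd hℓ).2 hd)
    refine Nat.Coprime.mul_dvd_of_dvd_of_dvd hcop ?_ (hc.dvd_of_dvd_mul_left hmul)
    exact (hodd3.add_odd odd_one).two_dvd

theorem odd_halfTotient_iff (hodd : Odd ℓ) : Odd (halfTotient ℓ m) ↔ ℓ % 4 = 3 := by
  rw [halfTotient, Nat.odd_mul]
  have h1 : Odd (ℓ ^ (m - 1)) := hodd.pow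
  obtain ⟨t, rfl⟩ := hodd
  rw [Nat.odd_iff]
  constructor
  · rintro ⟨h, -⟩
    lia
  · intro h
    exact ⟨by lia, h1⟩

/-- Quadratic reciprocity for the prime `3`. -/
theorem mod_four_eq_iff (hℓ : ℓ.Prime) (hodd : Odd ℓ) (hm : 1 ≤ m) (h3 : ℓ % 3 ≠ 0)
    (hprim : orderOf (3 : ZMod (2 * ℓ ^ m)) = Nat.totient (2 * ℓ ^ m)) :
    ℓ % 4 = 3 ↔ ℓ % 3 = 1 := by
  have : Fact ℓ.Prime := ⟨hℓ⟩
  have hℓ2 : ℓ ≠ 2 := by rintro rfl; exact absurd hodd (by decide)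
  -- If 3 were a square modulo ℓ, Euler's criterion would give s = 1 modulo ℓ, against s = -1.
  have hnsq : ¬ IsSquare (3 : ZMod ℓ) := by
    intro hsq
    have h30 : (3 : ZMod ℓ) ≠ 0 := by
      intro h
      have : ((3 : ℕ) : ZMod ℓ) = 0 := by exact_mod_cast h
      rw [ZMod.natCast_eq_zero_iff] at this
      have := (Nat.prime_dvd_prime_iff_eq hℓ Nat.prime_three).1 this
      rw [this] at h3
      exact h3 rfl
    have h1 : (3 : ZMod ℓ) ^ (ℓ / 2) = 1 := (ZMod.euler_criterion ℓ h30).1 hsq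
    have h2 : (3 : ZMod ℓ) ^ halfTotient ℓ m = 1 := by rw [halfTotient, pow_mul, h1, one_pow]
    have h4 : ℓ ∣ 3 ^ halfTotient ℓ m + 1 :=
      dvd_trans (dvd_trans (dvd_pow_self ℓ (by lia)) (dvd_mul_left _ 2))
        (dvd_three_pow_add_one hℓ hodd hm hprim)
    rw [← ZMod.natCast_eq_zero_iff] at h4
    push_cast at h4
    rw [h2] at h4
    have h5 : ((2 : ℕ) : ZMod ℓ) = 0 := by
      push_cast
      rw [← h4]
      norm_num
    rw [ZMod.natCast_eq_zero_iff] at h5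
    exact hℓ2 ((Nat.prime_dvd_prime_iff_eq hℓ Nat.prime_two).1 h5)
  have h1mod : ℓ % 3 = 1 ↔ IsSquare (ℓ : ZMod 3) := by
    have hc : (ℓ : ZMod 3) = ((ℓ % 3 : ℕ) : ZMod 3) := by simp
    have hlt : ℓ % 3 < 3 := Nat.mod_lt _ (by norm_num)
    have hdec : ∀ r < 3, r ≠ 0 → (r = 1 ↔ IsSquare ((r : ℕ) : ZMod 3)) := by decide
    rw [hc]
    exact hdec _ hlt h3
  have hℓ4 : ℓ % 4 = 1 ∨ ℓ % 4 = 3 := by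
    obtain ⟨t, ht⟩ := hodd
    lia
  rw [h1mod]
  rcases hℓ4 with h4 | h4
  · have := ZMod.exists_sq_eq_prime_iff_of_mod_four_eq_one (p := ℓ) (q := 3) h4 (by norm_num)
    constructor
    · intro h
      lia
    · intro h
      exact absurd (by exact_mod_cast this.2 h) hnsq
  · have := ZMod.exists_sq_eq_prime_iff_of_mod_four_eq_three (p := ℓ) (q := 3) h4 (by norm_num)
      (by rintro rfl; exact h3 rfl)
    constructor
    · intro _
      by_contra h
      apply hnsq
      exact_mod_cast this.2 h
    · intro _
      exact h4

/-- Since ℓ^m is odd, M is even exactly when 4 divides 3^f + 1, that is, when f is odd; reciprocity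
translates the parity of f into ℓ modulo 3. -/
theorem even_quotient_iff (hℓ : ℓ.Prime) (hodd : Odd ℓ) (hm : 1 ≤ m) (h3 : ℓ % 3 ≠ 0)
    (hprim : orderOf (3 : ZMod (2 * ℓ ^ m)) = Nat.totient (2 * ℓ ^ m)) {M : ℕ}
    (hM : 3 ^ halfTotient ℓ m + 1 = 2 * ℓ ^ m * M) : Even M ↔ ℓ % 3 = 1 := by
  rw [← mod_four_eq_iff hℓ hodd hm h3 hprim, ← odd_halfTotient_iff (m := m) hodd]
  obtain ⟨t, ht⟩ := hodd.pow (n := m)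
  rw [ht] at hM
  have h9 (n : ℕ) : 9 ^ n % 4 = 1 := by
    rw [Nat.pow_mod]
    simp
  rcases Nat.even_or_odd' (halfTotient ℓ m) with ⟨n, h | h⟩
  · rw [h, pow_mul] at hM
    have := h9 n
    norm_num at hM
    constructor
    · rintro ⟨r, hr⟩
      subst hr
      exfalso
      have : 9 ^ n + 1 = 4 * ((2 * t + 1) * r) := by rw [hM]; ring
      lia
    · intro ho
      rw [h] at ho
      exact absurd ho (by simp)
  · rw [h, pow_succ, pow_mul] at hM
    have := h9 n
    norm_num at hM
    constructor
    · intro _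
      rw [h]
      exact odd_two_mul_add_one n
    · intro _
      by_contra hne
      rw [Nat.not_even_iff_odd] at hne
      obtain ⟨r, hr⟩ := hne
      subst hr
      have : 9 ^ n * 3 + 1 = 4 * (2 * t * r + t + r) + 2 := by rw [hM]; ring
      lia

end Arithmetic

/-! ### Traces of 2ℓ^m-th roots of unity -/

section Traces

theorem sq_eq_one_of_ne_zero {ε : ZMod 3} (hε : ε ≠ 0) : ε ^ 2 = 1 := by
  revert ε
  decide

variable {ℓ m : ℕ}

theorem coprime_three (hℓ : ℓ.Prime)
    (hprim : orderOf (3 : ZMod (2 * ℓ ^ m)) = Nat.totient (2 * ℓ ^ m)) :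
    Nat.Coprime 3 (2 * ℓ ^ m) := by
  have hN : 0 < 2 * ℓ ^ m := Nat.mul_pos two_pos (pow_pos hℓ.pos m)
  have hunit : IsUnit (3 : ZMod (2 * ℓ ^ m)) := by
    have hφ : 0 < Nat.totient (2 * ℓ ^ m) := Nat.totient_pos.2 hN
    rw [← hprim] at hφ
    exact (orderOf_pos_iff.1 hφ).isUnit
  rw [← ZMod.isUnit_iff_coprime]
  exact_mod_cast hunit

/-- Powers of 3 are units, and the order of 3 provides as many distinct ones as there are units. -/
theorem image_pow_mod (hprim : orderOf (3 : ZMod (2 * ℓ ^ m)) = Nat.totient (2 * ℓ ^ m))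
    (hℓ : ℓ.Prime) :
    (range (Nat.totient (2 * ℓ ^ m))).image (fun i => 3 ^ i % (2 * ℓ ^ m))
      = {j ∈ range (2 * ℓ ^ m) | (2 * ℓ ^ m).Coprime j} := by
  have hN : 0 < 2 * ℓ ^ m := Nat.mul_pos two_pos (pow_pos hℓ.pos m)
  have h3 := coprime_three hℓ hprim
  apply Finset.eq_of_subset_of_card_le
  · intro j hj
    obtain ⟨i, -, rfl⟩ := mem_image.1 hj
    refine mem_filter.2 ⟨mem_range.2 (Nat.mod_lt _ hN), ?_⟩
    have : Nat.Coprime (2 * ℓ ^ m) (3 ^ i) := (Nat.Coprime.pow_left i h3).symm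
    rw [Nat.coprime_comm] at this ⊢
    exact ((Nat.mod_modEq _ _).gcd_eq).trans this
  · rw [card_image_of_injOn, card_range]
    · rw [Nat.totient]
    · intro i hi k hk hik
      have h1 : (3 : ZMod (2 * ℓ ^ m)) ^ i = 3 ^ k := by
        have := (ZMod.natCast_eq_natCast_iff' (3 ^ i) (3 ^ k) (2 * ℓ ^ m)).2 hik
        exact_mod_cast this
      rw [← hprim] at hi hk
      exact pow_injOn_Iio_orderOf (by simpa using hi) (by simpa using hk) h1

/-- The units modulo 2ℓ^m are the odd residues minus the odd multiples of ℓ; for powers of a root of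
unity both sums are geometric. -/
theorem sum_coprime_eq {R : Type*} [AddCommGroup R] (hℓ : ℓ.Prime) (hodd : Odd ℓ) (hm : 1 ≤ m)
    (h : ℕ → R) :
    ∑ j ∈ range (2 * ℓ ^ m) with (2 * ℓ ^ m).Coprime j, h j
      = ∑ i ∈ range (ℓ ^ m), h (2 * i + 1) - ∑ i ∈ range (ℓ ^ (m - 1)), h (ℓ * (2 * i + 1)) := by
  have hpow : ℓ ^ m = ℓ * ℓ ^ (m - 1) := by rw [← pow_succ', Nat.sub_add_cancel hm]
  set A := (range (ℓ ^ m)).image (fun i => 2 * i + 1) with hA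
  set B := (range (ℓ ^ (m - 1))).image (fun i => ℓ * (2 * i + 1)) with hB
  have hAs : ∑ j ∈ A, h j = ∑ i ∈ range (ℓ ^ m), h (2 * i + 1) :=
    sum_image fun i _ j _ hij => by simpa using hij
  have hBs : ∑ j ∈ B, h j = ∑ i ∈ range (ℓ ^ (m - 1)), h (ℓ * (2 * i + 1)) :=
    sum_image fun i _ j _ hij => by
      have := Nat.eq_of_mul_eq_mul_left hℓ.pos hij
      lia
  obtain ⟨t, ht⟩ := hodd
  have hBA : B ⊆ A := by
    intro j hj
    obtain ⟨i, hi, rfl⟩ := mem_image.1 hj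
    have hi := mem_range.1 hi
    refine mem_image.2 ⟨ℓ * i + t, mem_range.2 ?_, ?_⟩
    · rw [hpow]
      calc ℓ * i + t < ℓ * i + ℓ := by lia
        _ = ℓ * (i + 1) := by ring
        _ ≤ ℓ * ℓ ^ (m - 1) := Nat.mul_le_mul_left _ hi
    · calc 2 * (ℓ * i + t) + 1 = 2 * (ℓ * i) + (2 * t + 1) := by ring
        _ = 2 * (ℓ * i) + ℓ := by rw [← ht]
        _ = ℓ * (2 * i + 1) := by ring
  have hset : ({j ∈ range (2 * ℓ ^ m) | (2 * ℓ ^ m).Coprime j} : Finset ℕ) = A \ B := by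
    ext j
    rw [mem_filter, mem_range, Nat.coprime_mul_iff_left, mem_sdiff,
      Nat.coprime_pow_left_iff (by lia), Nat.Prime.coprime_iff_not_dvd hℓ, Nat.coprime_two_left]
    constructor
    · rintro ⟨h1, ⟨i, rfl⟩, h2⟩
      refine ⟨mem_image.2 ⟨i, mem_range.2 (by lia), rfl⟩, fun h3 => h2 ?_⟩
      obtain ⟨i', -, h4⟩ := mem_image.1 h3
      exact ⟨_, h4.symm⟩
    · rintro ⟨h1, h2⟩
      obtain ⟨i, hi, rfl⟩ := mem_image.1 h1
      have hi := mem_range.1 hi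
      refine ⟨by lia, ⟨i, rfl⟩, ?_⟩
      rintro ⟨c, hc⟩
      apply h2
      have hcodd : Odd c := by
        have : Odd (ℓ * c) := hc ▸ odd_two_mul_add_one i
        exact (Nat.odd_mul.1 this).2
      obtain ⟨r, hr⟩ := hcodd
      refine mem_image.2 ⟨r, mem_range.2 ?_, by rw [← hr]; exact hc.symm⟩
      have h5 : ℓ * c < ℓ * (2 * ℓ ^ (m - 1)) := by
        rw [← hc, mul_left_comm, ← hpow]
        lia
      have := Nat.lt_of_mul_lt_mul_left h5
      lia
  rw [hset, ← hAs, ← hBs, ← sum_sdiff hBA, add_sub_cancel_right]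

variable {F : Type*} [Field F] [Fintype F] [Algebra (ZMod 3) F]

theorem finrank_eq_of_card {e : ℕ} (hF : Fintype.card F = 3 ^ e) :
    Module.finrank (ZMod 3) F = e := by
  have h := Module.card_eq_pow_finrank (K := ZMod 3) (V := F)
  rw [hF, ZMod.card] at h
  exact (Nat.pow_right_injective (by norm_num : 2 ≤ 3) h).symm

/-- The trace of a root of unity as a Ramanujan sum. -/
theorem algebraMap_trace_eq (hℓ : ℓ.Prime) (hodd : Odd ℓ) (hm : 1 ≤ m)
    (hprim : orderOf (3 : ZMod (2 * ℓ ^ m)) = Nat.totient (2 * ℓ ^ m))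
    (hF : Fintype.card F = 3 ^ Nat.totient (2 * ℓ ^ m)) {x : F} (hx : x ^ (2 * ℓ ^ m) = 1) :
    algebraMap (ZMod 3) F (Algebra.trace (ZMod 3) F x)
      = x * ∑ i ∈ range (ℓ ^ m), (x ^ 2) ^ i
        - x ^ ℓ * ∑ i ∈ range (ℓ ^ (m - 1)), (x ^ (2 * ℓ)) ^ i := by
  rw [FiniteField.algebraMap_trace_eq_sum_pow, Nat.card_zmod, finrank_eq_of_card hF]
  have hmod (n : ℕ) : x ^ n = x ^ (n % (2 * ℓ ^ m)) := by
    conv_lhs => rw [← Nat.div_add_mod n (2 * ℓ ^ m), pow_add, pow_mul, hx, one_pow, one_mul]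
  have hN : 0 < 2 * ℓ ^ m := Nat.mul_pos two_pos (pow_pos hℓ.pos m)
  have hinj : Set.InjOn (fun i => 3 ^ i % (2 * ℓ ^ m))
      (range (Nat.totient (2 * ℓ ^ m)) : Set ℕ) := by
    rw [← card_image_iff, image_pow_mod hprim hℓ, card_range]
    rfl
  -- The Frobenius conjugates of x run through all powers of x with exponent prime to 2ℓ^m.
  have h1 : ∑ i ∈ range (Nat.totient (2 * ℓ ^ m)), x ^ 3 ^ i
      = ∑ j ∈ range (2 * ℓ ^ m) with (2 * ℓ ^ m).Coprime j, x ^ j := by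
    rw [← image_pow_mod hprim hℓ, sum_image hinj]
    exact sum_congr rfl fun i _ => hmod _
  rw [h1, sum_coprime_eq hℓ hodd hm, mul_sum, mul_sum]
  congr 1
  · refine sum_congr rfl fun i _ => ?_
    ring
  · refine sum_congr rfl fun i _ => ?_
    ring

theorem geom_sum_eq_zero_of_pow_eq_one {y : F} {n : ℕ} (hy : y ^ n = 1) (hne : y ≠ 1) :
    ∑ i ∈ range n, y ^ i = 0 := by
  rw [geom_sum_eq hne, hy, sub_self, zero_div]

variable (hℓ : ℓ.Prime) (hodd : Odd ℓ) (hm : 1 ≤ m)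
    (hprim : orderOf (3 : ZMod (2 * ℓ ^ m)) = Nat.totient (2 * ℓ ^ m))
    (hF : Fintype.card F = 3 ^ Nat.totient (2 * ℓ ^ m))

include hℓ hodd hm hprim hF

theorem trace_eq_zero_of_pow_ne_one {x : F} (hx : x ^ (2 * ℓ ^ m) = 1)
    (hne : x ^ (2 * ℓ) ≠ 1) : Algebra.trace (ZMod 3) F x = 0 := by
  apply (algebraMap (ZMod 3) F).injective
  have h2 : x ^ 2 ≠ 1 := by
    intro h
    rw [pow_mul, h, one_pow] at hne
    exact hne rfl
  have h3 : (x ^ (2 * ℓ)) ^ ℓ ^ (m - 1) = 1 := by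
    rw [← pow_mul, mul_assoc, ← pow_succ', Nat.sub_add_cancel hm, hx]
  rw [algebraMap_trace_eq hℓ hodd hm hprim hF hx,
    geom_sum_eq_zero_of_pow_eq_one (by rw [← pow_mul, hx]) h2,
    geom_sum_eq_zero_of_pow_eq_one h3 hne]
  simp

theorem trace_eq_of_sq_ne_one {x : F} (hx : x ^ (2 * ℓ ^ m) = 1) (hne : x ^ 2 ≠ 1)
    {ε : ZMod 3} (hε : ε ≠ 0) (hxε : x ^ ℓ = algebraMap (ZMod 3) F ε) :
    Algebra.trace (ZMod 3) F x = -ε * (ℓ : ZMod 3) ^ (m - 1) := by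
  apply (algebraMap (ZMod 3) F).injective
  have hε2 : ε ^ 2 = 1 := sq_eq_one_of_ne_zero hε
  have h3 : x ^ (2 * ℓ) = 1 := by
    rw [mul_comm, pow_mul, hxε, ← map_pow, hε2, map_one]
  rw [algebraMap_trace_eq hℓ hodd hm hprim hF hx,
    geom_sum_eq_zero_of_pow_eq_one (by rw [← pow_mul, hx]) hne, h3, hxε]
  simp

theorem trace_eq_of_sq_eq_one {ε : ZMod 3} (hε : ε ≠ 0) :
    Algebra.trace (ZMod 3) F (algebraMap (ZMod 3) F ε)
      = ε * (ℓ - 1) * (ℓ : ZMod 3) ^ (m - 1) := by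
  have hε2 : ε ^ 2 = 1 := sq_eq_one_of_ne_zero hε
  rw [Algebra.trace_algebraMap, finrank_eq_of_card hF, totient_two_mul_prime_pow hℓ hodd hm,
    nsmul_eq_mul, Nat.cast_mul, Nat.cast_sub hℓ.one_le, Nat.cast_pow, Nat.cast_one]
  ring

end Traces

/-! ### The phase of the code and its number of zero lines -/

section Phase

/-- The standing assumptions: `3` is a primitive root modulo `2 ℓ ^ m`, the field has
`3 ^ φ (2 ℓ ^ m)` elements, and `M` is the quotient of `√q + 1` by `2 ℓ ^ m`. -/
structure PrimitiveRootSetting (ℓ m M : ℕ) (F : Type*) [Fintype F] : Prop where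
  prime : ℓ.Prime
  odd : Odd ℓ
  one_le : 1 ≤ m
  mod_three : ℓ % 3 ≠ 0
  orderOf_eq : orderOf (3 : ZMod (2 * ℓ ^ m)) = Nat.totient (2 * ℓ ^ m)
  card_eq' : Fintype.card F = 3 ^ Nat.totient (2 * ℓ ^ m)
  quot_eq : 3 ^ halfTotient ℓ m + 1 = 2 * ℓ ^ m * M

variable {F : Type*} [Field F] [Fintype F] [CharP F 3] [Algebra (ZMod 3) F]
variable {ℓ m M : ℕ}

namespace PrimitiveRootSetting

theorem card_eq (h : PrimitiveRootSetting ℓ m M F) :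
    Fintype.card F = (3 ^ halfTotient ℓ m) ^ 2 := by
  rw [h.card_eq', totient_eq_two_mul h.prime h.odd h.one_le, ← pow_mul, mul_comm 2]
  rfl

theorem one_le_pow (_ : PrimitiveRootSetting ℓ m M F) : 1 ≤ 3 ^ halfTotient ℓ m :=
  Nat.one_le_pow _ _ (by norm_num)

theorem card_sub_one (h : PrimitiveRootSetting ℓ m M F) :
    Fintype.card F - 1 = (3 ^ halfTotient ℓ m - 1) * M * (2 * ℓ ^ m) := by
  rw [h.card_eq, mul_assoc, mul_comm M, ← h.quot_eq, mul_comm, ← Nat.sq_sub_sq, one_pow]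

theorem expo_eq (h : PrimitiveRootSetting ℓ m M F) :
    (Fintype.card F - 1) / (2 * ℓ ^ m) = (3 ^ halfTotient ℓ m - 1) * M := by
  rw [h.card_sub_one, Nat.mul_div_cancel _ (Nat.mul_pos two_pos (pow_pos h.prime.pos m))]

theorem expo_pos (h : PrimitiveRootSetting ℓ m M F) : 0 < (3 ^ halfTotient ℓ m - 1) * M := by
  refine Nat.pos_of_ne_zero fun h0 => ?_
  have h1 := h.card_sub_one
  rw [h0, zero_mul] at h1
  exact (Nat.sub_pos_of_lt Fintype.one_lt_card).ne' h1

theorem pow_expo_pow (h : PrimitiveRootSetting ℓ m M F) {x : F} (hx : x ≠ 0) :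
    (x ^ ((3 ^ halfTotient ℓ m - 1) * M)) ^ (2 * ℓ ^ m) = 1 := by
  rw [← pow_mul, ← h.card_sub_one, FiniteField.pow_card_sub_one_eq_one x hx]

end PrimitiveRootSetting

/-- The phase function `Tr (x ^ ((q - 1) / (2 ℓ ^ m))) - α`. -/
noncomputable def phase (ℓ m : ℕ) (α : ZMod 3) (x : F) : ZMod 3 :=
  Algebra.trace (ZMod 3) F (x ^ ((Fintype.card F - 1) / (2 * ℓ ^ m))) - α

theorem definingSet_eq_phaseSet (α : ZMod 3) (β : F) :
    definingSet (2 * ℓ ^ m) α β = phaseSet (phase ℓ m α) β := by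
  classical
  unfold definingSet phaseSet phase
  ext x
  simp only [mem_filter, mem_univ, true_and, map_add]
  rw [sub_add_eq_add_sub, sub_eq_zero]

namespace PrimitiveRootSetting

theorem phase_invariant (h : PrimitiveRootSetting ℓ m M F) (α : ZMod 3) :
    LineInvariant (halfTotient ℓ m) (phase ℓ m α : F → ZMod 3) := by
  intro k hk hk0 x
  have h1 : k ^ (3 ^ halfTotient ℓ m - 1) = 1 := by
    apply mul_left_cancel₀ hk0
    rw [← pow_succ', Nat.sub_add_cancel h.one_le_pow, mul_one, mem_frobFixed.1 hk]
  rw [phase, phase, h.expo_eq, mul_pow, pow_mul k, h1, one_pow, one_mul]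

/-- The three cases record which of the two geometric sums, with ratios y² and y^(2ℓ), degenerate:
neither, both, or only the second. Here ε is the sign y^ℓ. -/
theorem cases_of_pow_eq_one (h : PrimitiveRootSetting ℓ m M F) {y : F}
    (hy : y ^ (2 * ℓ ^ m) = 1) :
    (Algebra.trace (ZMod 3) F y = 0 ∧ y ^ (2 * ℓ) ≠ 1) ∨
    ∃ ε : ZMod 3, ε ≠ 0 ∧ y ^ ℓ = algebraMap (ZMod 3) F ε ∧
      ((y = algebraMap (ZMod 3) F ε ∧
        Algebra.trace (ZMod 3) F y = ε * (ℓ - 1) * (ℓ : ZMod 3) ^ (m - 1)) ∨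
       (y ^ 2 ≠ 1 ∧ Algebra.trace (ZMod 3) F y = -ε * (ℓ : ZMod 3) ^ (m - 1))) := by
  by_cases h1 : y ^ (2 * ℓ) = 1
  · right
    obtain ⟨ε, hε, hyε⟩ : ∃ ε : ZMod 3, ε ≠ 0 ∧ y ^ ℓ = algebraMap (ZMod 3) F ε := by
      rw [mul_comm, pow_mul, sq_eq_one_iff] at h1
      rcases h1 with h1 | h1
      · exact ⟨1, by decide, by rw [h1, map_one]⟩
      · exact ⟨-1, by decide, by rw [h1, map_neg, map_one]⟩
    refine ⟨ε, hε, hyε, ?_⟩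
    by_cases h2 : y ^ 2 = 1
    · left
      have h3 : y = algebraMap (ZMod 3) F ε := by
        rw [← hyε]
        obtain ⟨t, ht⟩ := h.odd
        rw [ht, pow_succ, pow_mul, h2, one_pow, one_mul]
      refine ⟨h3, ?_⟩
      rw [h3]
      exact trace_eq_of_sq_eq_one h.prime h.odd h.one_le h.orderOf_eq h.card_eq' hε
    · exact Or.inr ⟨h2, trace_eq_of_sq_ne_one h.prime h.odd h.one_le h.orderOf_eq h.card_eq'
        hy h2 hε hyε⟩
  · exact Or.inl ⟨trace_eq_zero_of_pow_ne_one h.prime h.odd h.one_le h.orderOf_eq h.card_eq'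
      hy h1, h1⟩

theorem cast_eq_one (hℓ : ℓ % 3 = 1) : (ℓ : ZMod 3) = 1 := by
  have : (ℓ : ZMod 3) = ((ℓ % 3 : ℕ) : ZMod 3) := by simp
  rw [this, hℓ, Nat.cast_one]

theorem cast_eq_neg_one (hℓ : ℓ % 3 = 2) : (ℓ : ZMod 3) = -1 := by
  have : (ℓ : ZMod 3) = ((ℓ % 3 : ℕ) : ZMod 3) := by simp
  rw [this, hℓ]
  rfl

theorem algebraMap_sq {ε : ZMod 3} (hε : ε ≠ 0) : (algebraMap (ZMod 3) F ε) ^ 2 = 1 := by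
  rw [← map_pow, sq_eq_one_of_ne_zero hε, map_one]

theorem trace_eq_iff_of_mod_one (h : PrimitiveRootSetting ℓ m M F) (hℓ : ℓ % 3 = 1) {y : F}
    (hy : y ^ (2 * ℓ ^ m) = 1) {α : ZMod 3} (hα : α ≠ 0) :
    Algebra.trace (ZMod 3) F y = α ↔
      y ^ ℓ = algebraMap (ZMod 3) F (-α) ∧ y ≠ algebraMap (ZMod 3) F (-α) := by
  have hα' : -α ≠ 0 := neg_ne_zero.2 hα
  have hinj := (algebraMap (ZMod 3) F).injective
  rcases h.cases_of_pow_eq_one hy with ⟨h1, h2⟩ | ⟨ε, hε, h1, ⟨h2, h3⟩ | ⟨h2, h3⟩⟩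
  · rw [h1]
    refine ⟨fun h3 => absurd h3.symm hα, fun h3 => absurd ?_ h2⟩
    rw [mul_comm, pow_mul, h3.1, algebraMap_sq hα']
  · rw [h3, cast_eq_one hℓ, sub_self, mul_zero, zero_mul]
    refine ⟨fun h4 => absurd h4.symm hα, fun h4 => absurd ?_ h4.2⟩
    rw [h2, ← h1, h4.1]
  · rw [h3, cast_eq_one hℓ, one_pow, mul_one, h1, hinj.eq_iff, neg_eq_iff_eq_neg]
    refine ⟨fun h4 => ⟨h4, ?_⟩, fun h4 => h4.1⟩
    intro h5
    exact h2 (by rw [h5, algebraMap_sq hα'])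

theorem sign_ne_zero (h : PrimitiveRootSetting ℓ m M F) : (ℓ : ZMod 3) ^ (m - 1) ≠ 0 := by
  refine pow_ne_zero _ fun h0 => h.mod_three ?_
  rw [ZMod.natCast_eq_zero_iff] at h0
  exact Nat.mod_eq_zero_of_dvd h0

/-- Now ℓ - 1 = 1 in `ZMod 3`, so the roots ±1 have nonzero trace too, with sign opposite to that of
the other roots sharing the same ℓ-th power. -/
theorem trace_eq_iff_of_mod_two (h : PrimitiveRootSetting ℓ m M F) (hℓ : ℓ % 3 = 2) {y : F}
    (hy : y ^ (2 * ℓ ^ m) = 1) {α : ZMod 3} (hα : α ≠ 0) :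
    Algebra.trace (ZMod 3) F y = α ↔
      (y ^ ℓ = algebraMap (ZMod 3) F (-(α * (ℓ : ZMod 3) ^ (m - 1))) ∧
        y ≠ algebraMap (ZMod 3) F (-(α * (ℓ : ZMod 3) ^ (m - 1)))) ∨
      y = algebraMap (ZMod 3) F (α * (ℓ : ZMod 3) ^ (m - 1)) := by
  have hc := h.sign_ne_zero
  have hinj := (algebraMap (ZMod 3) F).injective
  have hd : (ℓ : ZMod 3) - 1 = 1 := by rw [cast_eq_neg_one hℓ]; rfl
  rcases h.cases_of_pow_eq_one hy with ⟨h1, h2⟩ | ⟨ε, hε, h1, ⟨h2, h3⟩ | ⟨h2, h3⟩⟩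
  · rw [h1]
    refine ⟨fun h3 => absurd h3.symm hα, fun h3 => absurd ?_ h2⟩
    rcases h3 with h3 | h3
    · rw [mul_comm, pow_mul, h3.1, algebraMap_sq (neg_ne_zero.2 (mul_ne_zero hα hc))]
    · rw [pow_mul, h3, algebraMap_sq (mul_ne_zero hα hc), one_pow]
  · rw [h3, hd, h1, h2, hinj.eq_iff, hinj.ne_iff, hinj.eq_iff]
    generalize (ℓ : ZMod 3) ^ (m - 1) = c at hc ⊢
    clear h1 h2 h3
    revert ε α c
    decide
  · have h4 : y ≠ algebraMap (ZMod 3) F (-(α * (ℓ : ZMod 3) ^ (m - 1))) := by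
      intro h5
      exact h2 (by rw [h5, algebraMap_sq (neg_ne_zero.2 (mul_ne_zero hα hc))])
    have h6 : y ≠ algebraMap (ZMod 3) F (α * (ℓ : ZMod 3) ^ (m - 1)) := by
      intro h5
      exact h2 (by rw [h5, algebraMap_sq (mul_ne_zero hα hc)])
    simp only [h4, h6, h1, h3, hinj.eq_iff, ne_eq, not_false_eq_true, and_true, or_false]
    generalize (ℓ : ZMod 3) ^ (m - 1) = c at hc ⊢
    clear h1 h2 h3 h4 h6
    revert ε α c
    decide

open scoped Classical in
theorem card_filter_pow_eq_algebraMap {d : ℕ} (hd : 2 * d ∣ Fintype.card F - 1) {ε : ZMod 3}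
    (hε : ε ≠ 0) : #{x : F | x ^ d = algebraMap (ZMod 3) F ε} = d := by
  have h1 : ε = 1 ∨ ε = -1 := by revert ε; decide
  rcases h1 with rfl | rfl
  · rw [map_one]
    exact card_filter_pow_eq_one (dvd_trans (dvd_mul_left d 2) hd)
  · rw [map_neg, map_one]
    exact card_filter_pow_eq_neg_one hd

theorem algebraMap_pow_odd (h : PrimitiveRootSetting ℓ m M F) {ε : ZMod 3} (hε : ε ≠ 0) :
    (algebraMap (ZMod 3) F ε) ^ ℓ = algebraMap (ZMod 3) F ε := by
  obtain ⟨t, ht⟩ := h.odd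
  rw [ht, pow_succ, pow_mul, algebraMap_sq hε, one_pow, one_mul]

theorem two_mul_dvd (h : PrimitiveRootSetting ℓ m M F) :
    2 * ((3 ^ halfTotient ℓ m - 1) * M * ℓ) ∣ Fintype.card F - 1 := by
  rw [h.card_sub_one]
  refine ⟨ℓ ^ (m - 1), ?_⟩
  have : ℓ ^ m = ℓ * ℓ ^ (m - 1) := by rw [← pow_succ', Nat.sub_add_cancel h.one_le]
  rw [this]
  ring

open scoped Classical in
-- With E = (s-1)M, the equation x^(Eℓ) = ε has Eℓ solutions; the E solutions of x^E = ε are among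
-- them because ε^ℓ = ε, and they are removed.
theorem card_filter_pow_prime (h : PrimitiveRootSetting ℓ m M F) {ε : ZMod 3} (hε : ε ≠ 0) :
    #{x : F | (x ^ ((3 ^ halfTotient ℓ m - 1) * M)) ^ ℓ = algebraMap (ZMod 3) F ε ∧
      x ^ ((3 ^ halfTotient ℓ m - 1) * M) ≠ algebraMap (ZMod 3) F ε}
      = (3 ^ halfTotient ℓ m - 1) * M * (ℓ - 1) := by
  have h1 := card_filter_pow_eq_algebraMap h.two_mul_dvd hε
  have h2 := card_filter_pow_eq_algebraMap (F := F) (d := (3 ^ halfTotient ℓ m - 1) * M)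
    (dvd_trans (mul_dvd_mul_left 2 (dvd_mul_right _ _)) h.two_mul_dvd) hε
  have h3 := Finset.card_filter_add_card_filter_not
    (s := ({x : F | x ^ ((3 ^ halfTotient ℓ m - 1) * M * ℓ) = algebraMap (ZMod 3) F ε} : Finset F))
    (fun x => x ^ ((3 ^ halfTotient ℓ m - 1) * M) = algebraMap (ZMod 3) F ε)
  rw [filter_filter, filter_filter, h1] at h3
  have h4 : ({x : F | x ^ ((3 ^ halfTotient ℓ m - 1) * M * ℓ) = algebraMap (ZMod 3) F ε ∧
      x ^ ((3 ^ halfTotient ℓ m - 1) * M) = algebraMap (ZMod 3) F ε} : Finset F)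
      = ({x : F | x ^ ((3 ^ halfTotient ℓ m - 1) * M) = algebraMap (ZMod 3) F ε} : Finset F) := by
    ext x
    simp only [mem_filter, mem_univ, true_and, and_iff_right_iff_imp]
    intro hx
    rw [pow_mul, hx, h.algebraMap_pow_odd hε]
  rw [h4, h2] at h3
  simp only [pow_mul _ _ ℓ] at h3
  rw [Nat.mul_sub, mul_one]
  exact Nat.eq_sub_of_add_eq' h3

theorem ne_zero_of_pow_expo (h : PrimitiveRootSetting ℓ m M F) {x : F} {ε : ZMod 3} (hε : ε ≠ 0)
    (hx : (x ^ ((3 ^ halfTotient ℓ m - 1) * M)) ^ ℓ = algebraMap (ZMod 3) F ε) : x ≠ 0 := by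
  rintro rfl
  rw [zero_pow h.expo_pos.ne', zero_pow h.prime.ne_zero] at hx
  exact hε ((algebraMap (ZMod 3) F).injective (by rw [← hx, map_zero]))

open scoped Classical in
theorem card_trace_eq_of_mod_one (h : PrimitiveRootSetting ℓ m M F) (hℓ : ℓ % 3 = 1)
    {α : ZMod 3} (hα : α ≠ 0) :
    #{x : F | x ≠ 0 ∧ phase ℓ m α x = 0} = (3 ^ halfTotient ℓ m - 1) * (M * (ℓ - 1)) := by
  rw [← mul_assoc, ← h.card_filter_pow_prime (neg_ne_zero.2 hα)]
  congr 1
  ext x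
  simp only [mem_filter, mem_univ, true_and]
  rw [phase, sub_eq_zero, h.expo_eq]
  constructor
  · rintro ⟨h0, h1⟩
    exact (h.trace_eq_iff_of_mod_one hℓ (h.pow_expo_pow h0) hα).1 h1
  · intro h1
    have h0 := h.ne_zero_of_pow_expo (neg_ne_zero.2 hα) h1.1
    exact ⟨h0, (h.trace_eq_iff_of_mod_one hℓ (h.pow_expo_pow h0) hα).2 h1⟩

open scoped Classical in
theorem card_trace_eq_of_mod_two (h : PrimitiveRootSetting ℓ m M F) (hℓ : ℓ % 3 = 2)
    {α : ZMod 3} (hα : α ≠ 0) :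
    #{x : F | x ≠ 0 ∧ phase ℓ m α x = 0} = (3 ^ halfTotient ℓ m - 1) * (M * ℓ) := by
  have hc := mul_ne_zero hα h.sign_ne_zero
  have h1 := h.card_filter_pow_prime (neg_ne_zero.2 hc)
  have h2 := card_filter_pow_eq_algebraMap (F := F) (d := (3 ^ halfTotient ℓ m - 1) * M)
    (dvd_trans (mul_dvd_mul_left 2 (dvd_mul_right _ _)) h.two_mul_dvd) hc
  have h3 : (3 ^ halfTotient ℓ m - 1) * (M * ℓ)
      = (3 ^ halfTotient ℓ m - 1) * M * (ℓ - 1) + (3 ^ halfTotient ℓ m - 1) * M := by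
    obtain ⟨t, ht⟩ := h.odd
    rw [ht, Nat.add_sub_cancel]
    ring
  refine Eq.trans ?_ (h3.trans (congrArg₂ (· + ·) h1.symm h2.symm)).symm
  rw [← card_union_of_disjoint]
  · congr 1
    ext x
    simp only [mem_filter, mem_univ, true_and, mem_union]
    rw [phase, sub_eq_zero, h.expo_eq]
    constructor
    · rintro ⟨h0, h1⟩
      exact (h.trace_eq_iff_of_mod_two hℓ (h.pow_expo_pow h0) hα).1 h1
    · intro h1
      have h0 : x ≠ 0 := by
        rcases h1 with h1 | h1
        · exact h.ne_zero_of_pow_expo (neg_ne_zero.2 hc) h1.1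
        · refine h.ne_zero_of_pow_expo hc ?_
          rw [h1, h.algebraMap_pow_odd hc]
      exact ⟨h0, (h.trace_eq_iff_of_mod_two hℓ (h.pow_expo_pow h0) hα).2 h1⟩
  · rw [disjoint_filter]
    rintro x - ⟨h4, -⟩ h5
    rw [h5, h.algebraMap_pow_odd hc] at h4
    have := (algebraMap (ZMod 3) F).injective h4
    generalize α * (ℓ : ZMod 3) ^ (m - 1) = r at this hc
    revert r
    decide

open scoped Classical in
-- Complementary count: the values 1 and -1 of the trace occupy M·A lines each out of s + 1 =
-- 2ℓ^m·M.
theorem card_trace_eq_zero (h : PrimitiveRootSetting ℓ m M F) {A : ℕ}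
    (hA : ∀ α : ZMod 3, α ≠ 0 →
      #{x : F | x ≠ 0 ∧ phase ℓ m α x = 0} = (3 ^ halfTotient ℓ m - 1) * (M * A))
    (hle : A ≤ ℓ ^ m) :
    #{x : F | x ≠ 0 ∧ phase ℓ m 0 x = 0}
      = (3 ^ halfTotient ℓ m - 1) * (2 * M * (ℓ ^ m - A)) := by
  have hsum : #{x : F | x ≠ 0 ∧ phase ℓ m 0 x = 0} + #{x : F | x ≠ 0 ∧ phase ℓ m 1 x = 0}
      + #{x : F | x ≠ 0 ∧ phase ℓ m (-1) x = 0} = Fintype.card F - 1 := by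
    have h1 : #(univ.erase (0 : F)) = Fintype.card F - 1 := by
      rw [card_erase_of_mem (mem_univ _), card_univ]
    rw [← h1, card_eq_sum_ones, card_eq_sum_ones, card_eq_sum_ones, card_eq_sum_ones,
      sum_filter, sum_filter, sum_filter, ← sum_add_distrib, ← sum_add_distrib,
      ← sum_filter_add_sum_filter_not (univ : Finset F) (fun x => x ≠ 0)]
    have h2 : (univ.filter fun x : F => x ≠ 0) = univ.erase 0 := by
      ext x
      simp
    rw [h2]
    rw [Finset.sum_eq_zero (s := univ.filter fun x : F => ¬ x ≠ 0), add_zero]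
    · refine sum_congr rfl fun x hx => ?_
      have hx0 : x ≠ 0 := (mem_erase.1 hx).1
      simp only [hx0, ne_eq, not_false_eq_true, true_and, phase]
      generalize Algebra.trace (ZMod 3) F (x ^ ((Fintype.card F - 1) / (2 * ℓ ^ m))) = t
      revert t
      decide
    · intro x hx
      have : x = 0 := by simpa using hx
      simp [this]
  rw [hA 1 (by decide), hA (-1) (by decide), h.card_sub_one] at hsum
  obtain ⟨c, hc⟩ := Nat.exists_eq_add_of_le hle
  rw [hc] at hsum ⊢
  rw [Nat.add_sub_cancel_left]
  have : (3 ^ halfTotient ℓ m - 1) * M * (2 * (A + c)) = (3 ^ halfTotient ℓ m - 1) * (2 * M * c)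
    + (3 ^ halfTotient ℓ m - 1) * (M * A) + (3 ^ halfTotient ℓ m - 1) * (M * A) := by ring
  lia

open scoped Classical in
theorem phaseData (h : PrimitiveRootSetting ℓ m M F) {θ : F} (hθ0 : θ ≠ 0)
    (hθ : θ ^ 3 ^ halfTotient ℓ m = -θ) {α : ZMod 3} {κ : ℕ}
    (hκ : #{x : F | x ≠ 0 ∧ phase ℓ m α x = 0} = (3 ^ halfTotient ℓ m - 1) * κ) :
    PhaseData (halfTotient ℓ m) (phase ℓ m α) θ κ where
  one_le := one_le_halfTotient h.prime
  card_eq := h.card_eq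
  invariant := h.phase_invariant α
  ne_zero := hθ0
  pow_eq := hθ
  phaseSum_zero := by
    have h1 := three_mul_card_eq (phase ℓ m α : F → ZMod 3) 0
    simp only [zero_mul, map_zero, add_zero] at h1
    rw [hκ, h.card_eq] at h1
    push_cast [Nat.cast_sub h.one_le_pow] at h1
    linarith

end PrimitiveRootSetting

end Phase

/-! ### The residue sets described by divisibility -/

section Residues

variable {ℓ m j : ℕ}

/-- The four pieces cut [0, 2ℓ^m) into blocks of length ℓ^(m-1) with the multiples of ℓ^(m-1) left
out. -/
theorem mem_setJpp_iff (hℓ : ℓ.Prime) (hm : 1 ≤ m) (hj : j < 2 * ℓ ^ m) :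
    j ∈ setJpp ℓ m ↔ ¬ ℓ ^ (m - 1) ∣ j := by
  have hX : ℓ ^ m = ℓ * ℓ ^ (m - 1) := by rw [← pow_succ', Nat.sub_add_cancel hm]
  have hY : 0 < ℓ ^ (m - 1) := pow_pos hℓ.pos _
  simp only [setJpp, setJ11, setJ1, setJ2, setJ31, setJ4, Set.mem_union, Set.mem_ofPred_eq,
    Set.mem_sdiff, Set.mem_singleton_iff]
  rw [hX] at hj ⊢
  clear hX
  generalize ℓ ^ (m - 1) = Y at *
  obtain ⟨t, rfl⟩ : ∃ t, ℓ = t + 1 := ⟨ℓ - 1, by have := hℓ.pos; lia⟩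
  rw [Nat.add_sub_cancel]
  have hlt (a b : ℕ) (hab : a * Y < b * Y) : a + 1 ≤ b := Nat.lt_of_mul_lt_mul_right hab
  constructor
  · rintro (((⟨-, h⟩ | ⟨⟨h1, h2⟩, h3⟩) | ⟨k, u, hk, hk', hu, hu', rfl⟩) | ⟨h1, h2⟩)
    · exact h
    · rintro ⟨c, rfl⟩
      rw [mul_comm Y c] at *
      have h4 := hlt _ _ h1
      have h5 := Nat.le_of_mul_le_mul_right h2 hY
      exact h3 (by rw [le_antisymm h5 h4])
    · rintro ⟨c, hc⟩
      have h1 : Y ≤ k * Y := Nat.le_mul_of_pos_left Y hk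
      have h2 : (t + 1) * Y + k * Y = Y * c + u := by lia
      have h3 : (t + 1 + k) * Y = c * Y + u := by rw [add_mul, h2, mul_comm]
      have h4 := hlt c (t + 1 + k) (by lia)
      have h5 : (c + 1) * Y ≤ (t + 1 + k) * Y := Nat.mul_le_mul_right Y h4
      rw [add_mul] at h5
      lia
    · rintro ⟨c, rfl⟩
      have h3 : (2 * (t + 1) - 1) * Y < c * Y := by
        rw [Nat.sub_mul, mul_assoc, one_mul, mul_comm c]
        exact h1
      have h4 := hlt _ _ h3
      have h5 : c * Y < (2 * (t + 1)) * Y := by rw [mul_assoc, mul_comm c]; exact hj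
      have h6 := hlt _ _ h5
      lia
  · intro h
    have hj0 : j ≠ 0 := by rintro rfl; exact h (dvd_zero _)
    by_cases h1 : j ≤ t * Y
    · exact Or.inl (Or.inl (Or.inl ⟨⟨by lia, h1⟩, h⟩))
    by_cases h2 : j ≤ (t + 1) * Y
    · refine Or.inl (Or.inl (Or.inr ⟨⟨by lia, h2⟩, ?_⟩))
      rintro rfl
      exact h (dvd_mul_left _ _)
    by_cases h3 : 2 * ((t + 1) * Y) - Y < j
    · exact Or.inr ⟨h3, by lia⟩
    · left
      right
      have hdm := Nat.div_add_mod j Y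
      have hr : 0 < j % Y := Nat.pos_of_ne_zero fun h0 => h (Nat.dvd_of_mod_eq_zero h0)
      have hr' : j % Y < Y := Nat.mod_lt _ hY
      set d := j / Y with hd
      rw [mul_comm] at hdm
      have h4 : t + 1 ≤ d := by
        have : (t + 1) * Y < (d + 1) * Y := by rw [add_mul d]; lia
        have := hlt _ _ this
        lia
      have h5 : d + 1 ≤ 2 * (t + 1) - 1 := by
        apply hlt
        rw [Nat.sub_mul, mul_assoc, one_mul]
        lia
      refine ⟨d + 1 - (t + 1), Y - j % Y, by lia, by lia, by lia, by lia, ?_⟩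
      rw [← add_mul, Nat.add_sub_cancel' (by lia), add_mul, one_mul]
      lia

theorem mem_setJp_iff (hℓ : ℓ.Prime) (hm : 1 ≤ m) (hj : j < 2 * ℓ ^ m) :
    j ∈ setJp ℓ m ↔ j = 0 ∨ j = ℓ ^ m ∨ ¬ ℓ ^ (m - 1) ∣ j := by
  rw [← mem_setJpp_iff hℓ hm hj]
  have hX : ℓ ^ m = ℓ * ℓ ^ (m - 1) := by rw [← pow_succ', Nat.sub_add_cancel hm]
  have hY : 0 < ℓ ^ (m - 1) := pow_pos hℓ.pos _
  have h2 : ℓ ^ m ∈ setJ2 ℓ m := by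
    refine ⟨?_, le_rfl⟩
    rw [hX]
    exact Nat.mul_lt_mul_of_pos_right (Nat.sub_lt hℓ.pos one_pos) hY
  simp only [setJp, setJpp, Set.mem_union, Set.mem_sdiff, Set.mem_singleton_iff]
  by_cases hjX : j = ℓ ^ m
  · subst hjX
    simp [h2]
  · simp only [hjX, not_false_eq_true, and_true, false_or]
    tauto

/-- In the second set ℓ^m contributes the odd summand ℓ to the cofactor of ℓ^(m-1), so an even k
there gives an odd cofactor. -/
theorem exists_odd_of_mem (hℓ : ℓ.Prime) (hodd : Odd ℓ) (hm : 1 ≤ m)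
    (hj : j ∈ setJ12 ℓ m ∪ setJ32 ℓ m) :
    ∃ k, j = ℓ ^ (m - 1) * k ∧ Odd k ∧ ¬ ℓ ∣ k := by
  have hY : 0 < ℓ ^ (m - 1) := pow_pos hℓ.pos _
  rcases hj with ⟨⟨h1, h2⟩, ⟨k, rfl⟩, h4⟩ | ⟨k, h1, h2, h3, rfl⟩
  · refine ⟨k, rfl, ?_, fun h5 => ?_⟩
    · rw [← Nat.not_even_iff_odd, even_iff_two_dvd]
      exact fun h5 => h4 (dvd_mul_of_dvd_right h5 _)
    · rw [mul_comm] at h2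
      have h6 := Nat.le_of_mul_le_mul_right h2 hY
      have hk : 0 < k := Nat.pos_of_ne_zero (by rintro rfl; simp at h1)
      have := Nat.le_of_dvd hk h5
      have := hℓ.pos
      lia
  · refine ⟨ℓ + k, ?_, hodd.add_even (even_iff_two_dvd.2 h3), fun h5 => ?_⟩
    · rw [mul_add, ← pow_succ, Nat.sub_add_cancel hm, mul_comm]
    · have := Nat.le_of_dvd h1 ((Nat.dvd_add_right (dvd_refl ℓ)).1 h5)
      have := hℓ.pos
      lia

theorem exists_even_of_mem (hℓ : ℓ.Prime) (hodd : Odd ℓ) (hm : 1 ≤ m)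
    (hj : j ∈ setJ13 ℓ m ∪ setJ33 ℓ m) :
    ∃ k, j = ℓ ^ (m - 1) * k ∧ Even k ∧ ¬ ℓ ∣ k := by
  have hY : 0 < ℓ ^ (m - 1) := pow_pos hℓ.pos _
  rcases hj with ⟨⟨h1, h2⟩, ⟨k, rfl⟩⟩ | ⟨k, h1, h2, h3, rfl⟩
  · refine ⟨2 * k, by ring, even_two_mul k, fun h5 => ?_⟩
    have h6 : 2 * ℓ ^ (m - 1) * k = (2 * k) * ℓ ^ (m - 1) := by ring
    rw [h6] at h2 h1
    have h7 := Nat.le_of_mul_le_mul_right h2 hY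
    have hk : 0 < 2 * k := Nat.pos_of_ne_zero (by intro h0; rw [h0] at h1; simp at h1)
    have := Nat.le_of_dvd hk h5
    have := hℓ.pos
    lia
  · refine ⟨ℓ + k, ?_, ?_, fun h5 => ?_⟩
    · rw [mul_add, ← pow_succ, Nat.sub_add_cancel hm, mul_comm]
    · rw [← even_iff_two_dvd, Nat.not_even_iff_odd] at h3
      exact hodd.add_odd h3
    · have := Nat.le_of_dvd h1 ((Nat.dvd_add_right (dvd_refl ℓ)).1 h5)
      have := hℓ.pos
      lia

end Residues

/-! ### Reading χ(β) off from j_β -/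

section Generator

variable {F : Type*} [Field F] [Fintype F] [CharP F 3] [Algebra (ZMod 3) F]
variable {ℓ m M : ℕ} {g : Fˣ}

theorem isPrimitiveRoot_of_generator (hg : ∀ x : Fˣ, x ∈ Subgroup.zpowers g) :
    IsPrimitiveRoot (g : F) (Fintype.card F - 1) := by
  rw [IsPrimitiveRoot.coe_units_iff, IsPrimitiveRoot.iff_orderOf,
    orderOf_eq_card_of_forall_mem_zpowers hg, Nat.card_units, Nat.card_eq_fintype_card]

theorem pow_ind (hg : ∀ x : Fˣ, x ∈ Subgroup.zpowers g) {β : F} (hβ : β ≠ 0) :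
    (g : F) ^ ind g β = β := by
  have hne : {k : ℕ | (g : F) ^ k = β}.Nonempty := by
    have h1 : Units.mk0 β hβ ∈ Submonoid.powers g := by
      rw [mem_powers_iff_mem_zpowers]
      exact hg _
    obtain ⟨k, hk⟩ := h1
    refine ⟨k, ?_⟩
    have := congrArg Units.val hk
    simpa using this
  exact Nat.sInf_mem hne

theorem jRes_lt (hℓ : 0 < ℓ) (β : F) : jRes ℓ m g β < 2 * ℓ ^ m := by
  have hN : (0 : ℤ) < ((2 * ℓ ^ m : ℕ) : ℤ) := by
    exact_mod_cast Nat.mul_pos two_pos (pow_pos hℓ m)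
  have h1 := Int.emod_lt_of_pos (-(ind g β : ℤ)) hN
  have h2 := Int.emod_nonneg (-(ind g β : ℤ)) hN.ne'
  unfold jRes
  lia

theorem dvd_jRes_add_ind (hℓ : 0 < ℓ) (β : F) : 2 * ℓ ^ m ∣ jRes ℓ m g β + ind g β := by
  have hN : (0 : ℤ) < ((2 * ℓ ^ m : ℕ) : ℤ) := by
    exact_mod_cast Nat.mul_pos two_pos (pow_pos hℓ m)
  have h2 := Int.emod_nonneg (-(ind g β : ℤ)) hN.ne'
  rw [← Int.natCast_dvd_natCast, Nat.cast_add]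
  unfold jRes
  rw [Int.toNat_of_nonneg h2]
  have h3 := Int.emod_add_mul_ediv (-(ind g β : ℤ)) ((2 * ℓ ^ m : ℕ) : ℤ)
  refine ⟨-(-(ind g β : ℤ) / ((2 * ℓ ^ m : ℕ) : ℤ)), ?_⟩
  linarith

namespace PrimitiveRootSetting

theorem isPrimitiveRoot (h : PrimitiveRootSetting ℓ m M F)
    (hg : ∀ x : Fˣ, x ∈ Subgroup.zpowers g) :
    IsPrimitiveRoot ((g : F) ^ ((3 ^ halfTotient ℓ m - 1) * M)) (2 * ℓ ^ m) :=
  (isPrimitiveRoot_of_generator hg).pow (Nat.sub_pos_of_lt Fintype.one_lt_card) h.card_sub_one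

theorem pow_eq_neg_one (h : PrimitiveRootSetting ℓ m M F)
    (hg : ∀ x : Fˣ, x ∈ Subgroup.zpowers g) :
    ((g : F) ^ ((3 ^ halfTotient ℓ m - 1) * M)) ^ ℓ ^ m = -1 := by
  have h1 := (h.isPrimitiveRoot hg).pow (Nat.mul_pos two_pos (pow_pos h.prime.pos m))
    (mul_comm 2 (ℓ ^ m))
  exact h1.eq_neg_one_of_two_right

/-- The exponent ℓ^m·M is (s+1)/2, so the (s-1)-th power of this element is g^((q-1)/2) = -1. This
is the concrete θ used for the kernel of the relative trace. -/
theorem theta_pow (h : PrimitiveRootSetting ℓ m M F)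
    (hg : ∀ x : Fˣ, x ∈ Subgroup.zpowers g) :
    ((g : F) ^ (ℓ ^ m * M)) ^ 3 ^ halfTotient ℓ m = -(g : F) ^ (ℓ ^ m * M) := by
  have h1 : 3 ^ halfTotient ℓ m = (3 ^ halfTotient ℓ m - 1) + 1 :=
    (Nat.sub_add_cancel h.one_le_pow).symm
  have h2 : ((g : F) ^ (ℓ ^ m * M)) ^ (3 ^ halfTotient ℓ m - 1) = -1 := by
    rw [← h.pow_eq_neg_one hg, ← pow_mul, ← pow_mul]
    congr 1
    ring
  rw [h1, pow_succ, h2, neg_one_mul]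

/-- With γ = g^((s-1)M) of order 2ℓ^m, raising β to the power (s-1)M gives γ^(Ind β), whose inverse
is γ^(j_β); the factor θ contributes (-1)^M. -/
theorem pow_theta_div (h : PrimitiveRootSetting ℓ m M F)
    (hg : ∀ x : Fˣ, x ∈ Subgroup.zpowers g) {β : F} (hβ : β ≠ 0) :
    ((g : F) ^ (ℓ ^ m * M) / β) ^ ((3 ^ halfTotient ℓ m - 1) * M)
      = (-1) ^ M * ((g : F) ^ ((3 ^ halfTotient ℓ m - 1) * M)) ^ jRes ℓ m g β := by
  have h1 : ((g : F) ^ (ℓ ^ m * M)) ^ ((3 ^ halfTotient ℓ m - 1) * M) = (-1) ^ M := by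
    rw [← h.pow_eq_neg_one hg, ← pow_mul, ← pow_mul, ← pow_mul]
    congr 1
    ring
  have h2 : ((g : F) ^ ((3 ^ halfTotient ℓ m - 1) * M)) ^ jRes ℓ m g β
      * β ^ ((3 ^ halfTotient ℓ m - 1) * M) = 1 := by
    nth_rw 2 [← pow_ind hg hβ]
    rw [← pow_mul _ (ind g β), mul_comm (ind g β), pow_mul _ _ (ind g β), ← pow_add]
    obtain ⟨c, hc⟩ := dvd_jRes_add_ind (m := m) (g := g) h.prime.pos β
    rw [hc, pow_mul, (h.isPrimitiveRoot hg).pow_eq_one, one_pow]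
  rw [div_pow, h1, div_eq_iff (pow_ne_zero _ hβ), mul_assoc, h2, mul_one]

/-- The trace of the `j`-th power of the chosen root of unity of order `2 ℓ ^ m`. -/
noncomputable def rootTrace (ℓ m M : ℕ) (g : Fˣ) (j : ℕ) : ZMod 3 :=
  Algebra.trace (ZMod 3) F (((g : F) ^ ((3 ^ halfTotient ℓ m - 1) * M)) ^ j)

theorem zeroInd_eq (h : PrimitiveRootSetting ℓ m M F)
    (hg : ∀ x : Fˣ, x ∈ Subgroup.zpowers g) {β : F} (hβ : β ≠ 0) (α : ZMod 3) :
    zeroInd (phase ℓ m α) ((g : F) ^ (ℓ ^ m * M)) β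
      = if (-1) ^ M * rootTrace ℓ m M g (jRes ℓ m g β) = α then 1 else 0 := by
  have h1 : Algebra.trace (ZMod 3) F (((g : F) ^ (ℓ ^ m * M) / β) ^
      ((3 ^ halfTotient ℓ m - 1) * M)) = (-1) ^ M * rootTrace ℓ m M g (jRes ℓ m g β) := by
    rw [h.pow_theta_div hg hβ, rootTrace]
    rcases neg_one_pow_eq_or F M with h2 | h2 <;>
    rcases Nat.even_or_odd M with h3 | h3 <;> simp [h3.neg_one_pow]
  rw [zeroInd, phase, h.expo_eq, h1]
  simp [hβ, sub_eq_zero]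

theorem rootTrace_of_not_dvd (h : PrimitiveRootSetting ℓ m M F)
    (hg : ∀ x : Fˣ, x ∈ Subgroup.zpowers g) {j : ℕ} (hj : ¬ ℓ ^ (m - 1) ∣ j) :
    rootTrace ℓ m M g j = 0 := by
  have hγ := h.isPrimitiveRoot hg
  refine trace_eq_zero_of_pow_ne_one h.prime h.odd h.one_le h.orderOf_eq h.card_eq' ?_ ?_
  · rw [pow_right_comm _ _ (2 * ℓ ^ m), hγ.pow_eq_one, one_pow]
  · rw [← pow_mul]
    intro h1
    apply hj
    have h2 := (hγ.pow_eq_one_iff_dvd _).1 h1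
    have h3 : 2 * ℓ ^ m = ℓ ^ (m - 1) * (2 * ℓ) := by
      rw [mul_left_comm, ← pow_succ, Nat.sub_add_cancel h.one_le]
    rw [h3] at h2
    exact Nat.dvd_of_mul_dvd_mul_right (Nat.mul_pos two_pos h.prime.pos) h2

theorem rootTrace_of_not_dvd_index (h : PrimitiveRootSetting ℓ m M F)
    (hg : ∀ x : Fˣ, x ∈ Subgroup.zpowers g) {k : ℕ} (hk : ¬ ℓ ∣ k) :
    rootTrace ℓ m M g (ℓ ^ (m - 1) * k) = -(-1) ^ k * (ℓ : ZMod 3) ^ (m - 1) := by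
  have hγ := h.isPrimitiveRoot hg
  refine trace_eq_of_sq_ne_one h.prime h.odd h.one_le h.orderOf_eq h.card_eq' ?_ ?_
    (pow_ne_zero _ (by decide)) ?_
  · rw [pow_right_comm _ _ (2 * ℓ ^ m), hγ.pow_eq_one, one_pow]
  · rw [← pow_mul]
    intro h1
    apply hk
    have h2 := (hγ.pow_eq_one_iff_dvd _).1 h1
    have h3 : 2 * ℓ ^ m = (2 * ℓ ^ (m - 1)) * ℓ := by
      rw [mul_assoc, ← pow_succ, Nat.sub_add_cancel h.one_le]
    have h4 : ℓ ^ (m - 1) * k * 2 = (2 * ℓ ^ (m - 1)) * k := by ring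
    rw [h3, h4] at h2
    exact Nat.dvd_of_mul_dvd_mul_left (Nat.mul_pos two_pos (pow_pos h.prime.pos _)) h2
  · have h5 : ℓ ^ (m - 1) * k * ℓ = ℓ ^ m * k := by
      rw [mul_right_comm, ← pow_succ, Nat.sub_add_cancel h.one_le]
    rw [← pow_mul, h5, pow_mul, h.pow_eq_neg_one hg, map_pow, map_neg, map_one]

theorem rootTrace_zero (h : PrimitiveRootSetting ℓ m M F) :
    rootTrace ℓ m M g 0 = (ℓ - 1) * (ℓ : ZMod 3) ^ (m - 1) := by
  have := trace_eq_of_sq_eq_one h.prime h.odd h.one_le h.orderOf_eq h.card_eq'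
    (one_ne_zero (α := ZMod 3))
  rw [map_one, one_mul] at this
  rw [rootTrace, pow_zero, this]

theorem rootTrace_half (h : PrimitiveRootSetting ℓ m M F)
    (hg : ∀ x : Fˣ, x ∈ Subgroup.zpowers g) :
    rootTrace ℓ m M g (ℓ ^ m) = -(ℓ - 1) * (ℓ : ZMod 3) ^ (m - 1) := by
  have := trace_eq_of_sq_eq_one h.prime h.odd h.one_le h.orderOf_eq h.card_eq'
    (show (-1 : ZMod 3) ≠ 0 by decide)
  rw [map_neg, map_one, neg_one_mul] at this
  rw [rootTrace, h.pow_eq_neg_one hg, this]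

theorem rootTrace_of_mem_odd (h : PrimitiveRootSetting ℓ m M F)
    (hg : ∀ x : Fˣ, x ∈ Subgroup.zpowers g) {j : ℕ} (hj : j ∈ setJ12 ℓ m ∪ setJ32 ℓ m) :
    rootTrace ℓ m M g j = (ℓ : ZMod 3) ^ (m - 1) := by
  obtain ⟨k, rfl, hk, hk'⟩ := exists_odd_of_mem h.prime h.odd h.one_le hj
  rw [h.rootTrace_of_not_dvd_index hg hk', hk.neg_one_pow, neg_neg, one_mul]

theorem rootTrace_of_mem_even (h : PrimitiveRootSetting ℓ m M F)
    (hg : ∀ x : Fˣ, x ∈ Subgroup.zpowers g) {j : ℕ} (hj : j ∈ setJ13 ℓ m ∪ setJ33 ℓ m) :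
    rootTrace ℓ m M g j = -(ℓ : ZMod 3) ^ (m - 1) := by
  obtain ⟨k, rfl, hk, hk'⟩ := exists_even_of_mem h.prime h.odd h.one_le hj
  rw [h.rootTrace_of_not_dvd_index hg hk', hk.neg_one_pow, neg_one_mul]

theorem rootTrace_ne_zero (h : PrimitiveRootSetting ℓ m M F)
    (hg : ∀ x : Fˣ, x ∈ Subgroup.zpowers g) {k : ℕ} (hk : ¬ ℓ ∣ k) :
    rootTrace ℓ m M g (ℓ ^ (m - 1) * k) ≠ 0 := by
  rw [h.rootTrace_of_not_dvd_index hg hk]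
  exact mul_ne_zero (neg_ne_zero.2 (pow_ne_zero _ (by decide))) h.sign_ne_zero

theorem rootTrace_eq_zero_iff_of_mod_one (h : PrimitiveRootSetting ℓ m M F) (hℓ : ℓ % 3 = 1)
    (hg : ∀ x : Fˣ, x ∈ Subgroup.zpowers g) {j : ℕ} (hj : j < 2 * ℓ ^ m) :
    rootTrace ℓ m M g j = 0 ↔ j ∈ setJp ℓ m := by
  rw [mem_setJp_iff h.prime h.one_le hj]
  constructor
  · intro h0
    by_contra hne
    push Not at hne
    obtain ⟨h1, h2, k, rfl⟩ := hne
    refine h.rootTrace_ne_zero hg ?_ h0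
    rintro ⟨c, rfl⟩
    have h3 : ℓ ^ (m - 1) * (ℓ * c) = ℓ ^ m * c := by
      rw [← mul_assoc, ← pow_succ, Nat.sub_add_cancel h.one_le]
    rw [h3] at h1 h2 hj
    rw [mul_comm 2] at hj
    have h4 := Nat.lt_of_mul_lt_mul_left hj
    interval_cases c
    · simp at h1
    · simp at h2
  · rintro (rfl | rfl | h1)
    · rw [h.rootTrace_zero, cast_eq_one hℓ, sub_self, zero_mul]
    · rw [h.rootTrace_half hg, cast_eq_one hℓ, sub_self, neg_zero, zero_mul]
    · exact h.rootTrace_of_not_dvd hg h1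

theorem rootTrace_eq_zero_iff_of_mod_two (h : PrimitiveRootSetting ℓ m M F) (hℓ : ℓ % 3 = 2)
    (hg : ∀ x : Fˣ, x ∈ Subgroup.zpowers g) {j : ℕ} (hj : j < 2 * ℓ ^ m) :
    rootTrace ℓ m M g j = 0 ↔ j ∈ setJpp ℓ m := by
  rw [mem_setJpp_iff h.prime h.one_le hj]
  have hd : (ℓ : ZMod 3) - 1 ≠ 0 := by rw [cast_eq_neg_one hℓ]; decide
  constructor
  · rintro h0 ⟨k, rfl⟩
    by_cases hk : ℓ ∣ k
    · obtain ⟨c, rfl⟩ := hk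
      have h3 : ℓ ^ (m - 1) * (ℓ * c) = ℓ ^ m * c := by
        rw [← mul_assoc, ← pow_succ, Nat.sub_add_cancel h.one_le]
      rw [h3] at h0 hj
      rw [mul_comm 2] at hj
      have h4 := Nat.lt_of_mul_lt_mul_left hj
      interval_cases c
      · rw [mul_zero, h.rootTrace_zero] at h0
        exact mul_ne_zero hd h.sign_ne_zero h0
      · rw [mul_one, h.rootTrace_half hg] at h0
        exact mul_ne_zero (neg_ne_zero.2 hd) h.sign_ne_zero h0
    · exact h.rootTrace_ne_zero hg hk h0
  · exact h.rootTrace_of_not_dvd hg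

end PrimitiveRootSetting

end Generator

/-! ### Bounds on the number of zero lines -/

section SideConditions

variable {s X M A : ℕ}

theorem zeroLines_bounds (hs : s + 1 = 2 * X * M) (hA : 3 ≤ A) (hAX : A ≤ X) (hM : 1 ≤ M) :
    3 ≤ M * A ∧ M * A + 1 ≤ s := by
  have h1 : 1 * 3 ≤ M * A := Nat.mul_le_mul hM hA
  have h2 : M * A ≤ M * X := Nat.mul_le_mul_left M hAX
  have h3 : 2 * X * M = 2 * (M * X) := by ring
  lia

theorem zeroLines_bounds' (hs : s + 1 = 2 * X * M) (hA : 1 ≤ A) (hAX : A ≤ X) (hM : 1 ≤ M)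
    (h3 : 3 ≤ 2 * M * (X - A)) : 3 ≤ 2 * M * (X - A) ∧ 2 * M * (X - A) + 1 ≤ s := by
  have h1 : 1 * 1 ≤ M * A := Nat.mul_le_mul hM hA
  obtain ⟨c, rfl⟩ := Nat.exists_eq_add_of_le hAX
  rw [Nat.add_sub_cancel_left] at *
  have h4 : 2 * (A + c) * M = 2 * M * c + 2 * (M * A) := by ring
  lia

/-- This and the next lemma factor the quantity s + 1 - 3κ that governs coincidences between
weights, for α ≠ 0 and α = 0 respectively. -/
theorem add_one_sub_three_mul {a : ℤ} (hs : a + 1 = 2 * X * M) :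
    a + 1 - 3 * ((M * A : ℕ) : ℤ) = M * (2 * X - 3 * A) := by
  rw [hs]
  push_cast
  ring

theorem add_one_sub_three_mul' {a : ℤ} (hs : a + 1 = 2 * X * M) (hAX : A ≤ X) :
    a + 1 - 3 * ((2 * M * (X - A) : ℕ) : ℤ) = -2 * (M * (2 * X - 3 * A)) := by
  rw [hs]
  push_cast [Nat.cast_sub hAX]
  ring

end SideConditions

/-! ### Rewriting the parameters of a distribution -/

section Congr

variable {ι : Type*} [Fintype ι] {C : Submodule (ZMod 3) (ι → ZMod 3)} {n n' : ℝ} {k : ℕ}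

theorem HasWeightDistribution.congr_two {a b c d a' b' c' d' : ℝ}
    (h : HasWeightDistribution C n k [(a, b), (c, d)]) (hn : n' = n) (ha : a' = a) (hb : b' = b)
    (hc : c' = c) (hd : d' = d) : HasWeightDistribution C n' k [(a', b'), (c', d')] := by
  rw [hn, ha, hb, hc, hd]
  exact h

theorem HasWeightDistribution.congr_four {a b c d u v w a' c' d' u' v' w' t : ℝ}
    (h : HasWeightDistribution C n k [(a, b), (c, d), (u, v), (w, t)]) (hn : n' = n)
    (ha : a' = a) (hc : c' = c) (hd : d' = d) (hu : u' = u) (hv : v' = v) (hw : w' = w)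
    {t' : ℝ} (ht : t' = t) :
    HasWeightDistribution C n' k [(a', b), (c', d'), (u', v'), (w', t')] := by
  rw [hn, ha, hc, hd, hu, hv, hw, ht]
  exact h

end Congr

variable {F : Type*} [Field F] [Fintype F] [CharP F 3] [Algebra (ZMod 3) F]
variable {ℓ m M : ℕ} {g : Fˣ} {β : F} {α : ZMod 3}

theorem hasWeightDistribution_code {n : ℝ} {k : ℕ} {W : List (ℝ × ℝ)}
    (h : HasWeightDistribution (traceCode (phaseSet (phase ℓ m α) β)) n k W) :
    HasWeightDistribution (code ℓ m α β) n k W := by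
  unfold code
  rw [definingSet_eq_phaseSet]
  exact h

/-! ### Separation of the weights and the two classes of ℓ modulo 3 -/

namespace PrimitiveRootSetting

theorem five_le (h : PrimitiveRootSetting ℓ m M F) : 5 ≤ ℓ := by
  have h1 := h.prime.two_le
  obtain ⟨t, ht⟩ := h.odd
  have h2 := h.mod_three
  by_contra hlt
  have h3 : ℓ = 3 := by lia
  rw [h3] at h2
  exact h2 rfl

theorem seven_le (h : PrimitiveRootSetting ℓ m M F) (hℓ : ℓ % 3 = 1) : 7 ≤ ℓ := by
  have h1 := h.five_le
  obtain ⟨t, ht⟩ := h.odd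
  lia

theorem one_le_quot (h : PrimitiveRootSetting ℓ m M F) : 1 ≤ M := by
  refine Nat.one_le_iff_ne_zero.2 fun h0 => ?_
  have := h.quot_eq
  rw [h0, mul_zero] at this
  lia

theorem even_quot (h : PrimitiveRootSetting ℓ m M F) (hℓ : ℓ % 3 = 1) : Even M :=
  (even_quotient_iff h.prime h.odd h.one_le h.mod_three h.orderOf_eq h.quot_eq).2 hℓ

theorem odd_quot (h : PrimitiveRootSetting ℓ m M F) (hℓ : ℓ % 3 = 2) : Odd M := by
  rw [← Nat.not_even_iff_odd,
    even_quotient_iff h.prime h.odd h.one_le h.mod_three h.orderOf_eq h.quot_eq]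
  lia

theorem two_le_quot (h : PrimitiveRootSetting ℓ m M F) (hℓ : ℓ % 3 = 1) : 2 ≤ M := by
  obtain ⟨r, hr⟩ := h.even_quot hℓ
  have := h.one_le_quot
  lia

theorem le_pow (h : PrimitiveRootSetting ℓ m M F) : ℓ ≤ ℓ ^ m :=
  Nat.le_self_pow (by have := h.one_le; lia) ℓ

theorem quot_eq_int (h : PrimitiveRootSetting ℓ m M F) :
    (3 : ℤ) ^ halfTotient ℓ m + 1 = 2 * (ℓ ^ m : ℕ) * M := by
  exact_mod_cast h.quot_eq

/-- For m = 1 the second factor is 3 - ℓ ≤ -4 and M ≥ 2 because M is even; for m ≥ 2 the term ℓ^m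
dominates. -/
theorem discriminant_of_mod_one (h : PrimitiveRootSetting ℓ m M F) (hℓ : ℓ % 3 = 1) :
    (M : ℤ) * (2 * (ℓ ^ m : ℕ) - 3 * (ℓ - 1 : ℕ)) ≤ -8 ∨
      8 ≤ (M : ℤ) * (2 * (ℓ ^ m : ℕ) - 3 * (ℓ - 1 : ℕ)) := by
  have hM : (2 : ℤ) ≤ M := by exact_mod_cast h.two_le_quot hℓ
  have h7 : (7 : ℤ) ≤ ℓ := by exact_mod_cast h.seven_le hℓ
  have hc : ((ℓ - 1 : ℕ) : ℤ) = ℓ - 1 := by rw [Nat.cast_sub h.prime.one_le, Nat.cast_one]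
  rw [hc]
  rcases Nat.eq_or_lt_of_le h.one_le with h1 | h1
  · left
    rw [← h1, pow_one]
    nlinarith
  · right
    have h2 : (ℓ : ℤ) ^ 2 ≤ (ℓ : ℤ) ^ m := pow_le_pow_right₀ (by linarith) h1
    have h3 : (8 : ℤ) ≤ 2 * (ℓ : ℤ) ^ m - 3 * (ℓ - 1) := by nlinarith
    push_cast
    exact (by norm_num : (8 : ℤ) ≤ 1 * 8).trans
      (mul_le_mul (by linarith) h3 (by norm_num) (by linarith))

theorem discriminant_of_mod_two (h : PrimitiveRootSetting ℓ m M F) (hne : ℓ ^ m ≠ 5) :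
    (M : ℤ) * (2 * (ℓ ^ m : ℕ) - 3 * ℓ) ≤ -6 ∨ 8 ≤ (M : ℤ) * (2 * (ℓ ^ m : ℕ) - 3 * ℓ) := by
  have hM : (1 : ℤ) ≤ M := by exact_mod_cast h.one_le_quot
  have h5 : (5 : ℤ) ≤ ℓ := by exact_mod_cast h.five_le
  rcases Nat.eq_or_lt_of_le h.one_le with h1 | h1
  · left
    rw [← h1, pow_one] at hne ⊢
    have h6 : (6 : ℤ) ≤ ℓ := by
      have := h.five_le
      have : 6 ≤ ℓ := by lia
      exact_mod_cast this
    nlinarith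
  · right
    have h2 : (ℓ : ℤ) ^ 2 ≤ (ℓ : ℤ) ^ m := pow_le_pow_right₀ (by linarith) h1
    have h3 : (8 : ℤ) ≤ 2 * (ℓ : ℤ) ^ m - 3 * ℓ := by nlinarith
    push_cast
    exact (by norm_num : (8 : ℤ) ≤ 1 * 8).trans
      (mul_le_mul hM h3 (by norm_num) (by linarith))

/-- The weaker bound -5 also covers ℓ^m = 5. It suffices when χ(β) = 1, where only -2, 1 and 4 must
be avoided. -/
theorem discriminant_le (h : PrimitiveRootSetting ℓ m M F) :
    (M : ℤ) * (2 * (ℓ ^ m : ℕ) - 3 * ℓ) ≤ -5 ∨ 8 ≤ (M : ℤ) * (2 * (ℓ ^ m : ℕ) - 3 * ℓ) := by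
  by_cases h5 : ℓ ^ m = 5
  · left
    have h1 := h.five_le
    have h2 := h.le_pow
    have h3 : ℓ = 5 := by lia
    rw [h5, h3]
    have hM : (1 : ℤ) ≤ M := by exact_mod_cast h.one_le_quot
    push_cast
    linarith
  · rcases h.discriminant_of_mod_two h5 with h1 | h1
    · exact Or.inl (by linarith)
    · exact Or.inr h1

theorem theta_ne_zero : ((g : F) ^ (ℓ ^ m * M)) ≠ 0 := pow_ne_zero _ g.ne_zero

theorem phaseData_of_mod_one (h : PrimitiveRootSetting ℓ m M F) (hℓ : ℓ % 3 = 1)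
    (hg : ∀ x : Fˣ, x ∈ Subgroup.zpowers g) (hα : α ≠ 0) :
    PhaseData (halfTotient ℓ m) (phase ℓ m α) ((g : F) ^ (ℓ ^ m * M)) (M * (ℓ - 1)) :=
  h.phaseData theta_ne_zero (h.theta_pow hg) (h.card_trace_eq_of_mod_one hℓ hα)

theorem phaseData_zero_of_mod_one (h : PrimitiveRootSetting ℓ m M F) (hℓ : ℓ % 3 = 1)
    (hg : ∀ x : Fˣ, x ∈ Subgroup.zpowers g) :
    PhaseData (halfTotient ℓ m) (phase ℓ m 0) ((g : F) ^ (ℓ ^ m * M))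
      (2 * M * (ℓ ^ m - (ℓ - 1))) :=
  h.phaseData theta_ne_zero (h.theta_pow hg)
    (h.card_trace_eq_zero (fun _ => h.card_trace_eq_of_mod_one hℓ)
      ((Nat.sub_le _ _).trans h.le_pow))

theorem phaseData_of_mod_two (h : PrimitiveRootSetting ℓ m M F) (hℓ : ℓ % 3 = 2)
    (hg : ∀ x : Fˣ, x ∈ Subgroup.zpowers g) (hα : α ≠ 0) :
    PhaseData (halfTotient ℓ m) (phase ℓ m α) ((g : F) ^ (ℓ ^ m * M)) (M * ℓ) :=
  h.phaseData theta_ne_zero (h.theta_pow hg) (h.card_trace_eq_of_mod_two hℓ hα)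

theorem phaseData_zero_of_mod_two (h : PrimitiveRootSetting ℓ m M F) (hℓ : ℓ % 3 = 2)
    (hg : ∀ x : Fˣ, x ∈ Subgroup.zpowers g) :
    PhaseData (halfTotient ℓ m) (phase ℓ m 0) ((g : F) ^ (ℓ ^ m * M))
      (2 * M * (ℓ ^ m - ℓ)) :=
  h.phaseData theta_ne_zero (h.theta_pow hg)
    (h.card_trace_eq_zero (fun _ => h.card_trace_eq_of_mod_two hℓ) h.le_pow)

theorem zeroInd_eq_of_mod_one (h : PrimitiveRootSetting ℓ m M F) (hℓ : ℓ % 3 = 1)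
    (hg : ∀ x : Fˣ, x ∈ Subgroup.zpowers g) (hβ : β ≠ 0) (α : ZMod 3) :
    zeroInd (phase ℓ m α) ((g : F) ^ (ℓ ^ m * M)) β
      = if rootTrace ℓ m M g (jRes ℓ m g β) = α then 1 else 0 := by
  rw [h.zeroInd_eq hg hβ, (h.even_quot hℓ).neg_one_pow, one_mul]

theorem zeroInd_eq_of_mod_two (h : PrimitiveRootSetting ℓ m M F) (hℓ : ℓ % 3 = 2)
    (hg : ∀ x : Fˣ, x ∈ Subgroup.zpowers g) (hβ : β ≠ 0) (α : ZMod 3) :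
    zeroInd (phase ℓ m α) ((g : F) ^ (ℓ ^ m * M)) β
      = if -rootTrace ℓ m M g (jRes ℓ m g β) = α then 1 else 0 := by
  rw [h.zeroInd_eq hg hβ, (h.odd_quot hℓ).neg_one_pow, neg_one_mul]

theorem sign_eq_of_mod_two (h : PrimitiveRootSetting ℓ m M F) (hℓ : ℓ % 3 = 2) :
    (ℓ : ZMod 3) ^ (m - 1) = -(-1) ^ m := by
  obtain ⟨t, rfl⟩ := Nat.exists_eq_add_of_le' h.one_le
  rw [cast_eq_neg_one hℓ, Nat.add_sub_cancel, pow_succ, mul_neg_one, neg_neg]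

theorem neg_rootTrace_of_mem_odd (h : PrimitiveRootSetting ℓ m M F) (hℓ : ℓ % 3 = 2)
    (hg : ∀ x : Fˣ, x ∈ Subgroup.zpowers g) {j : ℕ}
    (hj : j ∈ {0} ∪ setJ12 ℓ m ∪ setJ32 ℓ m) : -rootTrace ℓ m M g j = (-1) ^ m := by
  rw [Set.union_assoc] at hj
  rcases hj with hj | hj
  · rw [Set.mem_singleton_iff.1 hj, h.rootTrace_zero, h.sign_eq_of_mod_two hℓ, cast_eq_neg_one hℓ]
    generalize (-1 : ZMod 3) ^ m = c
    revert c
    decide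
  · rw [h.rootTrace_of_mem_odd hg hj, h.sign_eq_of_mod_two hℓ, neg_neg]

theorem neg_rootTrace_of_mem_even (h : PrimitiveRootSetting ℓ m M F) (hℓ : ℓ % 3 = 2)
    (hg : ∀ x : Fˣ, x ∈ Subgroup.zpowers g) {j : ℕ}
    (hj : j ∈ {ℓ ^ m} ∪ setJ13 ℓ m ∪ setJ33 ℓ m) : -rootTrace ℓ m M g j = -(-1) ^ m := by
  rw [Set.union_assoc] at hj
  rcases hj with hj | hj
  · rw [Set.mem_singleton_iff.1 hj, h.rootTrace_half hg, h.sign_eq_of_mod_two hℓ,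
      cast_eq_neg_one hℓ]
    generalize (-1 : ZMod 3) ^ m = c
    revert c
    decide
  · rw [h.rootTrace_of_mem_even hg hj, h.sign_eq_of_mod_two hℓ, neg_neg]

end PrimitiveRootSetting

theorem neg_one_pow_eq_of_even_add {m : ℕ} (hα : α ≠ 0) (h : Even (m + signExp α)) :
    (-1 : ZMod 3) ^ m = α := by
  rw [signExp_spec α hα]
  rw [Nat.even_add] at h
  have h' : signExp ((-1 : ZMod 3) ^ signExp α) = signExp α := by rw [← signExp_spec α hα]
  rcases Nat.even_or_odd m with h1 | h1
  · rw [h1.neg_one_pow, (h.1 h1).neg_one_pow]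
  · have h2 : Odd (signExp α) := by
      rw [← Nat.not_even_iff_odd] at h1 ⊢
      exact fun h3 => h1 (h.2 h3)
    rw [h1.neg_one_pow, h2.neg_one_pow]

theorem neg_one_pow_eq_of_odd_add {m : ℕ} (hα : α ≠ 0) (h : Odd (m + signExp α)) :
    -(-1 : ZMod 3) ^ m = α := by
  have h1 : Even (m + 1 + signExp α) := by
    rw [add_right_comm]
    exact h.add_one
  rw [← neg_one_pow_eq_of_even_add hα h1, pow_succ, mul_neg_one]

theorem eq_of_signExp_eq_zero (h : signExp α = 0) : α = 1 := by
  revert α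
  decide

theorem eq_of_signExp_eq_one (hα : α ≠ 0) (h : signExp α = 1) : α = -1 := by
  revert α
  decide

theorem neg_ne_self_of_ne_zero (hα : α ≠ 0) : -α ≠ α := by
  revert α
  decide

end TernaryCode

/-! ### Assembly of the weight distributions -/

open TernaryCode

set_option maxHeartbeats 1600000

theorem theorem4p2 (ℓ m : ℕ) (hℓ : ℓ.Prime) (hodd : Odd ℓ) (hm : 1 ≤ m)
    (hprim : orderOf (3 : ZMod (2 * ℓ ^ m)) = Nat.totient (2 * ℓ ^ m))
    {F : Type*} [Field F] [Fintype F] [Algebra (ZMod 3) F]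
    (hF : Fintype.card F = 3 ^ Nat.totient (2 * ℓ ^ m))
    (g : Fˣ) (hg : ∀ x : Fˣ, x ∈ Subgroup.zpowers g)
    (α : ZMod 3) (β : F)
    (q s L : ℝ) (hq : q = (Fintype.card F : ℝ)) (hs : s = Real.sqrt q) (hL : L = (ℓ : ℝ)) :
    -- part (a)
    (β = 0 →
      (α = 0 → m = 1 → ℓ % 3 = 2 → definingSet (2 * ℓ ^ m) α β = ∅) ∧
      (α = 0 → ℓ % 3 = 1 →
        HasWeightDistribution (code ℓ m α β)
          ((L ^ m - L + 1) * (q - 1) / L ^ m)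
          ((ℓ - 1) * ℓ ^ (m - 1))
          [(2 * (L ^ m - L + 1) * q / (3 * L ^ m) - 2 * (L - 1) * s / (3 * L ^ m),
            (L ^ m - L + 1) * (q - 1) / L ^ m),
           (2 * (L ^ m - L + 1) * q / (3 * L ^ m) + 2 * (L ^ m - L + 1) * s / (3 * L ^ m),
            (L - 1) * (q - 1) / L ^ m)]) ∧
      (α ≠ 0 → ℓ % 3 = 1 →
        HasWeightDistribution (code ℓ m α β)
          ((L - 1) * (q - 1) / (2 * L ^ m))
          ((ℓ - 1) * ℓ ^ (m - 1))
          [((L - 1) * q / (3 * L ^ m) + (L - 1) * s / (3 * L ^ m),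
            (2 * L ^ m - L + 1) * (q - 1) / (2 * L ^ m)),
           ((L - 1) * q / (3 * L ^ m) - (2 * L ^ m - L + 1) * s / (3 * L ^ m),
            (L - 1) * (q - 1) / (2 * L ^ m))]) ∧
      (α = 0 → ℓ % 3 = 2 → 2 ≤ m →
        HasWeightDistribution (code ℓ m α β)
          ((L ^ (m - 1) - 1) * (q - 1) / L ^ (m - 1))
          ((ℓ - 1) * ℓ ^ (m - 1))
          [(2 * (L ^ (m - 1) - 1) * q / (3 * L ^ (m - 1))
              + 2 * (L ^ (m - 1) - 1) * s / (3 * L ^ (m - 1)),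
            (q - 1) / L ^ (m - 1)),
           (2 * (L ^ (m - 1) - 1) * q / (3 * L ^ (m - 1)) - 2 * s / (3 * L ^ (m - 1)),
            (L ^ (m - 1) - 1) * (q - 1) / L ^ (m - 1))]) ∧
      (α ≠ 0 → ℓ % 3 = 2 →
        HasWeightDistribution (code ℓ m α β)
          ((q - 1) / (2 * L ^ (m - 1)))
          ((ℓ - 1) * ℓ ^ (m - 1))
          [(q / (3 * L ^ (m - 1)) + s / (3 * L ^ (m - 1)),
            (2 * L ^ (m - 1) - 1) * (q - 1) / (2 * L ^ (m - 1))),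
           (q / (3 * L ^ (m - 1)) - (2 * L ^ (m - 1) - 1) * s / (3 * L ^ (m - 1)),
            (q - 1) / (2 * L ^ (m - 1)))])) ∧
    -- part (b)
    (β ≠ 0 → α = 0 →
      (m = 1 → ℓ % 3 = 2 →
        HasWeightDistribution (code ℓ m α β)
          (q / 3)
          ((ℓ - 1) * ℓ ^ (m - 1))
          [(q / 3, 2), (2 * q / 9, q - 3)]) ∧
      (ℓ % 3 = 1 → jRes ℓ m g β ∈ setJp ℓ m →
        HasWeightDistribution (code ℓ m α β)
          (q / 3 + (L - 1) * s / L ^ m + (-L ^ m + L - 1) / L ^ m)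
          ((ℓ - 1) * ℓ ^ (m - 1))
          [((L - 1) * (q + s) / (3 * L ^ m), 2),
           (2 * q / 9,
            (L ^ m - L + 1) ^ 2 * q / L ^ (2 * m)
              - (L - 1) * (L ^ m - 2 * L + 2) * s / L ^ (2 * m)
              + (L - 1) * (L ^ m + L - 1) / L ^ (2 * m) - 3),
           (2 * q / 9 + s / 3,
            2 * (L - 1) * (L ^ m - L + 1) * q / L ^ (2 * m)
              + 2 * (L - 1) * (L ^ m - 2 * L + 2) * s / L ^ (2 * m)
              - 2 * (L - 1) ^ 2 / L ^ (2 * m)),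
           (2 * q / 9 + 2 * s / 3,
            (L - 1) ^ 2 * q / L ^ (2 * m)
              + (L - 1) * (-L ^ m + 2 * L - 2) * s / L ^ (2 * m)
              + (L - 1) * (-L ^ m + L - 1) / L ^ (2 * m))]) ∧
      (ℓ % 3 = 1 → jRes ℓ m g β ∈ setJ ℓ m \ setJp ℓ m →
        HasWeightDistribution (code ℓ m α β)
          (q / 3 + (-L ^ m + L - 1) * (s + 1) / L ^ m)
          ((ℓ - 1) * ℓ ^ (m - 1))
          [((L - 1) * (q + s) / (3 * L ^ m) - s / 3, 2),
           (2 * q / 9,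
            (L - 1) ^ 2 * q / L ^ (2 * m)
              + (L - 1) * (-3 * L ^ m + 2 * L - 2) * s / L ^ (2 * m) + s
              + (L - 1) * (-3 * L ^ m + L - 1) / L ^ (2 * m) - 1),
           (2 * q / 9 - s / 3,
            2 * (L - 1) * (L ^ m - L + 1) * q / L ^ (2 * m)
              + 2 * (L - 1) * (3 * L ^ m - 2 * L + 2) * s / L ^ (2 * m) - 2 * s
              + 2 * (L - 1) * (2 * L ^ m - L + 1) / L ^ (2 * m) - 2),
           (2 * q / 9 - 2 * s / 3,
            (L - 1) * (-2 * L ^ m + L - 1) * q / L ^ (2 * m) + q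
              + (L - 1) * (-3 * L ^ m + 2 * L - 2) * s / L ^ (2 * m) + s
              + (L - 1) * (-L ^ m + L - 1) / L ^ (2 * m))]) ∧
      (2 ≤ m → ℓ % 3 = 2 → jRes ℓ m g β ∈ setJpp ℓ m →
        HasWeightDistribution (code ℓ m α β)
          (q / 3 + s / L ^ (m - 1) + (1 - L ^ (m - 1)) / L ^ (m - 1))
          ((ℓ - 1) * ℓ ^ (m - 1))
          [((q + s) / (3 * L ^ (m - 1)), 2),
           (2 * q / 9,
            (L ^ (m - 1) - 1) ^ 2 * q / L ^ (2 * m - 2)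
              + (2 - L ^ (m - 1)) * s / L ^ (2 * m - 2)
              + (L ^ (m - 1) + 1) / L ^ (2 * m - 2) - 3),
           (2 * q / 9 + s / 3,
            2 * (L ^ (m - 1) - 1) * q / L ^ (2 * m - 2)
              + 2 * (L ^ (m - 1) - 2) * s / L ^ (2 * m - 2)
              - 2 / L ^ (2 * m - 2)),
           (2 * q / 9 + 2 * s / 3,
            q / L ^ (2 * m - 2)
              + (2 - L ^ (m - 1)) * s / L ^ (2 * m - 2)
              + (1 - L ^ (m - 1)) / L ^ (2 * m - 2))]) ∧
      (2 ≤ m → ℓ % 3 = 2 → jRes ℓ m g β ∈ setJ ℓ m \ setJpp ℓ m →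
        HasWeightDistribution (code ℓ m α β)
          (q / 3 + (1 - L ^ (m - 1)) * (s + 1) / L ^ (m - 1))
          ((ℓ - 1) * ℓ ^ (m - 1))
          [(q / (3 * L ^ (m - 1)) + (1 - L ^ (m - 1)) * s / (3 * L ^ (m - 1)), 2),
           (2 * q / 9,
            q / L ^ (2 * m - 2)
              + (2 - 3 * L ^ (m - 1)) * s / L ^ (2 * m - 2) + s
              + (1 - 3 * L ^ (m - 1)) / L ^ (2 * m - 2) - 1),
           (2 * q / 9 - s / 3,
            2 * (L ^ (m - 1) - 1) * q / L ^ (2 * m - 2)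
              + 2 * (3 * L ^ (m - 1) - 2) * s / L ^ (2 * m - 2) - 2 * s
              + 2 * (2 * L ^ (m - 1) - 1) / L ^ (2 * m - 2) - 2),
           (2 * q / 9 - 2 * s / 3,
            (1 - 2 * L ^ (m - 1)) * q / L ^ (2 * m - 2) + q
              + (2 - 3 * L ^ (m - 1)) * s / L ^ (2 * m - 2) + s
              + (1 - L ^ (m - 1)) / L ^ (2 * m - 2))])) ∧
    -- part (c)
    (β ≠ 0 → α ≠ 0 →
      (m = 1 → ℓ = 5 →
        ((signExp α = 0 ∧ jRes ℓ m g β ∈ {0} ∪ setJ12 ℓ m ∪ setJ32 ℓ m) ∨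
          (signExp α = 1 ∧ jRes ℓ m g β ∈ {5} ∪ setJ13 ℓ m ∪ setJ33 ℓ m)) →
        HasWeightDistribution (code ℓ m α β) 22 4 [(12, 22), (18, 18), (15, 40)]) ∧
      (ℓ % 3 = 1 →
        (jRes ℓ m g β ∈ setJp ℓ m ∨
          (signExp α = 0 ∧ jRes ℓ m g β ∈ setJ13 ℓ m ∪ setJ33 ℓ m) ∨
          (signExp α = 1 ∧ jRes ℓ m g β ∈ setJ12 ℓ m ∪ setJ32 ℓ m)) →
        HasWeightDistribution (code ℓ m α β)
          (q / 3 + (1 - L) * (s + 1) / (2 * L ^ m))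
          ((ℓ - 1) * ℓ ^ (m - 1))
          [((2 * L ^ m - L + 1) * q / (6 * L ^ m) + (1 - L) * s / (6 * L ^ m), 2),
           (2 * q / 9,
            (L - 1) * (-4 * L ^ m + L - 1) * q / (4 * L ^ (2 * m)) + q
              + (L - 1) * (-L ^ m + L - 1) * s / (2 * L ^ (2 * m))
              + (L - 1) * (2 * L ^ m + L - 1) / (4 * L ^ (2 * m)) - 3),
           (2 * q / 9 - s / 3,
            (L - 1) * (2 * L ^ m - L + 1) * q / (2 * L ^ (2 * m))
              + (L - 1) * (L ^ m - L + 1) * s / L ^ (2 * m)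
              - (L - 1) ^ 2 / (2 * L ^ (2 * m))),
           (2 * q / 9 - 2 * s / 3,
            (L - 1) ^ 2 * q / (4 * L ^ (2 * m))
              + (L - 1) * (-L ^ m + L - 1) * s / (2 * L ^ (2 * m))
              + (L - 1) * (-2 * L ^ m + L - 1) / (4 * L ^ (2 * m)))]) ∧
      (ℓ % 3 = 1 →
        ((signExp α = 1 ∧ jRes ℓ m g β ∈ setJ13 ℓ m ∪ setJ33 ℓ m) ∨
          (signExp α = 0 ∧ jRes ℓ m g β ∈ setJ12 ℓ m ∪ setJ32 ℓ m)) →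
        HasWeightDistribution (code ℓ m α β)
          ((q + 3 * s) / 3 + (1 - L) * (s + 1) / (2 * L ^ m))
          ((ℓ - 1) * ℓ ^ (m - 1))
          [((2 * L ^ m - L + 1) * (q + s) / (6 * L ^ m), 2),
           (2 * q / 9,
            (L - 1) ^ 2 * q / (4 * L ^ (2 * m))
              + (L - 1) * (-3 * L ^ m + L - 1) * s / (2 * L ^ (2 * m)) + s
              + (L - 1) * (-6 * L ^ m + L - 1) / (4 * L ^ (2 * m)) - 1),
           (2 * q / 9 + s / 3,
            (L - 1) * (2 * L ^ m - L + 1) * q / (2 * L ^ (2 * m))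
              + (L - 1) * (3 * L ^ m - L + 1) * s / L ^ (2 * m) - 2 * s
              + (L - 1) * (4 * L ^ m - L + 1) / (2 * L ^ (2 * m)) - 2),
           (2 * q / 9 + 2 * s / 3,
            (L - 1) * (L - 1 - 4 * L ^ m) * q / (4 * L ^ (2 * m)) + q
              + (L - 1) * (-3 * L ^ m + L - 1) * s / (2 * L ^ (2 * m)) + s
              + (L - 1) * (L - 1 - 2 * L ^ m) / (4 * L ^ (2 * m)))]) ∧
      (ℓ % 3 = 2 → ℓ ^ m ≠ 5 →
        (jRes ℓ m g β ∈ setJpp ℓ m ∨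
          (Even (m + signExp α) ∧ jRes ℓ m g β ∈ {ℓ ^ m} ∪ setJ13 ℓ m ∪ setJ33 ℓ m) ∨
          (Odd (m + signExp α) ∧ jRes ℓ m g β ∈ {0} ∪ setJ12 ℓ m ∪ setJ32 ℓ m)) →
        HasWeightDistribution (code ℓ m α β)
          (q / 3 - (s + 1) / (2 * L ^ (m - 1)))
          ((ℓ - 1) * ℓ ^ (m - 1))
          [(((2 * L ^ (m - 1) - 1) * q - s) / (6 * L ^ (m - 1)), 2),
           (2 * q / 9,
            (-4 * L ^ (m - 1) + 1) * q / (4 * L ^ (2 * m - 2)) + q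
              + (1 - L ^ (m - 1)) * s / (2 * L ^ (2 * m - 2))
              + (2 * L ^ (m - 1) + 1) / (4 * L ^ (2 * m - 2)) - 3),
           (2 * q / 9 - s / 3,
            (2 * L ^ (m - 1) - 1) * q / (2 * L ^ (2 * m - 2))
              + (L ^ (m - 1) - 1) * s / L ^ (2 * m - 2)
              - 1 / (2 * L ^ (2 * m - 2))),
           (2 * q / 9 - 2 * s / 3,
            q / (4 * L ^ (2 * m - 2))
              + (1 - L ^ (m - 1)) * s / (2 * L ^ (2 * m - 2))
              + (1 - 2 * L ^ (m - 1)) / (4 * L ^ (2 * m - 2)))]) ∧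
      (ℓ % 3 = 2 →
        ((Even (m + signExp α) ∧ jRes ℓ m g β ∈ {0} ∪ setJ12 ℓ m ∪ setJ32 ℓ m) ∨
          (Odd (m + signExp α) ∧ jRes ℓ m g β ∈ {ℓ ^ m} ∪ setJ13 ℓ m ∪ setJ33 ℓ m)) →
        HasWeightDistribution (code ℓ m α β)
          ((q + 3 * s) / 3 - (s + 1) / (2 * L ^ (m - 1)))
          ((ℓ - 1) * ℓ ^ (m - 1))
          [((2 * L ^ (m - 1) - 1) * (q + s) / (6 * L ^ (m - 1)), 2),
           (2 * q / 9,
            q / (4 * L ^ (2 * m - 2))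
              + (1 - 3 * L ^ (m - 1)) * s / (2 * L ^ (2 * m - 2)) + s
              + (1 - 6 * L ^ (m - 1)) / (4 * L ^ (2 * m - 2)) - 1),
           (2 * q / 9 + s / 3,
            (2 * L ^ (m - 1) - 1) * q / (2 * L ^ (2 * m - 2))
              + (3 * L ^ (m - 1) - 1) * s / L ^ (2 * m - 2) - 2 * s
              + (4 * L ^ (m - 1) - 1) / (2 * L ^ (2 * m - 2)) - 2),
           (2 * q / 9 + 2 * s / 3,
            (1 - 4 * L ^ (m - 1)) * q / (4 * L ^ (2 * m - 2)) + q
              + (1 - 3 * L ^ (m - 1)) * s / (2 * L ^ (2 * m - 2)) + s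
              + (1 - 2 * L ^ (m - 1)) / (4 * L ^ (2 * m - 2)))])) := by
  have : CharP F 3 := charP_three F
  have h3 : ℓ % 3 ≠ 0 := by
    intro h0
    have h1 := coprime_three hℓ hprim
    have h2 : (3 : ℕ) ∣ 2 * ℓ ^ m :=
      dvd_mul_of_dvd_right (dvd_pow (Nat.dvd_of_mod_eq_zero h0) (by lia)) 2
    have h4 := Nat.Coprime.eq_one_of_dvd h1 h2
    lia
  obtain ⟨M, hM⟩ := dvd_three_pow_add_one hℓ hodd hm hprim
  have h : PrimitiveRootSetting ℓ m M F := ⟨hℓ, hodd, hm, h3, hprim, hF, hM⟩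
  have hk : Module.finrank (ZMod 3) F = (ℓ - 1) * ℓ ^ (m - 1) := by
    rw [finrank_eq_of_card hF, totient_two_mul_prime_pow hℓ hodd hm]
  have hqR : q = (3 ^ halfTotient ℓ m) ^ 2 := by
    rw [hq, h.card_eq]
    push_cast
    rfl
  have hsR : s = 3 ^ halfTotient ℓ m := by
    rw [hs, hqR, Real.sqrt_sq (by positivity)]
  have hM1 := h.one_le_quot
  have hM0 : (M : ℝ) ≠ 0 := by
    have : (0 : ℝ) < M := by exact_mod_cast hM1
    exact this.ne'
  have hL0 : L ≠ 0 := by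
    rw [hL]
    exact_mod_cast hℓ.ne_zero
  obtain ⟨X, hX⟩ : ∃ X, L ^ m = X := ⟨_, rfl⟩
  obtain ⟨Y, hY⟩ : ∃ Y, L ^ (m - 1) = Y := ⟨_, rfl⟩
  have hXY : X = L * Y := by rw [← hX, ← hY, ← pow_succ', Nat.sub_add_cancel hm]
  have hX0 : X ≠ 0 := hX ▸ pow_ne_zero _ hL0
  have hY0 : Y ≠ 0 := hY ▸ pow_ne_zero _ hL0
  have hX2 : L ^ (2 * m) = X ^ 2 := by rw [← hX, ← pow_mul, mul_comm]
  have hY2 : L ^ (2 * m - 2) = Y ^ 2 := by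
    rw [← hY, ← pow_mul]
    congr 1
    lia
  -- Through √q = 2XM - 1 all parameters become rational functions of M, L and X or Y, so the
  -- claimed formulas reduce to field identities.
  have hS : (3 : ℝ) ^ halfTotient ℓ m = 2 * X * M - 1 := by
    rw [← hX, hL, eq_sub_iff_add_eq]
    exact_mod_cast hM
  have hle := h.le_pow
  have h5 := h.five_le
  have hkap : ((M * (ℓ - 1) : ℕ) : ℝ) = M * (L - 1) := by
    rw [hL]
    push_cast [Nat.cast_sub hℓ.one_le]
    ring
  have hkap0 : ((2 * M * (ℓ ^ m - (ℓ - 1)) : ℕ) : ℝ) = 2 * M * (X - L + 1) := by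
    rw [← hX, hL]
    push_cast [Nat.cast_sub hℓ.one_le, Nat.cast_sub ((Nat.sub_le ℓ 1).trans hle)]
    ring
  have hkap' : ((M * ℓ : ℕ) : ℝ) = M * L := by
    rw [hL]
    push_cast
    ring
  have hkap0' : ((2 * M * (ℓ ^ m - ℓ) : ℕ) : ℝ) = 2 * M * (X - L) := by
    rw [← hX, hL]
    push_cast [Nat.cast_sub hle]
    ring
  have hb : 3 ≤ M * (ℓ - 1) ∧ M * (ℓ - 1) + 1 ≤ 3 ^ halfTotient ℓ m :=
    zeroLines_bounds hM (by lia) ((Nat.sub_le ℓ 1).trans hle) hM1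
  have hb' : 3 ≤ M * ℓ ∧ M * ℓ + 1 ≤ 3 ^ halfTotient ℓ m :=
    zeroLines_bounds hM (by lia) hle hM1
  have hb0 : ℓ % 3 = 1 → 3 ≤ 2 * M * (ℓ ^ m - (ℓ - 1)) ∧
      2 * M * (ℓ ^ m - (ℓ - 1)) + 1 ≤ 3 ^ halfTotient ℓ m := fun h1 =>
    zeroLines_bounds' hM (by lia) ((Nat.sub_le ℓ 1).trans hle) hM1 (by
      have := h.two_le_quot h1
      have : (2 * 2) * 1 ≤ 2 * M * (ℓ ^ m - (ℓ - 1)) := Nat.mul_le_mul (by lia) (by lia)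
      lia)
  have hb0' : 2 ≤ m → 3 ≤ 2 * M * (ℓ ^ m - ℓ) ∧
      2 * M * (ℓ ^ m - ℓ) + 1 ≤ 3 ^ halfTotient ℓ m := fun h2 =>
    zeroLines_bounds' hM (by lia) hle hM1 (by
      have h4 : ℓ ^ 2 ≤ ℓ ^ m := Nat.pow_le_pow_right (by lia) h2
      have h6 : 2 * ℓ ≤ ℓ ^ 2 := by rw [sq]; exact Nat.mul_le_mul_right _ (by lia)
      have : (2 * 1) * 2 ≤ 2 * M * (ℓ ^ m - ℓ) := Nat.mul_le_mul (by lia) (by lia)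
      lia)
  have hv := add_one_sub_three_mul (A := ℓ - 1) h.quot_eq_int
  have hv0 := add_one_sub_three_mul' h.quot_eq_int ((Nat.sub_le ℓ 1).trans hle)
  have hw := add_one_sub_three_mul (A := ℓ) h.quot_eq_int
  have hw0 := add_one_sub_three_mul' h.quot_eq_int hle
  have hd1 := fun h1 => h.discriminant_of_mod_one h1
  have hd2 := fun h1 => h.discriminant_of_mod_two h1
  have hd5 := h.discriminant_le
  have hjlt : jRes ℓ m g β < 2 * ℓ ^ m := jRes_lt hℓ.pos β
  refine ⟨?_, ?_, ?_⟩
  · rintro rfl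
    refine ⟨?_, ?_, ?_, ?_, ?_⟩
    · rintro rfl rfl h1
      -- For m = 1 the number of zero lines 2M(ℓ^m - ℓ) is 0.
      have hlen := (h.phaseData_zero_of_mod_two h1 hg).length_of_eq_zero
      rw [pow_one, Nat.sub_self, mul_zero, Nat.cast_zero, mul_zero] at hlen
      rw [definingSet_eq_phaseSet, ← Finset.card_eq_zero]
      exact_mod_cast hlen
    · rintro rfl h1
      refine hasWeightDistribution_code ((((h.phaseData_zero_of_mod_one h1 hg
        ).hasWeightDistribution_of_eq_zero hk (by have := hb0 h1; lia) (by have := hb0 h1; lia)).perm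
        (List.Perm.swap _ _ _)).congr_two ?_ ?_ ?_ ?_ ?_) <;>
      · simp only [hqR, hsR, hkap0, hX, hS]
        try field_simp
        try ring
    · intro hα h1
      refine hasWeightDistribution_code (((h.phaseData_of_mod_one h1 hg hα
        ).hasWeightDistribution_of_eq_zero hk (by lia) (by lia)).congr_two ?_ ?_ ?_ ?_ ?_) <;>
      · simp only [hqR, hsR, hkap, hX, hS]
        try field_simp
        try ring
    · rintro rfl h1 h2
      refine hasWeightDistribution_code (((h.phaseData_zero_of_mod_two h1 hg
        ).hasWeightDistribution_of_eq_zero hk (by have := hb0' h2; lia)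
          (by have := hb0' h2; lia)).congr_two ?_ ?_ ?_ ?_ ?_) <;>
      · simp only [hqR, hsR, hkap0', hY, hS, hXY]
        try field_simp
        try ring
    · intro hα h1
      refine hasWeightDistribution_code (((h.phaseData_of_mod_two h1 hg hα
        ).hasWeightDistribution_of_eq_zero hk (by lia) (by lia)).congr_two ?_ ?_ ?_ ?_ ?_) <;>
      · simp only [hqR, hsR, hkap', hY, hS, hXY]
        try field_simp
        try ring
  · rintro hβ rfl
    refine ⟨?_, ?_, ?_, ?_, ?_⟩
    · rintro rfl h1
      have hD := h.phaseData_zero_of_mod_two h1 hg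
      rw [pow_one, Nat.sub_self, mul_zero] at hD
      refine hasWeightDistribution_code ((hD.hasWeightDistribution_of_no_line hβ hk).congr_two
        ?_ ?_ rfl ?_ ?_) <;> rw [hqR]
    · intro h1 hj
      have hχ := h.zeroInd_eq_of_mod_one h1 hg hβ 0
      rw [if_pos ((h.rootTrace_eq_zero_iff_of_mod_one h1 hg hjlt).2 hj)] at hχ
      have hd := hd1 h1
      refine hasWeightDistribution_code (((h.phaseData_zero_of_mod_one h1 hg
        ).hasWeightDistribution_of_mem hβ hk hχ (hb0 h1).1 (hb0 h1).2 (by lia) (by lia)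
          (by lia)).congr_four ?_ ?_ ?_ ?_ ?_ ?_ ?_ ?_) <;>
      · simp only [hqR, hsR, hkap0, hX, hX2, hS]
        try field_simp
        try ring
    · intro h1 hj
      have hχ := h.zeroInd_eq_of_mod_one h1 hg hβ 0
      rw [if_neg fun h0 => hj.2 ((h.rootTrace_eq_zero_iff_of_mod_one h1 hg hjlt).1 h0)] at hχ
      have hd := hd1 h1
      refine hasWeightDistribution_code (((h.phaseData_zero_of_mod_one h1 hg
        ).hasWeightDistribution_of_not_mem hβ hk hχ (hb0 h1).1 (hb0 h1).2 (by lia) (by lia)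
          (by lia)).congr_four ?_ ?_ ?_ ?_ ?_ ?_ ?_ ?_) <;>
      · simp only [hqR, hsR, hkap0, hX, hX2, hS]
        try field_simp
        try ring
    · intro h2 h1 hj
      have hχ := h.zeroInd_eq_of_mod_two h1 hg hβ 0
      rw [(h.rootTrace_eq_zero_iff_of_mod_two h1 hg hjlt).2 hj, neg_zero, if_pos rfl] at hχ
      refine hasWeightDistribution_code (((h.phaseData_zero_of_mod_two h1 hg
        ).hasWeightDistribution_of_mem hβ hk hχ (hb0' h2).1 (hb0' h2).2 (by lia) (by lia)
          (by lia)).congr_four ?_ ?_ ?_ ?_ ?_ ?_ ?_ ?_) <;>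
      · simp only [hqR, hsR, hkap0', hY, hY2, hS, hXY]
        try field_simp
        try ring
    · intro h2 h1 hj
      have hχ := h.zeroInd_eq_of_mod_two h1 hg hβ 0
      rw [if_neg fun h0 => hj.2 ((h.rootTrace_eq_zero_iff_of_mod_two h1 hg hjlt).1
        (neg_eq_zero.1 h0))] at hχ
      refine hasWeightDistribution_code (((h.phaseData_zero_of_mod_two h1 hg
        ).hasWeightDistribution_of_not_mem hβ hk hχ (hb0' h2).1 (hb0' h2).2 (by lia) (by lia)
          (by lia)).congr_four ?_ ?_ ?_ ?_ ?_ ?_ ?_ ?_) <;>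
      · simp only [hqR, hsR, hkap0', hY, hY2, hS, hXY]
        try field_simp
        try ring
  · intro hβ hα
    have hneg := neg_ne_self_of_ne_zero hα
    refine ⟨?_, ?_, ?_, ?_, ?_⟩
    · rintro rfl rfl hj
      have h1 : 5 % 3 = 2 := rfl
      have hχ := h.zeroInd_eq_of_mod_two h1 hg hβ α
      have hne : -PrimitiveRootSetting.rootTrace 5 1 M g (jRes 5 1 g β) ≠ α := by
        rcases hj with ⟨h0, hj⟩ | ⟨h0, hj⟩
        · rw [h.neg_rootTrace_of_mem_odd h1 hg hj, eq_of_signExp_eq_zero h0]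
          decide
        · rw [h.neg_rootTrace_of_mem_even h1 hg hj, eq_of_signExp_eq_one hα h0]
          decide
      rw [if_neg hne] at hχ
      have hD := h.phaseData_of_mod_two h1 hg hα
      have hf2 : halfTotient 5 1 = 2 := rfl
      -- Here s = 9 and s + 1 = 10 = 2ℓ^m, so κ = 5 and s + 1 - 3κ = -5, the forbidden value for
      -- χ(β) = 0.
      have hM' : M = 1 := by
        rw [hf2] at hM
        lia
      subst hM'
      exact hasWeightDistribution_code (hD.hasWeightDistribution_exceptional hβ hk hχ)
    · intro h1 hj
      have hc : (ℓ : ZMod 3) ^ (m - 1) = 1 := by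
        rw [PrimitiveRootSetting.cast_eq_one h1, one_pow]
      have hχ := h.zeroInd_eq_of_mod_one h1 hg hβ α
      have hne : PrimitiveRootSetting.rootTrace ℓ m M g (jRes ℓ m g β) ≠ α := by
        rcases hj with hj | ⟨h0, hj⟩ | ⟨h0, hj⟩
        · rw [(h.rootTrace_eq_zero_iff_of_mod_one h1 hg hjlt).2 hj]
          exact hα.symm
        · rw [h.rootTrace_of_mem_even hg hj, eq_of_signExp_eq_zero h0, hc]
          decide
        · rw [h.rootTrace_of_mem_odd hg hj, eq_of_signExp_eq_one hα h0, hc]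
          decide
      rw [if_neg hne] at hχ
      have hd := hd1 h1
      refine hasWeightDistribution_code (((h.phaseData_of_mod_one h1 hg hα
        ).hasWeightDistribution_of_not_mem hβ hk hχ hb.1 hb.2 (by lia) (by lia)
          (by lia)).congr_four ?_ ?_ ?_ ?_ ?_ ?_ ?_ ?_) <;>
      · simp only [hqR, hsR, hkap, hX, hX2, hS]
        try field_simp
        try ring
    · intro h1 hj
      have hc : (ℓ : ZMod 3) ^ (m - 1) = 1 := by
        rw [PrimitiveRootSetting.cast_eq_one h1, one_pow]
      have hχ := h.zeroInd_eq_of_mod_one h1 hg hβ α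
      have heq : PrimitiveRootSetting.rootTrace ℓ m M g (jRes ℓ m g β) = α := by
        rcases hj with ⟨h0, hj⟩ | ⟨h0, hj⟩
        · rw [h.rootTrace_of_mem_even hg hj, eq_of_signExp_eq_one hα h0, hc]
        · rw [h.rootTrace_of_mem_odd hg hj, eq_of_signExp_eq_zero h0, hc]
      rw [if_pos heq] at hχ
      have hd := hd1 h1
      refine hasWeightDistribution_code (((h.phaseData_of_mod_one h1 hg hα
        ).hasWeightDistribution_of_mem hβ hk hχ hb.1 hb.2 (by lia) (by lia)
          (by lia)).congr_four ?_ ?_ ?_ ?_ ?_ ?_ ?_ ?_) <;>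
      · simp only [hqR, hsR, hkap, hX, hX2, hS]
        try field_simp
        try ring
    · intro h1 hne5 hj
      have hχ := h.zeroInd_eq_of_mod_two h1 hg hβ α
      have hne : -PrimitiveRootSetting.rootTrace ℓ m M g (jRes ℓ m g β) ≠ α := by
        rcases hj with hj | ⟨h0, hj⟩ | ⟨h0, hj⟩
        · rw [(h.rootTrace_eq_zero_iff_of_mod_two h1 hg hjlt).2 hj, neg_zero]
          exact hα.symm
        · rw [h.neg_rootTrace_of_mem_even h1 hg hj, neg_one_pow_eq_of_even_add hα h0]
          exact hneg
        · rw [h.neg_rootTrace_of_mem_odd h1 hg hj, ← neg_neg ((-1 : ZMod 3) ^ m),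
            neg_one_pow_eq_of_odd_add hα h0]
          exact hneg
      rw [if_neg hne] at hχ
      have hd := hd2 hne5
      refine hasWeightDistribution_code (((h.phaseData_of_mod_two h1 hg hα
        ).hasWeightDistribution_of_not_mem hβ hk hχ hb'.1 hb'.2 (by lia) (by lia)
          (by lia)).congr_four ?_ ?_ ?_ ?_ ?_ ?_ ?_ ?_) <;>
      · simp only [hqR, hsR, hkap', hY, hY2, hS, hXY]
        try field_simp
        try ring
    · intro h1 hj
      have hχ := h.zeroInd_eq_of_mod_two h1 hg hβ α
      have heq : -PrimitiveRootSetting.rootTrace ℓ m M g (jRes ℓ m g β) = α := by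
        rcases hj with ⟨h0, hj⟩ | ⟨h0, hj⟩
        · rw [h.neg_rootTrace_of_mem_odd h1 hg hj, neg_one_pow_eq_of_even_add hα h0]
        · rw [h.neg_rootTrace_of_mem_even h1 hg hj, neg_one_pow_eq_of_odd_add hα h0]
      rw [if_pos heq] at hχ
      refine hasWeightDistribution_code (((h.phaseData_of_mod_two h1 hg hα
        ).hasWeightDistribution_of_mem hβ hk hχ hb'.1 hb'.2 (by lia) (by lia)
          (by lia)).congr_four ?_ ?_ ?_ ?_ ?_ ?_ ?_ ?_) <;>
      · simp only [hqR, hsR, hkap', hY, hY2, hS, hXY]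
        try field_simp
        try ring
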